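/- Let $d\ge 1$ and $1\le p\le 2$. Fix a window $0\neq g\in\mathcal S(\mathbb R^d)$, let $V_gf(x,y)=(2\pi)^{-d/2}\langle f,M_yT_xg\rangle$ be the short-time Fourier transform of $f\in\mathcal S'(\mathbb R^d)$, where $M_yT_xg(t)=e^{iy\cdot t}g(t-x)$ and $\langle\cdot,\cdot\rangle$ extends the $L^2$ inner product, and let $M^{r,q}(\mathbb R^d)$ be the modulation space of all $f\in\mathcal S'(\mathbb R^d)$ with $\|f\|_{M^{r,q}}=\big\|\,\|V_gf(x,y)\|_{L^r_x}\big\|_{L^q_y}<\infty$. Let $K\in M^{\infty,1}(\mathbb R^d)$ (the Sjöstrand class) be real-valued, and let $u_0\in M^{p,p}(\mathbb R^d)$. Then there exists exactly one $u\in C([0,\infty),M^{p,p}(\mathbb R^d))$ that solves $$ i\partial_tu-Hu=(K*|u|^2)\,u,\qquad H=-\Delta+|x|^2,\qquad u(0)=u_0, $$ on $[0,\infty)$. Here the equation is understood in $\mathcal S'(\mathbb R^d)$ at every time: for every $t\ge0$, $K$ and $u(t)$ are given by locally integrable functions for which the convolution $K*|u(t)|^2$ converges almost everywhere and $(K*|u(t)|^2)u(t)$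 defines a tempered distribution, and for every $\varphi\in\mathcal S(\mathbb R^d)$ the function $s\mapsto\langle u(s),\varphi\rangle$ is differentiable at $t$ (from the right if $t=0$) with $$ i\,\frac{d}{dt}\langle u(t),\varphi\rangle-\langle Hu(t),\varphi\rangle=\langle (K*|u(t)|^2)u(t),\varphi\rangle , $$ where in this formula $\langle\cdot,\varphi\rangle$ denotes the bilinear action of a tempered distribution on $\varphi$. -/

import Mathlib

open MeasureTheory Filter Topology
open scoped ENNReal SchwartzMap Laplacian Convolution ComplexConjugate

namespace HarmonicNLS

noncomputable section

/-- The Euclidean space `ℝ^d`. -/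
abbrev Rd (d : ℕ) : Type := EuclideanSpace ℝ (Fin d)

/-- The character `t ↦ e^{i y·t}` has temperate growth, so multiplication by it acts on Schwartz
functions. -/
theorem hasTemperateGrowth_character {d : ℕ} (y : Rd d) :
    (fun t : Rd d => Complex.exp (Complex.I * (inner ℝ y t : ℝ))).HasTemperateGrowth := by
  have h1 : (fun s : ℝ => Complex.exp (Complex.I * (s : ℂ))).HasTemperateGrowth := by
    refine ⟨(contDiff_const.mul Complex.ofRealCLM.contDiff).cexp, fun n => ⟨0, 1, fun s => ?_⟩⟩
    have hder : ∀ n : ℕ, iteratedDeriv n (fun s : ℝ => Complex.exp (Complex.I * (s : ℂ)))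
        = fun s : ℝ => Complex.I ^ n * Complex.exp (Complex.I * (s : ℂ)) := by
      intro n
      induction n with
      | zero => simp
      | succ n ih =>
        rw [iteratedDeriv_succ, ih]
        funext s
        have h : HasDerivAt (fun s : ℝ => Complex.I ^ n * Complex.exp (Complex.I * (s : ℂ)))
            (Complex.I ^ n * (Complex.exp (Complex.I * (s : ℂ)) * (Complex.I * 1))) s :=
          (((Complex.ofRealCLM.hasDerivAt (x := s)).const_mul Complex.I).cexp).const_mul _
        rw [h.deriv]
        ring
    rw [norm_iteratedFDeriv_eq_norm_iteratedDeriv, hder]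
    simp [mul_comm Complex.I (s : ℂ), Complex.norm_exp_ofReal_mul_I]
  exact h1.comp (Function.hasTemperateGrowth_inner_right y)

/-- Complex conjugation of Schwartz functions. -/
def conjS {d : ℕ} (g : 𝓢(Rd d, ℂ)) : 𝓢(Rd d, ℂ) :=
  SchwartzMap.postcompCLM (𝕜 := ℝ) (Complex.conjCLE : ℂ →L[ℝ] ℂ) g

/-- The translation `T_x g (t) = g (t - x)`. -/
def translation {d : ℕ} (x : Rd d) (g : 𝓢(Rd d, ℂ)) : 𝓢(Rd d, ℂ) :=
  SchwartzMap.compSubConstCLM ℂ x g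

/-- The modulation `M_y g (t) = e^{i y·t} g (t)`. -/
def modulation {d : ℕ} (y : Rd d) (g : 𝓢(Rd d, ℂ)) : 𝓢(Rd d, ℂ) :=
  SchwartzMap.smulLeftCLM ℂ (fun t : Rd d => Complex.exp (Complex.I * (inner ℝ y t : ℝ))) g

theorem conjS_apply {d : ℕ} (g : 𝓢(Rd d, ℂ)) (t : Rd d) : conjS g t = conj (g t) := rfl

theorem translation_apply {d : ℕ} (x : Rd d) (g : 𝓢(Rd d, ℂ)) (t : Rd d) :
    translation x g t = g (t - x) := rfl

theorem modulation_apply {d : ℕ} (y : Rd d) (g : 𝓢(Rd d, ℂ)) (t : Rd d) :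
    modulation y g t = Complex.exp (Complex.I * (inner ℝ y t : ℝ)) * g t := by
  rw [modulation, SchwartzMap.smulLeftCLM_apply_apply (hasTemperateGrowth_character y),
    smul_eq_mul]

/-- The short-time Fourier transform
`V_g f (x, y) = (2π)^{-d/2} ⟨f, M_y T_x g⟩` of a tempered distribution `f`, where `⟨·, ·⟩` extends
the `L²` inner product (conjugate linear in the second slot). -/
def stft {d : ℕ} (g : 𝓢(Rd d, ℂ)) (f : 𝓢'(Rd d, ℂ)) (x y : Rd d) : ℂ :=
  (((2 * Real.pi) ^ (-(d : ℝ) / 2) : ℝ) : ℂ) * f (conjS (modulation y (translation x g)))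

/-- The modulation-space norm `‖ ‖V_g f (x, y)‖_{L^p_x} ‖_{L^q_y}` with window `g`. -/
def modNorm {d : ℕ} (g : 𝓢(Rd d, ℂ)) (p q : ℝ≥0∞) (f : 𝓢'(Rd d, ℂ)) : ℝ≥0∞ :=
  eLpNorm (fun y : Rd d => eLpNorm (fun x : Rd d => stft g f x y) p volume) q volume

/-- The modulation space `M^{p,q}(ℝ^d)` (with window `g`). -/
def modSpace {d : ℕ} (g : 𝓢(Rd d, ℂ)) (p q : ℝ≥0∞) : Set 𝓢'(Rd d, ℂ) :=
  {f | modNorm g p q f < ∞}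

/-- `u ∈ C([0,∞), M^{p,q}(ℝ^d))`; the values of `u` at negative times are irrelevant. -/
def ContinuousInModSpace {d : ℕ} (g : 𝓢(Rd d, ℂ)) (p q : ℝ≥0∞) (u : ℝ → 𝓢'(Rd d, ℂ)) : Prop :=
  (∀ t, 0 ≤ t → u t ∈ modSpace g p q) ∧
    ∀ t, 0 ≤ t → Tendsto (fun s => modNorm g p q (u s - u t)) (𝓝[Set.Ici 0] t) (𝓝 0)

/-- The tempered distribution `T` is (integration against) the locally integrable function `f`. -/
def IsFunction {d : ℕ} (T : 𝓢'(Rd d, ℂ)) (f : Rd d → ℂ) : Prop :=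
  LocallyIntegrable f volume ∧
    ∀ φ : 𝓢(Rd d, ℂ), Integrable (fun x => φ x * f x) volume ∧ T φ = ∫ x, φ x * f x

/-- A tempered distribution is real if it is real on real-valued Schwartz functions. -/
def IsReal {d : ℕ} (T : 𝓢'(Rd d, ℂ)) : Prop :=
  ∀ φ : 𝓢(Rd d, ℂ), (∀ x, (φ x).im = 0) → (T φ).im = 0

/-- `N = (K * |v|²) v`: here `K` and `v` are given by functions `k` and `f`, the convolution
integral `(k * |f|²)(x)` converges for almost every `x`, and `N` is given by the function
`(k * |f|²) f`. -/
def IsHartree {d : ℕ} (K v N : 𝓢'(Rd d, ℂ)) : Prop :=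
  ∃ k f : Rd d → ℂ, IsFunction K k ∧ IsFunction v f ∧
    (∀ᵐ x, ConvolutionExistsAt k (fun y => ((‖f y‖ ^ 2 : ℝ) : ℂ)) x
      (ContinuousLinearMap.mul ℂ ℂ) volume) ∧
    IsFunction N (fun x =>
      (k ⋆[ContinuousLinearMap.mul ℂ ℂ, volume] (fun y => ((‖f y‖ ^ 2 : ℝ) : ℂ))) x * f x)

/-- The harmonic oscillator `H v = -Δ v + |x|² v` on tempered distributions. -/
def harmonicOscillator {d : ℕ} (v : 𝓢'(Rd d, ℂ)) : 𝓢'(Rd d, ℂ) :=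
  -(Δ v) + TemperedDistribution.smulLeftCLM ℂ (fun x : Rd d => ((‖x‖ ^ 2 : ℝ) : ℂ)) v

/-- `∂_t u (t) = w` in the sense of tempered distributions, for `u` defined on `[0,∞)` (the
derivative is one-sided at `t = 0`). -/
def HasTimeDeriv {d : ℕ} (u : ℝ → 𝓢'(Rd d, ℂ)) (w : 𝓢'(Rd d, ℂ)) (t : ℝ) : Prop :=
  ∀ φ : 𝓢(Rd d, ℂ), HasDerivWithinAt (fun s => u s φ) (w φ) (Set.Ici 0) t

/-- `u` solves `i ∂_t u - H u = (K * |u|²) u` on `[0,∞)` with `u(0) = u₀`, the equation being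
understood in the sense of tempered distributions at every time. -/
def IsGlobalSolution {d : ℕ} (K u₀ : 𝓢'(Rd d, ℂ)) (u : ℝ → 𝓢'(Rd d, ℂ)) : Prop :=
  u 0 = u₀ ∧ ∀ t, 0 ≤ t → ∃ w N : 𝓢'(Rd d, ℂ), HasTimeDeriv u w t ∧ IsHartree K (u t) N ∧
    Complex.I • w - harmonicOscillator (u t) = N

end

end HarmonicNLS

/-! The proof rests on the coherent-state transform `ba`, the short-time Fourier transform with
Gaussian window and a symmetric phase. By `ba_coh` the overlap of two coherent states depends only
on the symplectic form and the Euclidean distance of their centres, so a rotation of phase space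
preserves the range of the transform. With Moyal's identity `inner_baL`, rotation by `2t` times
`e^{-idt}` pulls back to a unitary group `prop` on `L²`, and `hasDerivAt_prop` identifies it as the
flow of `-iH`. Rotations preserve measure, so `prop t` is also isometric for the `L^p` norm of the
transform, which is equivalent to the `M^{p,p}` norm for every window (`exists_window_kernel`). For
`p ≤ 2` that space embeds in `L²` (`eLpNorm_two_le_of_le_convolution`, `exists_eq_dist2`).

A Sjöstrand potential is a bounded function `k`. Multiplication by `k * (conj f · h)` has matrix
coefficients between coherent states dominated by a convolution kernel on phase space whose mass is
a constant times `‖f‖ ‖h‖`, with `L²` norms only. Young's inequality then gives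
`eLpNorm_ba_mult_le`: the multiplier acts boundedly on `M^{p,p}`, with a bound that does not involve
the modulation norms of `f` and `h`.

Existence: in the interaction picture `w(t) = e^{itH} u(t)` the equation is an ordinary differential
equation in `L²` with locally Lipschitz field. As `k` is real the `L²` norm is conserved, so the
flow is global (`exists_flow`). With `u` inserted in the potential the equation becomes linear with
coefficients bounded uniformly in time; it is solved globally among `L²` functions with transform in
`L^p`, and uniqueness in `L²` identifies the two solutions (`exists_graph_lift`).

Uniqueness: a distributional solution in `C([0,∞), M^{p,p})` is a continuous `L²` curve. Testing the
equation against evolving coherent states, which stay Schwartz functions, differentiates the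
transform of `e^{itH} v(t)` at each phase-space point. By `eq_add_integral_of_ba` this yields the
integral equation in `L²`, whose solution is unique (`solution_eq_flow`). -/

namespace HarmonicNLS

noncomputable section

/-! ### Weak integrals of Schwartz functions -/

section WeakIntegral

open LineDeriv

variable {E : Type*} [NormedAddCommGroup E] [NormedSpace ℝ E]

/-- A family of Schwartz functions all of whose seminorms are integrable. -/
def SchwartzIntegrable {W : Type*} [MeasurableSpace W] (Φ : W → 𝓢(E, ℂ)) (μ : Measure W) : Prop :=
  ∀ k n, Integrable (fun w => SchwartzMap.seminorm ℂ k n (Φ w)) μ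

theorem continuous_schwartzSeminorm (k n : ℕ) :
    Continuous (SchwartzMap.seminorm ℂ k n : 𝓢(E, ℂ) → ℝ) :=
  (schwartz_withSeminorms ℂ E ℂ).continuous_seminorm (k, n)

theorem exists_schwartzSeminorm_bound (A : 𝓢(E, ℂ) →L[ℂ] 𝓢(E, ℂ)) (k n : ℕ) :
    ∃ (s : Finset (ℕ × ℕ)) (C : ℝ), 0 ≤ C ∧ ∀ f, SchwartzMap.seminorm ℂ k n (A f) ≤
      C * ∑ i ∈ s, SchwartzMap.seminorm ℂ i.1 i.2 f := by
  obtain ⟨s, C, -, hC⟩ := Seminorm.bound_of_continuous (schwartz_withSeminorms ℂ E ℂ)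
    ((SchwartzMap.seminorm ℂ k n : Seminorm ℂ 𝓢(E, ℂ)).comp (A : 𝓢(E, ℂ) →ₗ[ℂ] 𝓢(E, ℂ)))
    ((continuous_schwartzSeminorm k n).comp A.continuous)
  refine ⟨s, C, C.2, fun f => (hC f).trans ?_⟩
  rw [smul_apply, NNReal.smul_def, smul_eq_mul]
  refine mul_le_mul_of_nonneg_left ?_ C.2
  exact Seminorm.finset_sup_apply_le (Finset.sum_nonneg fun i _ => apply_nonneg _ _) fun i hi =>
    Finset.single_le_sum (f := fun i : ℕ × ℕ => SchwartzMap.seminorm ℂ i.1 i.2 f)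
      (fun i _ => apply_nonneg _ _) hi

variable {W : Type*} [MeasurableSpace W] [TopologicalSpace W] [OpensMeasurableSpace W]
  {μ : Measure W}

theorem SchwartzIntegrable.comp_clm {Φ : W → 𝓢(E, ℂ)} (hΦ : Continuous Φ)
    (hint : SchwartzIntegrable Φ μ) (A : 𝓢(E, ℂ) →L[ℂ] 𝓢(E, ℂ)) :
    SchwartzIntegrable (fun w => A (Φ w)) μ := by
  intro k n
  obtain ⟨s, C, -, hC⟩ := exists_schwartzSeminorm_bound A k n
  refine Integrable.mono' ((integrable_finsetSum s fun i _ => hint i.1 i.2).const_mul C)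
    ((continuous_schwartzSeminorm k n).comp (A.continuous.comp hΦ)).aestronglyMeasurable
    (ae_of_all _ fun w => ?_)
  rw [Real.norm_of_nonneg (apply_nonneg _ _)]
  exact hC (Φ w)

theorem continuous_schwartz_eval (x : E) : Continuous fun f : 𝓢(E, ℂ) => f x :=
  (BoundedContinuousFunction.lipschitz_eval_const x).continuous.comp
    (SchwartzMap.toBoundedContinuousFunctionCLM ℂ E ℂ).continuous

theorem SchwartzIntegrable.integrable_eval {Φ : W → 𝓢(E, ℂ)} (hΦ : Continuous Φ)
    (hint : SchwartzIntegrable Φ μ) (x : E) : Integrable (fun w => Φ w x) μ :=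
  (hint 0 0).mono' ((continuous_schwartz_eval x).comp hΦ).aestronglyMeasurable
    (ae_of_all _ fun w => SchwartzMap.norm_le_seminorm ℂ (Φ w) x)

/-- Differentiation under the integral: the sup norm of `∂_v (Φ w)` is a majorant that does not
depend on the point, and it is integrable because continuous operators preserve
`SchwartzIntegrable`. -/
theorem lineDeriv_eq_integral {Φ : W → 𝓢(E, ℂ)} (hΦ : Continuous Φ)
    (hint : SchwartzIntegrable Φ μ) {φ : 𝓢(E, ℂ)} (hφ : ∀ x, φ x = ∫ w, Φ w x ∂μ) (v x : E) :
    ∂_{v} φ x = ∫ w, ∂_{v} (Φ w) x ∂μ := by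
  have hΦ' : Continuous fun w => ∂_{v} (Φ w) := (lineDerivOpCLM ℂ 𝓢(E, ℂ) v).continuous.comp hΦ
  have hint' : SchwartzIntegrable (fun w => ∂_{v} (Φ w)) μ :=
    hint.comp_clm hΦ (lineDerivOpCLM ℂ 𝓢(E, ℂ) v)
  have hd : ∀ (f : 𝓢(E, ℂ)) (t : ℝ), HasDerivAt (fun t : ℝ => f (x + t • v))
      (∂_{v} f (x + t • v)) t := by
    intro f t
    rw [SchwartzMap.lineDerivOp_apply_eq_fderiv]
    have h1 : HasDerivAt (fun t : ℝ => x + t • v) v t := by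
      simpa using ((hasDerivAt_id t).smul_const v).const_add x
    exact (f.hasFDerivAt (x + t • v)).comp_hasDerivAt t h1
  have key : HasDerivAt (fun t : ℝ => ∫ w, Φ w (x + t • v) ∂μ)
      (∫ w, ∂_{v} (Φ w) (x + (0 : ℝ) • v) ∂μ) 0 := by
    refine (hasDerivAt_integral_of_dominated_loc_of_deriv_le (F := fun t w => Φ w (x + t • v))
      (F' := fun t w => ∂_{v} (Φ w) (x + t • v))
      (bound := fun w => SchwartzMap.seminorm ℂ 0 0 (∂_{v} (Φ w))) univ_mem
      (Eventually.of_forall fun t => ?_) (hint.integrable_eval hΦ _) ?_ ?_ (hint' 0 0) ?_).2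
    · exact ((continuous_schwartz_eval _).comp hΦ).aestronglyMeasurable
    · exact ((continuous_schwartz_eval _).comp hΦ').aestronglyMeasurable
    · exact ae_of_all _ fun w t _ => SchwartzMap.norm_le_seminorm ℂ (∂_{v} (Φ w)) _
    · exact ae_of_all _ fun w t _ => hd (Φ w) t
  have h2 := hd φ 0
  simp only [hφ] at h2
  simpa using h2.unique key

theorem iteratedLineDeriv_eq_integral {Φ : W → 𝓢(E, ℂ)} (hΦ : Continuous Φ)
    (hint : SchwartzIntegrable Φ μ) {φ : 𝓢(E, ℂ)} (hφ : ∀ x, φ x = ∫ w, Φ w x ∂μ)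
    {n : ℕ} (m : Fin n → E) (x : E) :
    ∂^{m} φ x = ∫ w, ∂^{m} (Φ w) x ∂μ := by
  induction n generalizing x with
  | zero => simpa using hφ x
  | succ n ih =>
    simp only [iteratedLineDerivOp_succ_left]
    exact lineDeriv_eq_integral ((iteratedLineDerivOpCLM ℂ 𝓢(E, ℂ) (Fin.tail m)).continuous.comp hΦ)
      (hint.comp_clm hΦ (iteratedLineDerivOpCLM ℂ 𝓢(E, ℂ) (Fin.tail m))) (ih (Fin.tail m)) (m 0) x

/-- The points at which a finite set of Schwartz seminorms is tested: a seminorm, a point and a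
tuple of vectors in the unit ball. -/
def SeminormTest (E : Type*) [NormedAddCommGroup E] (s : Finset (ℕ × ℕ)) : Type _ :=
  Σ i : s, E × (Fin i.1.2 → Metric.closedBall (0 : E) 1)

/-- With the discrete topology every bounded function of the test points is continuous, so the test
values of a Schwartz function form an element of a Banach space. -/
instance (s : Finset (ℕ × ℕ)) : TopologicalSpace (SeminormTest E s) := ⊥

instance (s : Finset (ℕ × ℕ)) : DiscreteTopology (SeminormTest E s) := ⟨rfl⟩

/-- The value `‖x‖ ^ k * D^n f x (m₁, …, mₙ)`. -/
def testValue {s : Finset (ℕ × ℕ)} (f : 𝓢(E, ℂ)) (a : SeminormTest E s) : ℂ :=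
  (‖a.2.1‖ ^ a.1.1.1 : ℝ) * ∂^{fun j => (a.2.2 j : E)} f a.2.1

theorem norm_testValue_le {s : Finset (ℕ × ℕ)} (f : 𝓢(E, ℂ)) (a : SeminormTest E s) :
    ‖testValue f a‖ ≤ SchwartzMap.seminorm ℂ a.1.1.1 a.1.1.2 f := by
  rw [testValue, norm_mul, Complex.norm_real, norm_pow, norm_norm,
    SchwartzMap.iteratedLineDerivOp_eq_iteratedFDeriv]
  refine le_trans ?_ (SchwartzMap.le_seminorm ℂ a.1.1.1 a.1.1.2 f a.2.1)
  refine mul_le_mul_of_nonneg_left ?_ (by positivity)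
  refine (ContinuousMultilinearMap.le_opNorm _ _).trans ?_
  refine mul_le_of_le_one_right (norm_nonneg _) (Finset.prod_le_one (fun _ _ => norm_nonneg _) ?_)
  intro j _
  exact mem_closedBall_zero_iff.1 (a.2.2 j).2

/-- The bounded function of all test values of a Schwartz function. -/
def testFunction (s : Finset (ℕ × ℕ)) :
    𝓢(E, ℂ) →ₗ[ℂ] BoundedContinuousFunction (SeminormTest E s) ℂ where
  toFun f := BoundedContinuousFunction.ofNormedAddCommGroupDiscrete (testValue f)
    (∑ i ∈ s, SchwartzMap.seminorm ℂ i.1 i.2 f) fun a => (norm_testValue_le f a).trans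
      (Finset.single_le_sum (f := fun i : ℕ × ℕ => SchwartzMap.seminorm ℂ i.1 i.2 f)
        (fun _ _ => apply_nonneg _ _) a.1.2)
  map_add' f g := by
    ext a
    simp [testValue, iteratedLineDerivOp_add, mul_add]
  map_smul' c f := by
    ext a
    simp [testValue, iteratedLineDerivOp_smul, mul_left_comm]

theorem testFunction_apply (s : Finset (ℕ × ℕ)) (f : 𝓢(E, ℂ)) (a : SeminormTest E s) :
    testFunction s f a = testValue f a := rfl

theorem norm_testFunction_le (s : Finset (ℕ × ℕ)) (f : 𝓢(E, ℂ)) :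
    ‖testFunction s f‖ ≤ ∑ i ∈ s, SchwartzMap.seminorm ℂ i.1 i.2 f :=
  (BoundedContinuousFunction.norm_le (Finset.sum_nonneg fun _ _ => apply_nonneg _ _)).2 fun a =>
    (norm_testValue_le f a).trans
      (Finset.single_le_sum (f := fun i : ℕ × ℕ => SchwartzMap.seminorm ℂ i.1 i.2 f)
        (fun _ _ => apply_nonneg _ _) a.1.2)

theorem continuous_testFunction (s : Finset (ℕ × ℕ)) :
    Continuous (testFunction s : 𝓢(E, ℂ) →ₗ[ℂ] _) := by
  refine continuous_of_continuousAt_zero (testFunction s) ?_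
  rw [ContinuousAt, map_zero]
  refine squeeze_zero_norm (norm_testFunction_le s) ?_
  have : Continuous fun f : 𝓢(E, ℂ) => ∑ i ∈ s, SchwartzMap.seminorm ℂ i.1 i.2 f :=
    continuous_finsetSum _ fun i _ => continuous_schwartzSeminorm _ _
  simpa using this.tendsto 0

/-- Multilinearity allows each argument of the derivative to be normalised to length one. Together
with `norm_testFunction_le`, the sup norm of the test values is thus equivalent to the chosen finite
sum of seminorms. -/
theorem seminorm_le_norm_testFunction {s : Finset (ℕ × ℕ)} {i : ℕ × ℕ} (hi : i ∈ s)
    (f : 𝓢(E, ℂ)) : SchwartzMap.seminorm ℂ i.1 i.2 f ≤ ‖testFunction s f‖ := by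
  refine SchwartzMap.seminorm_le_bound ℂ _ _ f (norm_nonneg _) fun x => ?_
  have h1 : ∀ m : Fin i.2 → E, (∀ j, ‖m j‖ ≤ 1) →
      ‖x‖ ^ i.1 * ‖iteratedFDeriv ℝ i.2 f x m‖ ≤ ‖testFunction s f‖ := by
    intro m hm
    let a : SeminormTest E s := ⟨⟨i, hi⟩, x, fun j => ⟨m j, mem_closedBall_zero_iff.2 (hm j)⟩⟩
    have := (testFunction s f).norm_coe_le_norm a
    rw [testFunction_apply, testValue, SchwartzMap.iteratedLineDerivOp_eq_iteratedFDeriv, norm_mul,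
      Complex.norm_real, norm_pow, norm_norm] at this
    exact this
  have h : ‖(‖x‖ ^ i.1 : ℝ) • iteratedFDeriv ℝ i.2 f x‖ ≤ ‖testFunction s f‖ := by
    refine ContinuousMultilinearMap.opNorm_le_bound (norm_nonneg _) fun m => ?_
    have h2 := h1 (fun j => ‖m j‖⁻¹ • m j) fun j => by
      rw [norm_smul, norm_inv, norm_norm]
      exact inv_mul_le_one
    rw [smul_apply, norm_smul, norm_pow, norm_norm]
    by_cases h0 : ∃ j, m j = 0
    · obtain ⟨j, hj⟩ := h0
      rw [ContinuousMultilinearMap.map_coord_zero _ j hj, norm_zero, mul_zero]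
      positivity
    · push Not at h0
      have hpos : 0 < ∏ j, ‖m j‖ := Finset.prod_pos fun j _ => norm_pos_iff.2 (h0 j)
      rw [ContinuousMultilinearMap.map_smul_univ, norm_smul, Finset.prod_inv_distrib, norm_inv,
        Real.norm_of_nonneg hpos.le, mul_left_comm, inv_mul_le_iff₀ hpos] at h2
      rwa [mul_comm (‖testFunction s f‖)]
  rwa [norm_smul, norm_pow, norm_norm] at h

/-- Tempered distributions commute with weak integrals of Schwartz functions. -/
theorem temperedDistribution_integral [SecondCountableTopology W]
    (T : 𝓢'(E, ℂ)) {Φ : W → 𝓢(E, ℂ)} (hΦ : Continuous Φ) (hint : SchwartzIntegrable Φ μ)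
    (φ : 𝓢(E, ℂ)) (hφ : ∀ x, φ x = ∫ w, Φ w x ∂μ) :
    T φ = ∫ w, T (Φ w) ∂μ := by
  obtain ⟨s, C, -, hC⟩ := Seminorm.bound_of_continuous (schwartz_withSeminorms ℂ E ℂ)
    ((normSeminorm ℂ ℂ).comp (T : 𝓢(E, ℂ) →ₗ[ℂ] ℂ)) (continuous_norm.comp (map_continuous T))
  -- The order `(0, 0)` is added to make the map `J` injective.
  set s' : Finset (ℕ × ℕ) := insert (0, 0) s with hs'
  let J := testFunction (E := E) s'
  have hbound : ∀ f, ‖T f‖ ≤ C * ‖J f‖ := by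
    intro f
    refine (hC f).trans ?_
    rw [smul_apply, NNReal.smul_def, smul_eq_mul]
    refine mul_le_mul_of_nonneg_left ?_ C.2
    exact Seminorm.finset_sup_apply_le (norm_nonneg _) fun i hi =>
      seminorm_le_norm_testFunction (Finset.mem_insert_of_mem hi) f
  have hJinj : Function.Injective J := by
    refine (injective_iff_map_eq_zero J).2 fun f hf => ?_
    ext x
    have h := (SchwartzMap.norm_le_seminorm ℂ f x).trans
      (seminorm_le_norm_testFunction (s := s') (i := (0, 0)) (Finset.mem_insert_self _ _) f)
    rw [show testFunction s' f = 0 from hf, norm_zero] at h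
    simpa using h
  let eJ := LinearEquiv.ofInjective J hJinj
  -- Being bounded by finitely many seminorms, `T` factors through the range of `J`. Hahn–Banach
  -- extends it to the whole Banach space, where continuous functionals commute with the Bochner
  -- integral.
  let F₀ : StrongDual ℂ (LinearMap.range J) :=
    LinearMap.mkContinuous ((T : 𝓢(E, ℂ) →ₗ[ℂ] ℂ) ∘ₗ eJ.symm.toLinearMap) C (fun v => by
      obtain ⟨f, rfl⟩ := eJ.surjective v
      have h2 : ((eJ f : LinearMap.range J) : _) = J f := LinearEquiv.ofInjective_apply J f
      rw [LinearMap.comp_apply, LinearEquiv.coe_coe, LinearEquiv.symm_apply_apply]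
      have := hbound f
      rw [← h2] at this
      exact this)
  obtain ⟨F, hF, -⟩ := exists_extension_norm_eq (LinearMap.range J) F₀
  have hFJ : ∀ f, F (J f) = T f := by
    intro f
    have h1 := hF (eJ f)
    have h2 : ((eJ f : LinearMap.range J) : _) = J f := LinearEquiv.ofInjective_apply J f
    rw [h2] at h1
    rw [h1]
    simp [F₀]
  have hJint : Integrable (fun w => J (Φ w)) μ :=
    Integrable.mono' (integrable_finsetSum s' (fun i _ => hint i.1 i.2))
      ((continuous_testFunction s').comp hΦ).aestronglyMeasurable
      (ae_of_all _ fun w => norm_testFunction_le _ _)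
  have hJφ : J φ = ∫ w, J (Φ w) ∂μ := by
    ext a
    have h1 := (BoundedContinuousFunction.evalCLM ℂ a).integral_comp_comm hJint
    simp only [BoundedContinuousFunction.evalCLM_apply] at h1
    rw [← h1]
    simp only [J, testFunction_apply, testValue]
    rw [integral_const_mul, iteratedLineDeriv_eq_integral hΦ hint hφ]
  rw [← hFJ, hJφ, ← F.integral_comp_comm hJint]
  simp only [hFJ]

end WeakIntegral

/-! ### Time-frequency shifts of Schwartz functions -/

section TimeFrequencyShift

open FourierTransform

variable {d : ℕ}

/-- The sum of the Schwartz seminorms of order at most `(k, n)`. -/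
def seminormSum (k n : ℕ) (g : 𝓢(Rd d, ℂ)) : ℝ :=
  ∑ i ∈ Finset.Iic (k, n), SchwartzMap.seminorm ℂ i.1 i.2 g

theorem seminormSum_nonneg (k n : ℕ) (g : 𝓢(Rd d, ℂ)) : 0 ≤ seminormSum k n g :=
  Finset.sum_nonneg fun _ _ => apply_nonneg _ _

theorem continuous_seminormSum (k n : ℕ) : Continuous (seminormSum k n : 𝓢(Rd d, ℂ) → ℝ) :=
  continuous_finsetSum _ fun _ _ => continuous_schwartzSeminorm _ _

theorem seminormSum_zero (k n : ℕ) : seminormSum k n (0 : 𝓢(Rd d, ℂ)) = 0 := by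
  simp [seminormSum]

theorem one_add_norm_pow_mul_le (k n : ℕ) (g : 𝓢(Rd d, ℂ)) (x : Rd d) :
    (1 + ‖x‖) ^ k * ‖iteratedFDeriv ℝ n g x‖ ≤ 2 ^ k * seminormSum k n g := by
  refine (SchwartzMap.one_add_le_sup_seminorm_apply (𝕜 := ℂ) (m := (k, n)) le_rfl le_rfl g x).trans
    (mul_le_mul_of_nonneg_left ?_ (by positivity))
  exact Seminorm.finset_sup_apply_le (seminormSum_nonneg k n g) fun i hi =>
    Finset.single_le_sum (f := fun i : ℕ × ℕ => SchwartzMap.seminorm ℂ i.1 i.2 g)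
      (fun i _ => apply_nonneg _ _) hi

theorem one_add_norm_le_mul (x t : Rd d) : 1 + ‖t‖ ≤ (1 + ‖x‖) * (1 + ‖t - x‖) := by
  have h : ‖t‖ ≤ ‖t - x‖ + ‖x‖ := by simpa using norm_add_le (t - x) x
  nlinarith [norm_nonneg x, norm_nonneg (t - x)]

theorem seminorm_translation_le (k n : ℕ) (x : Rd d) (g : 𝓢(Rd d, ℂ)) :
    SchwartzMap.seminorm ℂ k n (translation x g) ≤ (1 + ‖x‖) ^ k * (2 ^ k * seminormSum k n g) := by
  have hs := seminormSum_nonneg k n g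
  refine SchwartzMap.seminorm_le_bound ℂ _ _ _ (by positivity) fun t => ?_
  have h1 : iteratedFDeriv ℝ n (translation x g) t = iteratedFDeriv ℝ n g (t - x) :=
    iteratedFDeriv_comp_sub n x t
  rw [h1]
  calc ‖t‖ ^ k * ‖iteratedFDeriv ℝ n g (t - x)‖
      ≤ ((1 + ‖x‖) * (1 + ‖t - x‖)) ^ k * ‖iteratedFDeriv ℝ n g (t - x)‖ := by
        gcongr
        linarith [one_add_norm_le_mul x t]
    _ = (1 + ‖x‖) ^ k * ((1 + ‖t - x‖) ^ k * ‖iteratedFDeriv ℝ n g (t - x)‖) := by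
        rw [mul_pow]; ring
    _ ≤ _ := mul_le_mul_of_nonneg_left (one_add_norm_pow_mul_le k n g (t - x)) (by positivity)

/-- Mean value inequality on the segment from `t` to `t - h`, at the price of one derivative. As
`‖h‖ ≤ 1`, the weight at `t` is comparable with the weight at every point of the segment; this
produces the second factor `2 ^ k`. -/
theorem seminorm_translation_sub_le (k n : ℕ) {h : Rd d} (hh : ‖h‖ ≤ 1) (g : 𝓢(Rd d, ℂ)) :
    SchwartzMap.seminorm ℂ k n (translation h g - g) ≤
      2 ^ k * (2 ^ k * seminormSum k (n + 1) g) * ‖h‖ := by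
  have hs := seminormSum_nonneg k (n + 1) g
  refine SchwartzMap.seminorm_le_bound ℂ _ _ _ (by positivity) fun t => ?_
  have h1 : iteratedFDeriv ℝ n (translation h g - g) t
      = iteratedFDeriv ℝ n g (t - h) - iteratedFDeriv ℝ n g t := by
    have : (⇑(translation h g - g) : Rd d → ℂ) = (⇑(translation h g) - ⇑g) := by ext; simp
    rw [this, iteratedFDeriv_sub_apply ((translation h g).smooth n).contDiffAt
      (g.smooth n).contDiffAt]
    congr 1
    exact iteratedFDeriv_comp_sub n h t
  have hdiff : Differentiable ℝ (iteratedFDeriv ℝ n g) := (g.smooth ⊤).differentiable_iteratedFDeriv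
    (mod_cast ENat.natCast_lt_top n)
  have h2 : ‖‖t‖ ^ k • iteratedFDeriv ℝ n g (t - h) - ‖t‖ ^ k • iteratedFDeriv ℝ n g t‖ ≤
      2 ^ k * (2 ^ k * seminormSum k (n + 1) g) * ‖t - h - t‖ := by
    refine (convex_segment t (t - h)).norm_image_sub_le_of_norm_fderiv_le
      (f := fun s => ‖t‖ ^ k • iteratedFDeriv ℝ n g s) (𝕜 := ℝ)
      (fun s _ => (hdiff s).fun_const_smul _) (fun s hs => ?_) (left_mem_segment _ _ _)
      (right_mem_segment _ _ _)
    have hst : ‖t - s‖ ≤ 1 := by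
      obtain ⟨a, b, ha, hb, hab, rfl⟩ := hs
      have : t - (a • t + b • (t - h)) = b • h := by
        have ha' : a = 1 - b := by linarith
        rw [ha']; module
      rw [this, norm_smul, Real.norm_of_nonneg hb]
      nlinarith [norm_nonneg h]
    have ht : ‖t‖ ≤ 2 * (1 + ‖s‖) := by
      have : ‖t‖ ≤ ‖t - s‖ + ‖s‖ := by simpa using norm_add_le (t - s) s
      linarith [norm_nonneg s]
    rw [fderiv_fun_const_smul (hdiff s), norm_smul, norm_pow, norm_norm, norm_fderiv_iteratedFDeriv]
    calc ‖t‖ ^ k * ‖iteratedFDeriv ℝ (n + 1) g s‖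
        ≤ (2 * (1 + ‖s‖)) ^ k * ‖iteratedFDeriv ℝ (n + 1) g s‖ := by gcongr
      _ = 2 ^ k * ((1 + ‖s‖) ^ k * ‖iteratedFDeriv ℝ (n + 1) g s‖) := by rw [mul_pow]; ring
      _ ≤ _ := mul_le_mul_of_nonneg_left (one_add_norm_pow_mul_le k (n + 1) g s) (by positivity)
  rw [← smul_sub, norm_smul, norm_pow, norm_norm] at h2
  rw [h1]
  simpa using h2

theorem translation_add (x y : Rd d) (g : 𝓢(Rd d, ℂ)) :
    translation (x + y) g = translation x (translation y g) := by
  ext t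
  simp only [translation_apply]
  congr 1
  abel

theorem translation_sub_right (x : Rd d) (g h : 𝓢(Rd d, ℂ)) :
    translation x (g - h) = translation x g - translation x h :=
  map_sub (SchwartzMap.compSubConstCLM ℂ x) g h

theorem tendsto_schwartz_iff {α : Type*} {l : Filter α} {f : α → 𝓢(Rd d, ℂ)} {g : 𝓢(Rd d, ℂ)} :
    Tendsto f l (𝓝 g) ↔
      ∀ k n, Tendsto (fun a => SchwartzMap.seminorm ℂ k n (f a - g)) l (𝓝 0) := by
  rw [(schwartz_withSeminorms ℂ (Rd d) ℂ).tendsto_nhds]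
  refine ⟨fun h k n => ?_, fun h i ε hε => ?_⟩
  · rw [Metric.tendsto_nhds]
    intro ε hε
    filter_upwards [h (k, n) ε hε] with a ha
    simpa [abs_of_nonneg (apply_nonneg (SchwartzMap.seminorm ℂ k n) (f a - g))] using ha
  · have := (h i.1 i.2).eventually (gt_mem_nhds hε)
    exact this

/-- Translation is jointly continuous on `ℝ^d × 𝓢`. -/
theorem continuous_translation :
    Continuous fun a : Rd d × 𝓢(Rd d, ℂ) => translation a.1 a.2 := by
  refine continuous_iff_continuousAt.2 fun ⟨x₀, g₀⟩ => ?_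
  rw [ContinuousAt, tendsto_schwartz_iff]
  intro k n
  have hx : Tendsto (fun a : Rd d × 𝓢(Rd d, ℂ) => a.1) (𝓝 (x₀, g₀)) (𝓝 x₀) :=
    continuous_fst.tendsto _
  have hg : Tendsto (fun a : Rd d × 𝓢(Rd d, ℂ) => a.2) (𝓝 (x₀, g₀)) (𝓝 g₀) :=
    continuous_snd.tendsto _
  have hlim : Tendsto (fun a : Rd d × 𝓢(Rd d, ℂ) =>
      (1 + ‖a.1‖) ^ k * (2 ^ k * seminormSum k n (a.2 - g₀)) +
        2 ^ k * (2 ^ k * seminormSum k (n + 1) (translation x₀ g₀)) * ‖a.1 - x₀‖)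
      (𝓝 (x₀, g₀)) (𝓝 ((1 + ‖x₀‖) ^ k * (2 ^ k * seminormSum k n (g₀ - g₀)) +
        2 ^ k * (2 ^ k * seminormSum k (n + 1) (translation x₀ g₀)) * ‖x₀ - x₀‖)) :=
    (((hx.norm.const_add 1).pow k).mul
      (((continuous_seminormSum k n).tendsto _ |>.comp (hg.sub_const g₀)).const_mul _)).add
      ((hx.sub_const x₀).norm.const_mul _)
  simp only [sub_self, seminormSum_zero, norm_zero, mul_zero, add_zero] at hlim
  refine squeeze_zero' (Eventually.of_forall fun a => apply_nonneg _ _) ?_ hlim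
  have hev : ∀ᶠ a : Rd d × 𝓢(Rd d, ℂ) in 𝓝 (x₀, g₀), ‖a.1 - x₀‖ ≤ 1 := by
    have := (hx.sub_const x₀).norm
    simp only [sub_self, norm_zero] at this
    filter_upwards [this.eventually (gt_mem_nhds one_pos)] with a ha using ha.le
  filter_upwards [hev] with a ha
  have : translation a.1 a.2 - translation x₀ g₀ = translation a.1 (a.2 - g₀) +
      (translation (a.1 - x₀) (translation x₀ g₀) - translation x₀ g₀) := by
    rw [translation_sub_right, ← translation_add, sub_add_cancel]
    abel
  simp only [this]
  exact (map_add_le_add _ _ _).trans (add_le_add (seminorm_translation_le k n a.1 _)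
    (seminorm_translation_sub_le k n ha _))

/-- Modulations become translations under the Fourier transform, so continuity and growth of
time-frequency shifts need proof for translations only. The factor `(2π)⁻¹` reflects the
normalisation `e^{-2πi x·ξ}` of `𝓕`. -/
theorem fourier_modulation (y : Rd d) (g : 𝓢(Rd d, ℂ)) :
    𝓕 (modulation y g) = translation ((2 * Real.pi)⁻¹ • y) (𝓕 g) := by
  ext ξ
  rw [translation_apply, SchwartzMap.fourier_coe, SchwartzMap.fourier_coe, Real.fourier_eq',
    Real.fourier_eq']
  congr 1
  ext v
  rw [modulation_apply, smul_eq_mul, smul_eq_mul, ← mul_assoc, ← Complex.exp_add]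
  congr 2
  rw [inner_sub_right, inner_smul_right, real_inner_comm v y]
  push_cast
  field_simp
  ring

theorem modulation_eq (y : Rd d) (g : 𝓢(Rd d, ℂ)) :
    modulation y g = 𝓕⁻ (translation ((2 * Real.pi)⁻¹ • y) (𝓕 g)) := by
  rw [← fourier_modulation, FourierTransform.fourierInv_fourier_eq]

/-- The time-frequency shift `M_y T_x g` for `z = (x, y)`. -/
def tf (z : Rd d × Rd d) (g : 𝓢(Rd d, ℂ)) : 𝓢(Rd d, ℂ) := modulation z.2 (translation z.1 g)

theorem tf_apply (z : Rd d × Rd d) (g : 𝓢(Rd d, ℂ)) (t : Rd d) :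
    tf z g t = Complex.exp (Complex.I * (inner ℝ z.2 t : ℝ)) * g (t - z.1) := by
  rw [tf, modulation_apply, translation_apply]

theorem norm_exp_I_mul_ofReal (r : ℝ) : ‖Complex.exp (Complex.I * (r : ℂ))‖ = 1 := by
  rw [mul_comm, Complex.norm_exp_ofReal_mul_I]

theorem continuous_tf (g : 𝓢(Rd d, ℂ)) : Continuous fun z : Rd d × Rd d => tf z g := by
  simp only [tf, modulation_eq]
  refine (fourierInvCLM ℂ 𝓢(Rd d, ℂ)).continuous.comp (continuous_translation.comp
    (Continuous.prodMk (by fun_prop) ?_))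
  exact (fourierCLM ℂ 𝓢(Rd d, ℂ)).continuous.comp (continuous_translation.comp
    (Continuous.prodMk continuous_fst continuous_const))

/-- A family of Schwartz functions whose seminorms grow polynomially. -/
def PolyGrowth {W : Type*} [Norm W] (Φ : W → 𝓢(Rd d, ℂ)) : Prop :=
  ∀ k n, ∃ (C : ℝ) (M : ℕ), 0 ≤ C ∧
    ∀ w, SchwartzMap.seminorm ℂ k n (Φ w) ≤ C * (1 + ‖w‖) ^ M

variable {W : Type*} [SeminormedAddCommGroup W]

theorem PolyGrowth.sum {Φ : W → 𝓢(Rd d, ℂ)} (h : PolyGrowth Φ) (s : Finset (ℕ × ℕ)) :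
    ∃ (C : ℝ) (M : ℕ), 0 ≤ C ∧
      ∀ w, ∑ i ∈ s, SchwartzMap.seminorm ℂ i.1 i.2 (Φ w) ≤ C * (1 + ‖w‖) ^ M := by
  choose C M hC h using h
  refine ⟨∑ i ∈ s, C i.1 i.2, ∑ i ∈ s, M i.1 i.2, Finset.sum_nonneg fun i _ => hC _ _, fun w => ?_⟩
  rw [Finset.sum_mul]
  refine Finset.sum_le_sum fun i hi => (h i.1 i.2 w).trans ?_
  refine mul_le_mul_of_nonneg_left ?_ (hC _ _)
  exact pow_le_pow_right₀ (by linarith [norm_nonneg w])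
    (Finset.single_le_sum (f := fun i : ℕ × ℕ => M i.1 i.2) (fun _ _ => Nat.zero_le _) hi)

theorem PolyGrowth.comp_clm {Φ : W → 𝓢(Rd d, ℂ)} (h : PolyGrowth Φ)
    (A : 𝓢(Rd d, ℂ) →L[ℂ] 𝓢(Rd d, ℂ)) : PolyGrowth fun w => A (Φ w) := by
  intro k n
  obtain ⟨s, C, hC, hA⟩ := exists_schwartzSeminorm_bound A k n
  obtain ⟨C', M, hC', hs⟩ := h.sum s
  refine ⟨C * C', M, mul_nonneg hC hC', fun w => (hA _).trans ?_⟩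
  rw [mul_assoc]
  exact mul_le_mul_of_nonneg_left (hs w) hC

theorem PolyGrowth.translation {Φ : W → 𝓢(Rd d, ℂ)} (h : PolyGrowth Φ) {a : W → Rd d}
    (ha : ∀ w, ‖a w‖ ≤ ‖w‖) : PolyGrowth fun w => translation (a w) (Φ w) := by
  intro k n
  obtain ⟨C, M, hC, hs⟩ := h.sum (Finset.Iic (k, n))
  refine ⟨2 ^ k * C, k + M, by positivity, fun w => (seminorm_translation_le k n _ _).trans ?_⟩
  have h1 : (1 + ‖a w‖) ^ k ≤ (1 + ‖w‖) ^ k := by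
    gcongr
    exact ha w
  have h2 : seminormSum k n (Φ w) ≤ C * (1 + ‖w‖) ^ M := hs w
  have h3 := seminormSum_nonneg k n (Φ w)
  calc (1 + ‖a w‖) ^ k * (2 ^ k * seminormSum k n (Φ w))
      ≤ (1 + ‖w‖) ^ k * (2 ^ k * (C * (1 + ‖w‖) ^ M)) := by gcongr
    _ = _ := by rw [pow_add]; ring

theorem polyGrowth_tf (g : 𝓢(Rd d, ℂ)) : PolyGrowth fun z : Rd d × Rd d => tf z g := by
  simp only [tf, modulation_eq]
  refine PolyGrowth.comp_clm (PolyGrowth.translation ?_ fun z => ?_)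
    (fourierInvCLM ℂ 𝓢(Rd d, ℂ))
  · refine PolyGrowth.comp_clm (PolyGrowth.translation ?_ fun z => norm_fst_le z)
      (fourierCLM ℂ 𝓢(Rd d, ℂ))
    exact fun k n => ⟨SchwartzMap.seminorm ℂ k n g, 0, apply_nonneg _ _, fun w => by simp⟩
  · rw [norm_smul, norm_inv, Real.norm_of_nonneg (by positivity)]
    refine (mul_le_of_le_one_left (norm_nonneg _) ?_).trans (norm_snd_le z)
    refine inv_le_one_of_one_le₀ ?_
    linarith [Real.pi_gt_three]

theorem conjS_smul (c : ℂ) (g : 𝓢(Rd d, ℂ)) : conjS (c • g) = conj c • conjS g := by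
  ext t
  simp [conjS_apply]

theorem conjS_tf (z : Rd d × Rd d) (g : 𝓢(Rd d, ℂ)) :
    conjS (tf z g) = tf (z.1, -z.2) (conjS g) := by
  ext t
  rw [conjS_apply, tf_apply, tf_apply, conjS_apply, map_mul, ← Complex.exp_conj]
  simp

theorem conjS_conjS (g : 𝓢(Rd d, ℂ)) : conjS (conjS g) = g := by
  ext t
  simp [conjS_apply]

end TimeFrequencyShift

/-! ### Gaussians and coherent states -/

section CoherentStates

open FourierTransform LineDeriv

variable {d : ℕ}

theorem iteratedFDeriv_cexp_neg_ofReal_norm (n : ℕ) (t : ℝ) :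
    ‖iteratedFDeriv ℝ n (fun t : ℝ => Complex.exp (-(t : ℂ))) t‖ = Real.exp (-t) := by
  have hder : ∀ n : ℕ, iteratedDeriv n (fun s : ℝ => Complex.exp (-(s : ℂ)))
      = fun s : ℝ => (-1) ^ n * Complex.exp (-(s : ℂ)) := by
    intro n
    induction n with
    | zero => simp
    | succ n ih =>
      rw [iteratedDeriv_succ, ih]
      funext s
      have h : HasDerivAt (fun s : ℝ => (-1) ^ n * Complex.exp (-(s : ℂ)))
          ((-1) ^ n * (Complex.exp (-(s : ℂ)) * (-1))) s :=
        (((Complex.ofRealCLM.hasDerivAt (x := s)).neg).cexp).const_mul _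
      rw [h.deriv]
      ring
  rw [norm_iteratedFDeriv_eq_norm_iteratedDeriv, hder, norm_mul, norm_pow, norm_neg, norm_one,
    one_pow, one_mul, Complex.norm_exp]
  simp

/-- Use `1 + r ≤ e^r` and complete the square in `M r - r² / 2`. -/
theorem one_add_pow_mul_exp_neg_sq_le (M : ℕ) {r : ℝ} (hr : 0 ≤ r) :
    (1 + r) ^ M * Real.exp (-(r ^ 2 / 2)) ≤ Real.exp ((M : ℝ) ^ 2 / 2) := by
  have h1 : (1 + r) ^ M ≤ Real.exp (M * r) := by
    rw [Real.exp_nat_mul]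
    refine pow_le_pow_left₀ (by positivity) ?_ M
    linarith [Real.add_one_le_exp r]
  calc (1 + r) ^ M * Real.exp (-(r ^ 2 / 2))
      ≤ Real.exp (M * r) * Real.exp (-(r ^ 2 / 2)) := by gcongr
    _ ≤ _ := by
      rw [← Real.exp_add]
      refine Real.exp_le_exp.2 ?_
      nlinarith [sq_nonneg ((M : ℝ) - r)]

theorem hasTemperateGrowth_half_norm_sq : (fun x : Rd d => ‖x‖ ^ 2 / 2).HasTemperateGrowth := by
  have := (Function.hasTemperateGrowth_norm_sq (Rd d)).mul
    (Function.HasTemperateGrowth.const (2⁻¹ : ℝ) (E := Rd d))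
  simp only [div_eq_mul_inv]
  exact this

/-- The Gaussian `s ↦ e^{-|s|²/2}`. -/
def gau : 𝓢(Rd d, ℂ) where
  toFun s := Complex.exp (-((‖s‖ ^ 2 / 2 : ℝ) : ℂ))
  smooth' := by
    have := (hasTemperateGrowth_half_norm_sq (d := d)).1
    exact (Complex.ofRealCLM.contDiff.comp this).neg.cexp
  decay' := by
    intro k n
    obtain ⟨l, C, hC, hb⟩ :=
      (hasTemperateGrowth_half_norm_sq (d := d)).norm_iteratedFDeriv_le_uniform n
    -- The estimate for derivatives of a composition wants the `i`-th derivative bounded by `D ^ i`;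
    -- making `D ≥ 1` gives `D ≤ D ^ i` for `i ≥ 1`.
    set C' := max C 1 with hC'
    refine ⟨n.factorial * C' ^ n * Real.exp (((k + l * n : ℕ) : ℝ) ^ 2 / 2), fun x => ?_⟩
    have h1 : (1 : ℝ) ≤ 1 + ‖x‖ := by linarith [norm_nonneg x]
    have hD : 1 ≤ C' * (1 + ‖x‖) ^ l :=
      one_le_mul_of_one_le_of_one_le (le_max_right _ _) (one_le_pow₀ h1)
    have h2 : ‖iteratedFDeriv ℝ n ((fun t : ℝ => Complex.exp (-(t : ℂ))) ∘
        fun x : Rd d => ‖x‖ ^ 2 / 2) x‖ ≤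
        n.factorial * Real.exp (-(‖x‖ ^ 2 / 2)) * (C' * (1 + ‖x‖) ^ l) ^ n := by
      refine norm_iteratedFDeriv_comp_le (N := (⊤ : ℕ∞)) (Complex.ofRealCLM.contDiff.neg.cexp)
        (hasTemperateGrowth_half_norm_sq (d := d)).1 (mod_cast le_top) x
        (fun i _ => (iteratedFDeriv_cexp_neg_ofReal_norm i _).le) fun i hi hin => ?_
      refine (hb i hin x).trans (le_trans ?_ (le_self_pow₀ hD (by omega)))
      gcongr
      exact le_max_left _ _
    have h3 := one_add_pow_mul_exp_neg_sq_le (k + l * n) (norm_nonneg x)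
    calc ‖x‖ ^ k * ‖iteratedFDeriv ℝ n ((fun t : ℝ => Complex.exp (-(t : ℂ))) ∘
        fun x : Rd d => ‖x‖ ^ 2 / 2) x‖
        ≤ (1 + ‖x‖) ^ k *
          (n.factorial * Real.exp (-(‖x‖ ^ 2 / 2)) * (C' * (1 + ‖x‖) ^ l) ^ n) := by
          gcongr
          linarith
      _ = n.factorial * C' ^ n * ((1 + ‖x‖) ^ (k + l * n) * Real.exp (-(‖x‖ ^ 2 / 2))) := by
          rw [pow_add, pow_mul, mul_pow]; ring
      _ ≤ _ := by gcongr

theorem gau_apply (s : Rd d) : gau s = Complex.exp (-((‖s‖ ^ 2 / 2 : ℝ) : ℂ)) := rfl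

theorem gau_eq_ofReal (s : Rd d) : gau s = ((Real.exp (-(‖s‖ ^ 2 / 2)) : ℝ) : ℂ) := by
  rw [gau_apply]
  push_cast
  rfl

theorem conjS_gau : conjS (gau : 𝓢(Rd d, ℂ)) = gau := by
  ext s
  rw [conjS_apply, gau_eq_ofReal, Complex.conj_ofReal]

theorem norm_gau_le (s : Rd d) : ‖gau s‖ ≤ 1 := by
  rw [gau_eq_ofReal, Complex.norm_real, Real.norm_of_nonneg (Real.exp_nonneg _)]
  exact Real.exp_le_one_iff.2 (by simp; positivity)

/-- The Weyl-symmetric time-frequency shift `e^{-i x·y/2} M_y T_x g`, `z = (x, y)`. -/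
def weyl (z : Rd d × Rd d) (g : 𝓢(Rd d, ℂ)) : 𝓢(Rd d, ℂ) :=
  Complex.exp (Complex.I * ((-(inner ℝ z.1 z.2) / 2 : ℝ) : ℂ)) • tf z g

theorem weyl_apply (z : Rd d × Rd d) (g : 𝓢(Rd d, ℂ)) (t : Rd d) :
    weyl z g t = Complex.exp (Complex.I * ((inner ℝ z.2 t - (inner ℝ z.1 z.2) / 2 : ℝ) : ℂ)) *
      g (t - z.1) := by
  rw [weyl, smul_apply, tf_apply, smul_eq_mul, ← mul_assoc, ← Complex.exp_add]
  congr 2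
  push_cast
  ring

theorem norm_weyl_apply (z : Rd d × Rd d) (g : 𝓢(Rd d, ℂ)) (t : Rd d) :
    ‖weyl z g t‖ = ‖g (t - z.1)‖ := by
  rw [weyl_apply, norm_mul, norm_exp_I_mul_ofReal, one_mul]

theorem continuous_weyl (g : 𝓢(Rd d, ℂ)) : Continuous fun z : Rd d × Rd d => weyl z g := by
  unfold weyl
  have h : Continuous fun z : Rd d × Rd d =>
      Complex.exp (Complex.I * ((-(inner ℝ z.1 z.2) / 2 : ℝ) : ℂ)) := by fun_prop
  exact h.smul (continuous_tf g)

theorem polyGrowth_weyl (g : 𝓢(Rd d, ℂ)) : PolyGrowth fun z : Rd d × Rd d => weyl z g := by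
  intro k n
  obtain ⟨C, M, hC, h⟩ := polyGrowth_tf g k n
  refine ⟨C, M, hC, fun z => ?_⟩
  simp only [weyl]
  rw [map_smul_eq_mul, norm_exp_I_mul_ofReal, one_mul]
  exact h z

/-- Phase-space conjugation `(x, y) ↦ (x, -y)`. -/
def zbar (z : Rd d × Rd d) : Rd d × Rd d := (z.1, -z.2)

theorem conjS_weyl (z : Rd d × Rd d) (g : 𝓢(Rd d, ℂ)) :
    conjS (weyl z g) = weyl (zbar z) (conjS g) := by
  rw [weyl, weyl, conjS_smul, conjS_tf, ← Complex.exp_conj, map_mul, Complex.conj_I,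
    Complex.conj_ofReal]
  congr 2
  simp only [zbar, inner_neg_right]
  push_cast
  ring

/-- The symmetric phase in `weyl` is chosen so that the only defect of additivity is half the
symplectic form. -/
theorem weyl_weyl (z w : Rd d × Rd d) (g : 𝓢(Rd d, ℂ)) :
    weyl z (weyl w g) = Complex.exp (Complex.I *
      (((inner ℝ z.2 w.1 - inner ℝ z.1 w.2) / 2 : ℝ) : ℂ)) • weyl (z + w) g := by
  ext t
  simp only [smul_apply, weyl_apply, smul_eq_mul, Prod.fst_add, Prod.snd_add]
  rw [← mul_assoc, ← mul_assoc, ← Complex.exp_add, ← Complex.exp_add, sub_add_eq_sub_sub]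
  congr 2
  simp only [inner_sub_right, inner_add_left, inner_add_right]
  rw [real_inner_comm z.1 w.2, real_inner_comm w.1 z.2]
  push_cast
  ring

/-- The coherent state centred at `z`. -/
def coh (z : Rd d × Rd d) : 𝓢(Rd d, ℂ) := weyl z gau

theorem coh_apply (z : Rd d × Rd d) (t : Rd d) :
    coh z t = Complex.exp (Complex.I * ((inner ℝ z.2 t - (inner ℝ z.1 z.2) / 2 : ℝ) : ℂ) -
      ((‖t - z.1‖ ^ 2 / 2 : ℝ) : ℂ)) := by
  rw [coh, weyl_apply, gau_apply, ← Complex.exp_add, ← sub_eq_add_neg]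

theorem conj_coh (z : Rd d × Rd d) (t : Rd d) : conj (coh z t) = coh (zbar z) t := by
  rw [← conjS_apply, coh, conjS_weyl, conjS_gau, coh]

theorem norm_coh_le (z : Rd d × Rd d) (t : Rd d) : ‖coh z t‖ ≤ 1 := by
  rw [coh, norm_weyl_apply]
  exact norm_gau_le _

theorem lineDeriv_coh (z : Rd d × Rd d) (v t : Rd d) :
    ∂_{v} (coh z) t = (Complex.I * ((inner ℝ z.2 v : ℝ) : ℂ) - ((inner ℝ (t - z.1) v : ℝ) : ℂ)) *
      coh z t := by
  rw [SchwartzMap.lineDerivOp_apply, lineDeriv]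
  have h1 : HasDerivAt (fun r : ℝ => (inner ℝ z.2 (t + r • v) - (inner ℝ z.1 z.2) / 2 : ℝ))
      (inner ℝ z.2 v) 0 := by
    have : HasDerivAt (fun r : ℝ => inner ℝ z.2 t + r * inner ℝ z.2 v - (inner ℝ z.1 z.2) / 2)
        (1 * inner ℝ z.2 v) 0 :=
      (((hasDerivAt_id (0 : ℝ)).mul_const _).const_add _).sub_const _
    simpa [inner_add_right, inner_smul_right] using this
  have h2 : HasDerivAt (fun r : ℝ => ‖t + r • v - z.1‖ ^ 2 / 2) (inner ℝ (t - z.1) v) 0 := by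
    have h : HasDerivAt (fun r : ℝ => t + r • v - z.1) v 0 := by
      simpa using (((hasDerivAt_id (0 : ℝ)).smul_const v).const_add t).sub_const z.1
    have := h.norm_sq.div_const 2
    simpa using this
  have h3 := ((h1.ofReal_comp.const_mul Complex.I).sub h2.ofReal_comp).cexp
  have h4 : (fun r : ℝ => coh z (t + r • v)) = fun r : ℝ => Complex.exp
      (((fun y : ℝ => Complex.I * ((inner ℝ z.2 (t + y • v) - inner ℝ z.1 z.2 / 2 : ℝ) : ℂ)) -
        fun y : ℝ => ((‖t + y • v - z.1‖ ^ 2 / 2 : ℝ) : ℂ)) r) := by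
    ext r
    rw [coh_apply, Pi.sub_apply]
  rw [h4, h3.deriv, mul_comm, coh_apply]
  simp

/-- The coherent-state transform `z ↦ ∫ f(s) conj (coh z s) ds`. -/
def ba (f : Rd d → ℂ) (z : Rd d × Rd d) : ℂ := ∫ s, f s * conj (coh z s)

theorem ba_eq (f : Rd d → ℂ) (z : Rd d × Rd d) : ba f z = ∫ s, f s * coh (zbar z) s := by
  simp only [ba, conj_coh]

/-- The creation operator in direction `v`. -/
def creation (v : Rd d) (φ : 𝓢(Rd d, ℂ)) : 𝓢(Rd d, ℂ) :=
  SchwartzMap.smulLeftCLM ℂ (fun s : Rd d => ((inner ℝ v s : ℝ) : ℂ)) φ - ∂_{v} φ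

theorem hasTemperateGrowth_inner_ofReal (v : Rd d) :
    (fun s : Rd d => ((inner ℝ v s : ℝ) : ℂ)).HasTemperateGrowth :=
  Function.Complex.hasTemperateGrowth_ofReal.comp (Function.hasTemperateGrowth_inner_right v)

theorem integrable_schwartz_mul (φ ψ : 𝓢(Rd d, ℂ)) : Integrable (fun s => φ s * ψ s) := by
  have := (SchwartzMap.smulLeftCLM ℂ (⇑φ) ψ).integrable (μ := volume)
  refine this.congr (ae_of_all _ fun s => ?_)
  rw [SchwartzMap.smulLeftCLM_apply_apply φ.hasTemperateGrowth, smul_eq_mul]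

/-- Integration by parts moves the derivative onto the coherent state, which brings down a factor
affine in `s`. Its `s`-part cancels the multiplication in `creation`, and only the scalar `(x - i
y)·v` remains. -/
theorem ba_creation (v : Rd d) (φ : 𝓢(Rd d, ℂ)) (z : Rd d × Rd d) :
    ba (creation v φ) z =
      (((inner ℝ z.1 v : ℝ) : ℂ) - Complex.I * ((inner ℝ z.2 v : ℝ) : ℂ)) * ba φ z := by
  rw [ba_eq, ba_eq]
  have h1 := SchwartzMap.integral_mul_lineDerivOp_right_eq_neg_left (μ := volume) φ
    (coh (zbar z)) v
  have h2 : ∀ s, creation v φ s * coh (zbar z) s =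
      SchwartzMap.smulLeftCLM ℂ (fun s : Rd d => ((inner ℝ v s : ℝ) : ℂ)) φ s * coh (zbar z) s
        - ∂_{v} φ s * coh (zbar z) s := by
    intro s
    rw [creation, sub_apply, sub_mul]
  simp only [h2]
  rw [integral_sub (integrable_schwartz_mul _ _) (integrable_schwartz_mul _ _), sub_eq_add_neg,
    ← h1, ← integral_add (integrable_schwartz_mul _ _) (integrable_schwartz_mul _ _),
    ← integral_const_mul]
  congr 1
  ext s
  rw [SchwartzMap.smulLeftCLM_apply_apply (hasTemperateGrowth_inner_ofReal v), smul_eq_mul,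
    lineDeriv_coh, inner_sub_left, real_inner_comm s v]
  simp only [zbar, inner_neg_left]
  push_cast
  ring

theorem norm_ba_le (f : Rd d → ℂ) (z : Rd d × Rd d) (hf : Integrable f) :
    ‖ba f z‖ ≤ ∫ s, ‖f s‖ := by
  refine norm_integral_le_of_norm_le hf.norm (ae_of_all _ fun s => ?_)
  rw [norm_mul, RCLike.norm_conj]
  exact mul_le_of_le_one_right (norm_nonneg _) (norm_coh_le z s)

theorem ba_creation_iterate (v : Rd d) (φ : 𝓢(Rd d, ℂ)) (N : ℕ) (z : Rd d × Rd d) :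
    ba ((creation v)^[N] φ) z =
      (((inner ℝ z.1 v : ℝ) : ℂ) - Complex.I * ((inner ℝ z.2 v : ℝ) : ℂ)) ^ N * ba φ z := by
  induction N with
  | zero => simp
  | succ N ih => rw [Function.iterate_succ_apply', ba_creation, ih, pow_succ]; ring

theorem norm_le_sum_abs_inner (x : Rd d) :
    ‖x‖ ≤ ∑ j, |inner ℝ x (EuclideanSpace.basisFun (Fin d) ℝ j)| := by
  conv_lhs => rw [← (EuclideanSpace.basisFun (Fin d) ℝ).sum_repr x]
  refine (norm_sum_le _ _).trans (Finset.sum_le_sum fun j _ => ?_)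
  rw [norm_smul, OrthonormalBasis.norm_eq_one, mul_one, OrthonormalBasis.repr_apply_apply,
    real_inner_comm, Real.norm_eq_abs]

/-- The coherent-state transform of a Schwartz function is rapidly decreasing. -/
theorem exists_ba_decay (φ : 𝓢(Rd d, ℂ)) (N : ℕ) :
    ∃ C, 0 ≤ C ∧ ∀ z, ‖ba φ z‖ ≤ C * ((1 + ‖z‖) ^ N)⁻¹ := by
  let e := EuclideanSpace.basisFun (Fin d) ℝ
  let A := fun j => ∫ s, ‖((creation (e j))^[N + 1] φ) s‖
  let D := ∑ j, A j
  let A₀ := ∫ s, ‖φ s‖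
  have hA : ∀ j, 0 ≤ A j := fun j => integral_nonneg fun _ => norm_nonneg _
  have hA₀ : 0 ≤ A₀ := integral_nonneg fun _ => norm_nonneg _
  have hD : 0 ≤ D := Finset.sum_nonneg fun j _ => hA j
  -- Creation operators along the basis vectors multiply the transform by `x_j - i y_j`. Iterating
  -- them bounds each `|x_j - i y_j|^(N+1) |ba φ z|` by an `L¹` norm, and a power-mean inequality
  -- recombines the coordinates.
  have h1 : ∀ z, ‖z‖ ^ (N + 1) * ‖ba φ z‖ ≤ (d : ℝ) ^ N * D := by
    intro z
    let ζ := fun j => ‖((inner ℝ z.1 (e j) : ℝ) : ℂ) - Complex.I * ((inner ℝ z.2 (e j) : ℝ) : ℂ)‖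
    have hζ : ‖z‖ ≤ ∑ j, ζ j := by
      rw [Prod.norm_def]
      refine max_le ((norm_le_sum_abs_inner z.1).trans (Finset.sum_le_sum fun j _ => ?_))
        ((norm_le_sum_abs_inner z.2).trans (Finset.sum_le_sum fun j _ => ?_))
      · have := Complex.abs_re_le_norm
          (((inner ℝ z.1 (e j) : ℝ) : ℂ) - Complex.I * ((inner ℝ z.2 (e j) : ℝ) : ℂ))
        simpa [ζ, e] using this
      · have := Complex.abs_im_le_norm
          (((inner ℝ z.1 (e j) : ℝ) : ℂ) - Complex.I * ((inner ℝ z.2 (e j) : ℝ) : ℂ))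
        simpa [ζ, e] using this
    have h2 : (∑ j, ζ j) ^ (N + 1) ≤ (d : ℝ) ^ N * ∑ j, ζ j ^ (N + 1) := by
      have := pow_sum_le_card_mul_sum_pow (s := Finset.univ) (f := ζ) (fun _ _ => norm_nonneg _) N
      simpa using this
    calc ‖z‖ ^ (N + 1) * ‖ba φ z‖ ≤ ((d : ℝ) ^ N * ∑ j, ζ j ^ (N + 1)) * ‖ba φ z‖ := by
          gcongr
          exact (pow_le_pow_left₀ (norm_nonneg _) hζ _).trans h2
      _ = (d : ℝ) ^ N * ∑ j, ζ j ^ (N + 1) * ‖ba φ z‖ := by rw [mul_assoc, Finset.sum_mul]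
      _ ≤ (d : ℝ) ^ N * D := by
          refine mul_le_mul_of_nonneg_left (Finset.sum_le_sum fun j _ => ?_) (by positivity)
          rw [← norm_pow, ← norm_mul, ← ba_creation_iterate]
          exact norm_ba_le _ z (SchwartzMap.integrable _)
  refine ⟨2 ^ N * (A₀ + (d : ℝ) ^ N * D), by positivity, fun z => ?_⟩
  have h0 : (0 : ℝ) < 1 + ‖z‖ := by positivity
  have h3 : ‖ba φ z‖ ≤ A₀ := norm_ba_le _ z φ.integrable
  rw [← div_eq_mul_inv, le_div_iff₀ (by positivity)]
  have h4 : (1 + ‖z‖) ^ (N + 1) ≤ 2 ^ N * (1 + ‖z‖ ^ (N + 1)) := by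
    simpa using add_pow_le zero_le_one (norm_nonneg z) (N + 1)
  have h5 : (1 + ‖z‖) ^ N ≤ (1 + ‖z‖) ^ (N + 1) :=
    pow_le_pow_right₀ (by linarith [norm_nonneg z]) (Nat.le_succ N)
  calc ‖ba φ z‖ * (1 + ‖z‖) ^ N ≤ ‖ba φ z‖ * (2 ^ N * (1 + ‖z‖ ^ (N + 1))) := by
        gcongr
        exact h5.trans h4
    _ = 2 ^ N * (‖ba φ z‖ + ‖z‖ ^ (N + 1) * ‖ba φ z‖) := by ring
    _ ≤ _ := by
        exact mul_le_mul_of_nonneg_left (add_le_add h3 (h1 z)) (by positivity)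

end CoherentStates

/-! ### Inversion formula and Moyal identity -/

section Inversion

open FourierTransform

variable {d : ℕ}

/-- Phase space. -/
abbrev PS (d : ℕ) : Type := Rd d × Rd d

instance : (volume : Measure (PS d)).IsAddHaarMeasure :=
  inferInstanceAs ((volume : Measure (Rd d)).prod volume).IsAddHaarMeasure

/-- An integrable polynomial weight on phase space. -/
def weight (z : PS d) : ℝ := ((1 + ‖z‖) ^ (2 * d + 1))⁻¹

theorem weight_le_one (z : PS d) : weight z ≤ 1 :=
  inv_le_one_of_one_le₀ (one_le_pow₀ (by linarith [norm_nonneg z]))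

theorem integrable_weight : Integrable (weight : PS d → ℝ) := by
  have h := integrable_one_add_norm (E := PS d) (μ := volume) (r := ((2 * d + 1 : ℕ) : ℝ)) (by
    simp; linarith)
  refine h.congr (ae_of_all _ fun z => ?_)
  simp only [weight]
  rw [Real.rpow_neg (by positivity), Real.rpow_natCast]

/-- The pairing of a function with the coherent states is a tempered distribution. -/
theorem ba_eq_distribution (φ : 𝓢(Rd d, ℂ)) (z : PS d) :
    ba φ z = SchwartzMap.toTemperedDistributionCLM (Rd d) ℂ volume φ (coh (zbar z)) := by
  rw [ba_eq, SchwartzMap.toTemperedDistributionCLM_apply_apply volume]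
  simp only [smul_eq_mul, mul_comm]

theorem continuous_zbar : Continuous (zbar : PS d → PS d) := by
  unfold zbar
  fun_prop

theorem continuous_ba_schwartz (φ : 𝓢(Rd d, ℂ)) : Continuous (ba φ) := by
  have : ba φ = fun z => SchwartzMap.toTemperedDistributionCLM (Rd d) ℂ volume φ (coh (zbar z)) :=
    funext (ba_eq_distribution φ)
  rw [this]
  exact (map_continuous _).comp ((continuous_weyl gau).comp continuous_zbar)

/-- For fixed `x` the transform is, up to a phase, a rescaled Fourier transform in `y` of `φ` times
a translated Gaussian. This makes Fourier inversion in `y` available. -/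
theorem ba_eq_fourier (φ : 𝓢(Rd d, ℂ)) (x y : Rd d) :
    ba φ (x, y) = Complex.exp (Complex.I * ((inner ℝ x y / 2 : ℝ) : ℂ)) *
      𝓕 (SchwartzMap.smulLeftCLM ℂ (⇑φ) (translation x gau)) ((2 * Real.pi)⁻¹ • y) := by
  rw [SchwartzMap.fourier_coe, Real.fourier_eq', ba, ← integral_const_mul]
  congr 1
  ext s
  rw [SchwartzMap.smulLeftCLM_apply_apply φ.hasTemperateGrowth, translation_apply, conj_coh, coh,
    weyl_apply]
  simp only [zbar, smul_eq_mul, inner_smul_right, inner_neg_left, inner_neg_right]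
  rw [mul_left_comm, ← mul_assoc (Complex.exp _) (Complex.exp _), ← Complex.exp_add]
  congr 2
  rw [real_inner_comm s y]
  push_cast
  field_simp
  ring

theorem integral_fourier_smul_exp (ψ : 𝓢(Rd d, ℂ)) (t : Rd d) :
    ∫ y, 𝓕 ψ ((2 * Real.pi)⁻¹ • y) * Complex.exp (Complex.I * ((inner ℝ y t : ℝ) : ℂ)) =
      (2 * Real.pi) ^ d * ψ t := by
  have h1 : 𝓕⁻ (𝓕 ψ) t = ψ t := by rw [FourierTransform.fourierInv_fourier_eq]
  rw [SchwartzMap.fourierInv_coe, Real.fourierInv_eq'] at h1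
  have h2 := Measure.integral_comp_smul (volume : Measure (Rd d))
    (fun v => Complex.exp (↑(2 * Real.pi * inner ℝ v t) * Complex.I) • 𝓕 ψ v) (2 * Real.pi)⁻¹
  rw [h1] at h2
  have hpi : (0 : ℝ) < 2 * Real.pi := by positivity
  rw [finrank_euclideanSpace, Fintype.card_fin, inv_pow, inv_inv, abs_of_pos (by positivity),
    Complex.real_smul] at h2
  push_cast at h2
  rw [← h2]
  congr 1
  ext y
  rw [smul_eq_mul, mul_comm]
  congr 2
  rw [inner_smul_left]
  simp only [conj_trivial]
  push_cast
  field_simp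

/-- The integral `∫ e^{-|s|²/2} g(s) ds`. -/
def gauPairing (g : 𝓢(Rd d, ℂ)) : ℂ := ∫ s, gau s * g s

theorem integrable_ba_mul_of_bounded (φ : 𝓢(Rd d, ℂ)) {F : PS d → ℂ}
    (hF : AEStronglyMeasurable F) {C : ℝ} (hC : ∀ w, ‖F w‖ ≤ C) :
    Integrable (fun w => ba φ w * F w) := by
  obtain ⟨A, hA, h⟩ := exists_ba_decay φ (2 * d + 1)
  refine Integrable.mul_bdd (c := C) ?_ hF (ae_of_all _ hC)
  exact (integrable_weight.const_mul A).mono' (continuous_ba_schwartz φ).aestronglyMeasurable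
    (ae_of_all _ h)

/-- Integrating in `y` first, Fourier inversion collapses the integrand to `φ t` times `gau (t - x)
* g (t - x)`; the remaining integral in `x` is `gauPairing g`. -/
theorem integral_ba_mul_weyl (φ g : 𝓢(Rd d, ℂ)) (t : Rd d) :
    ∫ w, ba φ w * weyl w g t = (2 * Real.pi) ^ d * gauPairing g * φ t := by
  have hcont : Continuous fun w : PS d => weyl w g t :=
    (continuous_schwartz_eval t).comp (continuous_weyl g)
  have hI : Integrable (fun w => ba φ w * weyl w g t) :=
    integrable_ba_mul_of_bounded φ hcont.aestronglyMeasurable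
      (C := SchwartzMap.seminorm ℂ 0 0 g) fun w => by
        rw [norm_weyl_apply]
        exact SchwartzMap.norm_le_seminorm ℂ g _
  rw [Measure.volume_eq_prod] at hI ⊢
  rw [integral_prod _ hI]
  have h1 : ∀ x y : Rd d, ba φ (x, y) * weyl (x, y) g t =
      (𝓕 (SchwartzMap.smulLeftCLM ℂ (⇑φ) (translation x gau)) ((2 * Real.pi)⁻¹ • y) *
        Complex.exp (Complex.I * ((inner ℝ y t : ℝ) : ℂ))) * g (t - x) := by
    intro x y
    rw [ba_eq_fourier, weyl_apply]
    have : Complex.exp (Complex.I * ((inner ℝ y t : ℝ) : ℂ)) =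
        Complex.exp (Complex.I * ((inner ℝ x y / 2 : ℝ) : ℂ)) *
        Complex.exp (Complex.I * ((inner ℝ y t - inner ℝ x y / 2 : ℝ) : ℂ)) := by
      rw [← Complex.exp_add]
      congr 1
      push_cast
      ring
    rw [this]
    ring
  simp only [h1, integral_mul_const, integral_fourier_smul_exp]
  have h2 : ∀ x : Rd d, (2 * (Real.pi : ℂ)) ^ d *
      (SchwartzMap.smulLeftCLM ℂ (⇑φ) (translation x gau)) t * g (t - x) =
      ((2 * (Real.pi : ℂ)) ^ d * φ t) * (gau (t - x) * g (t - x)) := by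
    intro x
    rw [SchwartzMap.smulLeftCLM_apply_apply φ.hasTemperateGrowth, translation_apply, smul_eq_mul]
    ring
  simp only [h2, integral_const_mul]
  rw [integral_sub_left_eq_self (fun s => gau s * g s) volume t, gauPairing]
  ring

theorem schwartzIntegrable_ba_smul_weyl (φ g : 𝓢(Rd d, ℂ)) :
    SchwartzIntegrable (fun w : PS d => ba φ w • weyl w g) volume := by
  intro k n
  obtain ⟨C, M, hC, hg⟩ := polyGrowth_weyl g k n
  -- `M` powers absorb the growth of the seminorms; the other `2d + 1` exceed the dimension `2d` of
  -- phase space and leave the integrable `weight`.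
  obtain ⟨A, hA, hφ⟩ := exists_ba_decay φ (M + (2 * d + 1))
  refine (integrable_weight.const_mul (A * C)).mono' ?_ (ae_of_all _ fun w => ?_)
  · exact ((continuous_schwartzSeminorm k n).comp
      ((continuous_ba_schwartz φ).smul (continuous_weyl g))).aestronglyMeasurable
  · rw [map_smul_eq_mul, norm_mul, norm_norm, Real.norm_of_nonneg (apply_nonneg _ _)]
    have h0 : (0 : ℝ) < 1 + ‖w‖ := by positivity
    calc ‖ba φ w‖ * SchwartzMap.seminorm ℂ k n (weyl w g)
        ≤ (A * ((1 + ‖w‖) ^ (M + (2 * d + 1)))⁻¹) * (C * (1 + ‖w‖) ^ M) :=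
          mul_le_mul (hφ w) (hg w) (apply_nonneg _ _) (by positivity)
      _ = A * C * weight w := by
          rw [weight, pow_add, mul_inv]
          field_simp

/-- Inversion formula for tempered distributions: analysis with coherent states, synthesis with an
arbitrary window `g`. -/
theorem distribution_inversion (T : 𝓢'(Rd d, ℂ)) (φ g : 𝓢(Rd d, ℂ)) :
    ∫ w, ba φ w * T (weyl w g) = (2 * Real.pi) ^ d * gauPairing g * T φ := by
  have h := temperedDistribution_integral T
    ((continuous_ba_schwartz φ).smul (continuous_weyl g)) (schwartzIntegrable_ba_smul_weyl φ g)
    (((2 * Real.pi) ^ d * gauPairing g) • φ) (fun t => by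
      simp only [smul_apply, smul_eq_mul]
      exact (integral_ba_mul_weyl φ g t).symm)
  simp only [map_smul, smul_eq_mul, Pi.smul_apply'] at h
  exact h.symm

theorem gauPairing_gau : (gauPairing (gau : 𝓢(Rd d, ℂ))) = ((∫ s : Rd d, Real.exp (-‖s‖ ^ 2) : ℝ) : ℂ) := by
  rw [gauPairing, ← integral_complex_ofReal]
  congr 1
  ext s
  rw [gau_eq_ofReal, ← Complex.ofReal_mul, ← Real.exp_add]
  congr 2
  ring

/-- The constant in the Moyal identity for coherent states. -/
def moyal (d : ℕ) : ℝ := (2 * Real.pi) ^ d * ∫ s : Rd d, Real.exp (-‖s‖ ^ 2)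

theorem moyal_eq : ((moyal d : ℝ) : ℂ) = (2 * Real.pi) ^ d * gauPairing (gau : 𝓢(Rd d, ℂ)) := by
  rw [gauPairing_gau, moyal]
  push_cast
  rfl

theorem moyal_pos : 0 < moyal d := by
  have hI : Integrable (fun s : Rd d => Real.exp (-‖s‖ ^ 2)) := by
    have := (integrable_schwartz_mul (gau : 𝓢(Rd d, ℂ)) gau).norm
    refine this.congr (ae_of_all _ fun s => ?_)
    simp only [gau_eq_ofReal]
    rw [← Complex.ofReal_mul, ← Real.exp_add, Complex.norm_real,
      Real.norm_of_nonneg (Real.exp_nonneg _)]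
    congr 1
    ring
  refine mul_pos (by positivity) ?_
  exact (integral_pos_iff_support_of_nonneg (fun s => Real.exp_nonneg _) hI).2 (by
    have : Function.support (fun s : Rd d => Real.exp (-‖s‖ ^ 2)) = Set.univ := by
      ext s
      simp [Real.exp_ne_zero]
    rw [this]
    exact isOpen_univ.measure_pos volume Set.univ_nonempty)

/-- This is the inversion formula for the distribution `conj ψ` with the Gaussian as synthesis
window. -/
theorem integral_ba_mul_conj_ba (φ ψ : 𝓢(Rd d, ℂ)) :
    ∫ w, ba φ w * conj (ba ψ w) = moyal d * ∫ s, φ s * conj (ψ s) := by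
  have h := distribution_inversion
    (SchwartzMap.toTemperedDistributionCLM (Rd d) ℂ volume (conjS ψ)) φ gau
  rw [← moyal_eq] at h
  simp only [SchwartzMap.toTemperedDistributionCLM_apply_apply volume, smul_eq_mul, conjS_apply] at h
  rw [← h]
  congr 1
  ext w
  congr 1
  rw [ba, ← integral_conj]
  congr 1
  ext s
  rw [map_mul, Complex.conj_conj, mul_comm]
  rfl

end Inversion

/-! ### The coherent-state transform on `L²` -/

section L2Transform

variable {d : ℕ}

/-- `L²(ℝ^d)`. -/
abbrev L2 (d : ℕ) : Type := Lp ℂ 2 (volume : Measure (Rd d))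

/-- `L^p` of phase space. -/
abbrev LZ (d : ℕ) (p : ℝ≥0∞) : Type := Lp ℂ p (volume : Measure (PS d))

/-- The coherent state as an element of `L²`. -/
def cohL (z : PS d) : L2 d := (coh z).toLp 2

theorem continuous_cohL : Continuous (cohL : PS d → L2 d) :=
  (SchwartzMap.toLpCLM ℂ ℂ 2 volume).continuous.comp (continuous_weyl gau)

theorem inner_toLp_eq (φ : 𝓢(Rd d, ℂ)) (f : L2 d) :
    inner ℂ (φ.toLp 2) f = ∫ s, f s * conj (φ s) := by
  rw [L2.inner_def]
  refine integral_congr_ae ?_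
  filter_upwards [φ.coeFn_toLp 2 volume] with s hs
  rw [hs, RCLike.inner_apply]

theorem ba_eq_inner (f : L2 d) (z : PS d) : ba f z = inner ℂ (cohL z) f := by
  rw [cohL, inner_toLp_eq, ba]

theorem continuous_ba (f : L2 d) : Continuous (ba f) := by
  have : ba f = fun z => inner ℂ (cohL z) f := funext (ba_eq_inner f)
  rw [this]
  exact continuous_cohL.inner continuous_const

theorem ba_toLp (φ : 𝓢(Rd d, ℂ)) (z : PS d) : ba (φ.toLp 2 : L2 d) z = ba φ z := by
  refine integral_congr_ae ?_
  filter_upwards [φ.coeFn_toLp 2 volume] with s hs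
  rw [hs]

theorem memLp_ba_schwartz (φ : 𝓢(Rd d, ℂ)) : MemLp (ba φ) 2 volume := by
  rw [memLp_two_iff_integrable_sq_norm (continuous_ba_schwartz φ).aestronglyMeasurable]
  obtain ⟨A, hA, h⟩ := exists_ba_decay φ (2 * d + 1)
  have h1 := (integrable_ba_mul_of_bounded φ (continuous_ba_schwartz φ).aestronglyMeasurable
    (C := A) fun w => (h w).trans (mul_le_of_le_one_right hA (weight_le_one w))).norm
  refine h1.congr (ae_of_all _ fun w => ?_)
  simp [sq]

theorem norm_toLp_ba_schwartz (φ : 𝓢(Rd d, ℂ)) :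
    ‖(memLp_ba_schwartz φ).toLp‖ = √(moyal d) * ‖(φ.toLp 2 : L2 d)‖ := by
  have h1 : ((‖(memLp_ba_schwartz φ).toLp‖ ^ 2 : ℝ) : ℂ) =
      ((moyal d * ‖(φ.toLp 2 : L2 d)‖ ^ 2 : ℝ) : ℂ) := by
    push_cast
    have h2 := inner_self_eq_norm_sq_to_K (𝕜 := ℂ) (memLp_ba_schwartz φ).toLp
    have h3 := inner_self_eq_norm_sq_to_K (𝕜 := ℂ) (φ.toLp 2 : L2 d)
    simp only [Complex.coe_algebraMap] at h2 h3
    rw [← h2, ← h3, SchwartzMap.inner_toL2_toL2_eq φ φ volume, L2.inner_def]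
    have h4 := integral_ba_mul_conj_ba φ φ
    simp only [RCLike.inner_apply]
    rw [← h4]
    refine integral_congr_ae ?_
    filter_upwards [(memLp_ba_schwartz φ).coeFn_toLp] with w hw
    rw [hw]
  have h5 : ‖(memLp_ba_schwartz φ).toLp‖ ^ 2 = (√(moyal d) * ‖(φ.toLp 2 : L2 d)‖) ^ 2 := by
    rw [mul_pow, Real.sq_sqrt moyal_pos.le]
    exact_mod_cast h1
  exact (pow_left_inj₀ (norm_nonneg _) (by positivity) two_ne_zero).1 h5

theorem exists_schwartz_seq (f : L2 d) :
    ∃ φ : ℕ → 𝓢(Rd d, ℂ), Tendsto (fun n => ((φ n).toLp 2 : L2 d)) atTop (𝓝 f) := by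
  have hd := SchwartzMap.denseRange_toLpCLM (E := Rd d) (F := ℂ) (p := 2) (by simp)
    (μ := (volume : Measure (Rd d)))
  obtain ⟨u, hu, hlim⟩ := mem_closure_iff_seq_limit.1 (hd f)
  choose φ hφ using hu
  refine ⟨φ, ?_⟩
  have : (fun n => ((φ n).toLp 2 : L2 d)) = u := funext hφ
  rw [this]
  exact hlim

/-- Fatou's lemma along Schwartz approximations: `L²` convergence gives convergence of the
transforms at every point, since these are inner products with coherent states. -/
theorem eLpNorm_ba_le (f : L2 d) :
    eLpNorm (ba f) 2 volume ≤ ENNReal.ofReal (√(moyal d) * ‖f‖) := by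
  obtain ⟨φ, hφ⟩ := exists_schwartz_seq f
  have h1 : ∀ z, Tendsto (fun n => ba (φ n) z) atTop (𝓝 (ba f z)) := by
    intro z
    simp only [← ba_toLp, ba_eq_inner]
    exact tendsto_const_nhds.inner hφ
  refine (Lp.eLpNorm_lim_le_liminf_eLpNorm
    (fun n => (continuous_ba_schwartz (φ n)).aestronglyMeasurable) (ba f)
    (ae_of_all _ h1)).trans ?_
  have h2 : ∀ n, eLpNorm (ba (φ n)) 2 volume =
      ENNReal.ofReal (√(moyal d) * ‖((φ n).toLp 2 : L2 d)‖) := by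
    intro n
    rw [← norm_toLp_ba_schwartz, Lp.norm_toLp, ENNReal.ofReal_toReal (memLp_ba_schwartz _).2.ne]
  simp only [h2]
  exact (ENNReal.tendsto_ofReal (hφ.norm.const_mul _)).liminf_eq.le

theorem memLp_ba (f : L2 d) : MemLp (ba f) 2 volume :=
  ⟨(continuous_ba f).aestronglyMeasurable, (eLpNorm_ba_le f).trans_lt ENNReal.ofReal_lt_top⟩

theorem ba_add (f g : L2 d) (z : PS d) : ba (f + g : L2 d) z = ba f z + ba g z := by
  simp only [ba_eq_inner, inner_add_right]

theorem ba_sub (f g : L2 d) (z : PS d) : ba (f - g : L2 d) z = ba f z - ba g z := by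
  simp only [ba_eq_inner, inner_sub_right]

theorem ba_smul (c : ℂ) (f : L2 d) (z : PS d) : ba (c • f : L2 d) z = c * ba f z := by
  simp only [ba_eq_inner, inner_smul_right]

/-- The coherent-state transform as a bounded operator `L²(ℝ^d) → L²(ℝ^{2d})`. -/
def baL : L2 d →L[ℂ] LZ d 2 :=
  LinearMap.mkContinuous
    { toFun := fun f => (memLp_ba f).toLp
      map_add' := fun f g => by
        rw [← MemLp.toLp_add]
        exact MemLp.toLp_congr _ _ (ae_of_all _ fun z => ba_add f g z)
      map_smul' := fun c f => by
        rw [RingHom.id_apply, ← MemLp.toLp_const_smul]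
        exact MemLp.toLp_congr _ _ (ae_of_all _ fun z => ba_smul c f z) }
    (√(moyal d)) (fun f => by
      simp only [LinearMap.coe_mk, AddHom.coe_mk, Lp.norm_toLp]
      exact ENNReal.toReal_le_of_le_ofReal (by positivity) (eLpNorm_ba_le f))

theorem coeFn_baL (f : L2 d) : baL f =ᵐ[volume] ba f := (memLp_ba f).coeFn_toLp

/-- Moyal's identity. -/
theorem inner_baL (f h : L2 d) : inner ℂ (baL f) (baL h) = moyal d * inner ℂ f h := by
  have key : ∀ φ ψ : 𝓢(Rd d, ℂ), inner ℂ (baL (φ.toLp 2 : L2 d)) (baL (ψ.toLp 2 : L2 d)) =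
      moyal d * inner ℂ (φ.toLp 2 : L2 d) (ψ.toLp 2 : L2 d) := by
    intro φ ψ
    rw [SchwartzMap.inner_toL2_toL2_eq φ ψ volume, L2.inner_def]
    simp only [RCLike.inner_apply]
    rw [← integral_ba_mul_conj_ba]
    refine integral_congr_ae ?_
    filter_upwards [coeFn_baL (φ.toLp 2 : L2 d), coeFn_baL (ψ.toLp 2 : L2 d)] with w h1 h2
    rw [h1, h2, ba_toLp, ba_toLp]
  obtain ⟨φ, hφ⟩ := exists_schwartz_seq f
  obtain ⟨ψ, hψ⟩ := exists_schwartz_seq h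
  have h1 := ((baL.continuous.tendsto f).comp hφ).inner (𝕜 := ℂ)
    ((baL.continuous.tendsto h).comp hψ)
  have h2 := (hφ.inner (𝕜 := ℂ) hψ).const_mul (moyal d : ℂ)
  refine tendsto_nhds_unique h1 ?_
  simp only [Function.comp_def, key]
  exact h2

theorem integral_ba_mul_conj_ba_L2 (f h : L2 d) :
    ∫ w, ba f w * conj (ba h w) = moyal d * inner ℂ h f := by
  rw [← inner_baL, L2.inner_def]
  refine integral_congr_ae ?_
  filter_upwards [coeFn_baL f, coeFn_baL h] with w h1 h2
  rw [h1, h2, RCLike.inner_apply]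

theorem adjoint_baL_baL (f : L2 d) :
    ContinuousLinearMap.adjoint baL (baL f) = (moyal d : ℂ) • f := by
  refine ext_inner_left ℂ fun h => ?_
  rw [ContinuousLinearMap.adjoint_inner_right, inner_baL, inner_smul_right]

theorem ba_eq_zero_imp {f : L2 d} (h : ∀ z, ba f z = 0) : f = 0 := by
  have h1 : baL f = 0 := by
    refine Lp.ext ?_
    filter_upwards [coeFn_baL f, Lp.coeFn_zero ℂ 2 (volume : Measure (PS d))] with z h1 h2
    rw [h1, h2, h z, Pi.zero_apply]
  have h2 := adjoint_baL_baL f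
  rw [h1, map_zero] at h2
  exact (smul_eq_zero.1 h2.symm).resolve_left (by exact_mod_cast moyal_pos.ne')

theorem ba_injective {f h : L2 d} (hfh : ∀ z, ba f z = ba h z) : f = h :=
  sub_eq_zero.1 (ba_eq_zero_imp fun z => by rw [ba_sub, hfh, sub_self])

end L2Transform

/-! ### Rotations of phase space -/

section Rotation

variable {d : ℕ}

/-- Rotation of phase space: multiplication of `x + i y` by `e^{iθ}`. -/
def rot (θ : ℝ) (z : PS d) : PS d :=
  (Real.cos θ • z.1 - Real.sin θ • z.2, Real.sin θ • z.1 + Real.cos θ • z.2)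

theorem continuous_rot : Continuous fun a : ℝ × PS d => rot a.1 a.2 := by
  unfold rot
  fun_prop

theorem rot_rot (θ η : ℝ) (z : PS d) : rot θ (rot η z) = rot (θ + η) z := by
  simp only [rot, Real.cos_add, Real.sin_add]
  ext1 <;> module

theorem rot_zero (z : PS d) : rot 0 z = z := by simp [rot]

theorem zbar_rot (θ : ℝ) (z : PS d) : zbar (rot θ z) = rot (-θ) (zbar z) := by
  simp only [zbar, rot, Real.cos_neg, Real.sin_neg]
  ext1 <;> module

theorem rot_sub (θ : ℝ) (z w : PS d) : rot θ z - rot θ w = rot θ (z - w) := by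
  simp only [rot]
  ext1 <;> simp only [Prod.fst_sub, Prod.snd_sub] <;> module

theorem rot_add (θ : ℝ) (z w : PS d) : rot θ (z + w) = rot θ z + rot θ w := by
  simp only [rot]
  ext1 <;> simp only [Prod.fst_add, Prod.snd_add] <;> module

theorem rot_smul (θ c : ℝ) (z : PS d) : rot θ (c • z) = c • rot θ z := by
  simp only [rot]
  ext1 <;> simp only [Prod.smul_fst, Prod.smul_snd] <;> module

theorem norm_sq_rot (θ : ℝ) (z : PS d) :
    ‖(rot θ z).1‖ ^ 2 + ‖(rot θ z).2‖ ^ 2 = ‖z.1‖ ^ 2 + ‖z.2‖ ^ 2 := by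
  simp only [rot]
  rw [norm_sub_sq_real, norm_add_sq_real]
  simp only [norm_smul, inner_smul_left, inner_smul_right, mul_pow, Real.norm_eq_abs, sq_abs,
    conj_trivial]
  linear_combination (‖z.1‖ ^ 2 + ‖z.2‖ ^ 2) * Real.sin_sq_add_cos_sq θ

/-- The symplectic form is invariant under rotations. -/
theorem symplectic_rot (θ : ℝ) (z w : PS d) :
    inner ℝ (rot θ w).2 (rot θ z).1 - inner ℝ (rot θ z).2 (rot θ w).1 =
      inner ℝ w.2 z.1 - inner ℝ z.2 w.1 := by
  simp only [rot, inner_add_left, inner_sub_right, inner_smul_left, inner_smul_right, conj_trivial]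
  rw [real_inner_comm z.1 w.1, real_inner_comm z.2 w.2, real_inner_comm z.1 w.2,
    real_inner_comm w.1 z.2]
  linear_combination (inner ℝ z.1 w.2 - inner ℝ w.1 z.2) * Real.sin_sq_add_cos_sq θ

/-- Rotation as a linear isometry of the Euclidean product. -/
def rotIso (θ : ℝ) : WithLp 2 (Rd d × Rd d) ≃ₗᵢ[ℝ] WithLp 2 (Rd d × Rd d) where
  toFun z := WithLp.toLp 2 (rot θ z.ofLp)
  invFun z := WithLp.toLp 2 (rot (-θ) z.ofLp)
  left_inv z := by simp [rot_rot, rot_zero]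
  right_inv z := by simp [rot_rot, rot_zero]
  map_add' z w := congrArg (WithLp.toLp 2) (rot_add θ z.ofLp w.ofLp)
  map_smul' c z := congrArg (WithLp.toLp 2) (rot_smul θ c z.ofLp)
  norm_map' z := by
    have h := norm_sq_rot θ z.ofLp
    have h1 := WithLp.prod_norm_sq_eq_of_L2 z
    have h2 := WithLp.prod_norm_sq_eq_of_L2 (WithLp.toLp 2 (rot θ z.ofLp))
    refine (pow_left_inj₀ (norm_nonneg _) (norm_nonneg _) two_ne_zero).1 ?_
    rw [h1]
    exact h2.trans h

/-- The product `PS d` carries the sup norm, for which rotations are not isometries in general; the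
Euclidean product has the same volume and there `rotIso` applies. -/
theorem measurePreserving_rot (θ : ℝ) :
    MeasurePreserving (rot θ : PS d → PS d) volume volume := by
  have h1 := WithLp.volume_preserving_ofLp (Rd d) (Rd d)
  have h2 := WithLp.volume_preserving_toLp (Rd d) (Rd d)
  exact h1.comp ((rotIso θ).measurePreserving.comp h2)

/-- Rotation as a continuous map. -/
def rotC (θ : ℝ) : C(PS d, PS d) where
  toFun := rot θ
  continuous_toFun := by
    unfold rot
    fun_prop

theorem continuous_rotC : Continuous (rotC : ℝ → C(PS d, PS d)) :=
  ContinuousMap.continuous_of_continuous_uncurry _ continuous_rot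

theorem measurePreserving_rotC (θ : ℝ) :
    MeasurePreserving (rotC θ : PS d → PS d) volume volume := measurePreserving_rot θ

variable (p : ℝ≥0∞) [Fact (1 ≤ p)]

/-- The operator `F ↦ e^{-idt} F ∘ rot (2t)` on `L^p` of phase space. -/
def rotL (t : ℝ) : LZ d p →L[ℂ] LZ d p :=
  Complex.exp (-(Complex.I * d * t)) •
    (Lp.compMeasurePreservingₗᵢ ℂ (rotC (2 * t)) (measurePreserving_rotC (2 * t))).toContinuousLinearMap

theorem norm_exp_neg_I_mul (t : ℝ) : ‖Complex.exp (-(Complex.I * d * t))‖ = 1 := by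
  have : -(Complex.I * d * t) = ((-(d * t) : ℝ) : ℂ) * Complex.I := by push_cast; ring
  rw [this, Complex.norm_exp_ofReal_mul_I]

theorem coeFn_rotL (t : ℝ) (F : LZ d p) :
    rotL p t F =ᵐ[volume] fun z => Complex.exp (-(Complex.I * d * t)) * F (rot (2 * t) z) := by
  have h1 : rotL p t F = Complex.exp (-(Complex.I * d * t)) •
    Lp.compMeasurePreserving (rotC (2 * t)) (measurePreserving_rotC (2 * t)) F := rfl
  rw [h1]
  filter_upwards [Lp.coeFn_smul (Complex.exp (-(Complex.I * d * t)))
    (Lp.compMeasurePreserving (rotC (2 * t)) (measurePreserving_rotC (2 * t)) F),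
    Lp.coeFn_compMeasurePreserving F (measurePreserving_rotC (2 * t))] with z h2 h3
  rw [h2, Pi.smul_apply, h3, smul_eq_mul]
  rfl

theorem norm_rotL (t : ℝ) (F : LZ d p) : ‖rotL p t F‖ = ‖F‖ := by
  have h1 : rotL p t F = Complex.exp (-(Complex.I * d * t)) •
    Lp.compMeasurePreserving (rotC (2 * t)) (measurePreserving_rotC (2 * t)) F := rfl
  rw [h1, norm_smul, norm_exp_neg_I_mul, one_mul, Lp.norm_compMeasurePreserving]

theorem continuous_rotL (hp : p ≠ ∞) (F : LZ d p) : Continuous fun t => rotL p t F := by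
  have h1 : (fun t => rotL p t F) = fun t : ℝ => Complex.exp (-(Complex.I * d * t)) •
    Lp.compMeasurePreserving (rotC (2 * t)) (measurePreserving_rotC (2 * t)) F := rfl
  rw [h1]
  have h2 : Continuous fun t : ℝ => Complex.exp (-(Complex.I * d * t)) := by fun_prop
  refine h2.smul ?_
  exact Continuous.compMeasurePreservingLp continuous_const
    (continuous_rotC.comp (by fun_prop)) (fun t => measurePreserving_rotC (2 * t)) hp

end Rotation

/-! ### The propagator of the harmonic oscillator -/

section Propagator

variable {d : ℕ}

/-- The Gaussian `s ↦ e^{-|s|²}`. -/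
def gauSq : 𝓢(Rd d, ℂ) := SchwartzMap.smulLeftCLM ℂ (⇑(gau : 𝓢(Rd d, ℂ))) gau

theorem gauSq_apply (s : Rd d) : gauSq s = Complex.exp (-((‖s‖ ^ 2 : ℝ) : ℂ)) := by
  rw [gauSq, SchwartzMap.smulLeftCLM_apply_apply gau.hasTemperateGrowth, smul_eq_mul, gau_apply,
    ← Complex.exp_add]
  congr 1
  push_cast
  ring

/-- The product of a coherent state and a conjugate coherent state is a shifted Gaussian. -/
theorem coh_mul_conj_coh (z w : PS d) (s : Rd d) :
    coh w s * conj (coh z s) =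
      Complex.exp (Complex.I * (((inner ℝ z.1 z.2 - inner ℝ w.1 w.2) / 2 : ℝ) : ℂ) -
        ((‖z.1 - w.1‖ ^ 2 / 4 : ℝ) : ℂ)) * tf ((2⁻¹ : ℝ) • (z.1 + w.1), w.2 - z.2) gauSq s := by
  rw [conj_coh, coh_apply, coh_apply, tf_apply, gauSq_apply, ← Complex.exp_add, ← Complex.exp_add,
    ← Complex.exp_add]
  congr 1
  simp only [zbar, inner_neg_left, inner_neg_right, inner_sub_left]
  have h : ‖s - w.1‖ ^ 2 / 2 + ‖s - z.1‖ ^ 2 / 2 =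
      ‖z.1 - w.1‖ ^ 2 / 4 + ‖s - (2⁻¹ : ℝ) • (z.1 + w.1)‖ ^ 2 := by
    simp only [norm_sub_sq_real, norm_smul, mul_pow, norm_add_sq_real, inner_smul_right,
      inner_add_right]
    norm_num
    ring
  have h' := congrArg (fun r : ℝ => (r : ℂ)) h
  push_cast at h' ⊢
  linear_combination -h'

theorem integral_tf_gauSq (m η : Rd d) :
    ∫ s, tf (m, η) gauSq s = Complex.exp (Complex.I * ((inner ℝ η m : ℝ) : ℂ)) *
      ((Real.pi : ℂ) ^ ((d : ℂ) / 2) * Complex.exp (-((‖η‖ ^ 2 / 4 : ℝ) : ℂ))) := by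
  have h1 : ∀ s, tf (m, η) gauSq s = Complex.exp (Complex.I * ((inner ℝ η m : ℝ) : ℂ)) *
      (fun u : Rd d => Complex.exp (-1 * (‖u‖ : ℂ) ^ 2 + Complex.I * ((inner ℝ η u : ℝ) : ℂ)))
        (s - m) := by
    intro s
    simp only
    rw [tf_apply, gauSq_apply, ← Complex.exp_add, ← Complex.exp_add]
    congr 1
    rw [inner_sub_right]
    push_cast
    ring
  simp only [h1]
  rw [integral_const_mul, integral_sub_right_eq_self
    (fun u : Rd d => Complex.exp (-1 * (‖u‖ : ℂ) ^ 2 + Complex.I * ((inner ℝ η u : ℝ) : ℂ))) m,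
    GaussianFourier.integral_cexp_neg_mul_sq_norm_add (by simp)]
  simp only [div_one, finrank_euclideanSpace, Fintype.card_fin, Complex.I_sq]
  congr 3
  push_cast
  ring

/-- The overlap of two coherent states. -/
theorem ba_coh (z w : PS d) :
    ba (coh w) z = (Real.pi : ℂ) ^ ((d : ℂ) / 2) * Complex.exp
      (Complex.I * (((inner ℝ w.2 z.1 - inner ℝ z.2 w.1) / 2 : ℝ) : ℂ) -
        (((‖(z - w).1‖ ^ 2 + ‖(z - w).2‖ ^ 2) / 4 : ℝ) : ℂ)) := by
  simp only [ba, coh_mul_conj_coh, integral_const_mul, integral_tf_gauSq]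
  rw [mul_left_comm (Complex.exp _) ((Real.pi : ℂ) ^ ((d : ℂ) / 2)), mul_left_comm,
    ← Complex.exp_add, ← Complex.exp_add]
  congr 2
  simp only [inner_sub_left, inner_smul_right, inner_add_right, Prod.fst_sub, Prod.snd_sub]
  rw [norm_sub_rev w.2 z.2, real_inner_comm w.2 w.1, real_inner_comm z.2 z.1]
  push_cast
  ring

/-- Both ingredients of the overlap, the symplectic form and the Euclidean distance, are rotation
invariant. This identity is what makes rotations of phase space act on `L²(ℝ^d)`. -/
theorem ba_coh_rot (θ : ℝ) (z w : PS d) : ba (coh (rot θ w)) (rot θ z) = ba (coh w) z := by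
  rw [ba_coh, ba_coh, symplectic_rot, rot_sub, norm_sq_rot]

theorem dense_span_cohL : Dense (Submodule.span ℂ (Set.range (cohL : PS d → L2 d)) : Set (L2 d)) := by
  rw [Submodule.dense_iff_topologicalClosure_eq_top, Submodule.topologicalClosure_eq_top_iff,
    Submodule.eq_bot_iff]
  intro f hf
  refine ba_eq_zero_imp fun z => ?_
  rw [ba_eq_inner]
  exact Submodule.mem_orthogonal _ f |>.1 hf _ (Submodule.subset_span ⟨z, rfl⟩)

theorem rotL_baL_cohL (t : ℝ) (w : PS d) :
    rotL 2 t (baL (cohL w)) = Complex.exp (-(Complex.I * d * t)) • baL (cohL (rot (-(2 * t)) w)) := by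
  refine Lp.ext ?_
  filter_upwards [coeFn_rotL 2 t (baL (cohL w)), (measurePreserving_rot (2 * t)).quasiMeasurePreserving.ae
    (coeFn_baL (cohL w)), Lp.coeFn_smul (Complex.exp (-(Complex.I * d * t)))
    (baL (cohL (rot (-(2 * t)) w))), coeFn_baL (cohL (rot (-(2 * t)) w))] with z h1 h2 h3 h4
  rw [h1, h2, h3, Pi.smul_apply, h4, smul_eq_mul, cohL, cohL, ba_toLp, ba_toLp]
  rw [← ba_coh_rot (2 * t) z, rot_rot, add_neg_cancel, rot_zero]

/-- The propagator `e^{-itH}` of the harmonic oscillator on `L²`. -/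
def prop (t : ℝ) : L2 d →L[ℂ] L2 d :=
  ((moyal d : ℂ)⁻¹ • ContinuousLinearMap.adjoint baL) ∘L (rotL 2 t ∘L baL)

/-- Up to the constant `moyal d`, the adjoint in `prop` inverts `baL` on its range only. Hence the
range has to be invariant under `rotL`, which `rotL_baL_cohL` shows on the coherent states; their
span is dense. -/
theorem baL_prop (t : ℝ) (f : L2 d) : baL (prop t f) = rotL 2 t (baL f) := by
  have h : baL ∘L prop t = rotL 2 t ∘L (baL : L2 d →L[ℂ] LZ d 2) := by
    refine ContinuousLinearMap.ext_on dense_span_cohL ?_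
    rintro _ ⟨w, rfl⟩
    have h0 : (moyal d : ℂ) ≠ 0 := by exact_mod_cast moyal_pos.ne'
    simp only [prop, ContinuousLinearMap.comp_apply, smul_apply,
      rotL_baL_cohL, map_smul, adjoint_baL_baL]
    rw [smul_smul, smul_smul]
    congr 1
    field_simp
  exact DFunLike.congr_fun h f

/-- The identity of `L²` classes holds at every point because both sides are continuous. -/
theorem ba_prop (t : ℝ) (f : L2 d) (z : PS d) :
    ba (prop t f) z = Complex.exp (-(Complex.I * d * t)) * ba f (rot (2 * t) z) := by
  have h : ba (prop t f) =ᵐ[volume]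
      fun z => Complex.exp (-(Complex.I * d * t)) * ba f (rot (2 * t) z) := by
    filter_upwards [coeFn_baL (prop t f), coeFn_rotL 2 t (baL f),
      (measurePreserving_rot (2 * t)).quasiMeasurePreserving.ae (coeFn_baL f)] with z h1 h2 h3
    rw [← h1, baL_prop, h2, h3]
  exact congrFun ((continuous_ba _).ae_eq_iff_eq volume (continuous_const.mul
    ((continuous_ba f).comp (continuous_rot.comp (Continuous.prodMk continuous_const
      continuous_id)))) |>.1 h) z

theorem prop_zero (f : L2 d) : prop 0 f = f :=
  ba_injective fun z => by rw [ba_prop]; simp [rot_zero]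

theorem prop_add (s t : ℝ) (f : L2 d) : prop (s + t) f = prop s (prop t f) :=
  ba_injective fun z => by
    rw [ba_prop, ba_prop, ba_prop, rot_rot, ← mul_assoc, ← Complex.exp_add]
    congr 2
    · push_cast; ring
    · ring_nf

theorem prop_prop_neg (t : ℝ) (f : L2 d) : prop t (prop (-t) f) = f := by
  rw [← prop_add, add_neg_cancel, prop_zero]

theorem norm_baL (f : L2 d) : ‖baL f‖ = √(moyal d) * ‖f‖ := by
  have h1 : ((‖baL f‖ ^ 2 : ℝ) : ℂ) = ((moyal d * ‖f‖ ^ 2 : ℝ) : ℂ) := by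
    push_cast
    have h2 := inner_self_eq_norm_sq_to_K (𝕜 := ℂ) (baL f)
    have h3 := inner_self_eq_norm_sq_to_K (𝕜 := ℂ) f
    simp only [Complex.coe_algebraMap] at h2 h3
    rw [← h2, ← h3, inner_baL]
  have h5 : ‖baL f‖ ^ 2 = (√(moyal d) * ‖f‖) ^ 2 := by
    rw [mul_pow, Real.sq_sqrt moyal_pos.le]
    exact_mod_cast h1
  exact (pow_left_inj₀ (norm_nonneg _) (by positivity) two_ne_zero).1 h5

theorem norm_prop (t : ℝ) (f : L2 d) : ‖prop t f‖ = ‖f‖ := by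
  have h := norm_baL (prop t f)
  rw [baL_prop, norm_rotL, norm_baL] at h
  exact (mul_left_cancel₀ (Real.sqrt_ne_zero'.2 moyal_pos) h).symm

/-- The propagator as a linear isometry. -/
def propIso (t : ℝ) : L2 d →ₗᵢ[ℂ] L2 d := ⟨(prop t).toLinearMap, norm_prop t⟩

theorem inner_prop_prop (t : ℝ) (f h : L2 d) : inner ℂ (prop t f) (prop t h) = inner ℂ f h :=
  (propIso t).inner_map_map f h

theorem inner_prop_right (t : ℝ) (f h : L2 d) :
    inner ℂ f (prop t h) = inner ℂ (prop (-t) f) h := by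
  rw [← inner_prop_prop t (prop (-t) f) h, prop_prop_neg]

theorem continuous_prop (f : L2 d) : Continuous fun t => prop t f :=
  ((moyal d : ℂ)⁻¹ • ContinuousLinearMap.adjoint baL).continuous.comp
    (continuous_rotL 2 (by simp) (baL f))

theorem prop_cohL (t : ℝ) (w : PS d) :
    prop t (cohL w) = Complex.exp (-(Complex.I * d * t)) • cohL (rot (-(2 * t)) w) :=
  ba_injective fun z => by
    rw [ba_prop, ba_smul, cohL, cohL, ba_toLp, ba_toLp, ← ba_coh_rot (2 * t) z, rot_rot,
      add_neg_cancel, rot_zero]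

theorem continuous_prop_apply {u : ℝ → L2 d} (hu : Continuous u) {σ : ℝ → ℝ} (hσ : Continuous σ) :
    Continuous fun t => prop (σ t) (u t) := by
  refine continuous_iff_continuousAt.2 fun t₀ => ?_
  rw [ContinuousAt, tendsto_iff_norm_sub_tendsto_zero]
  have h1 : Tendsto (fun t => ‖u t - u t₀‖ + ‖prop (σ t) (u t₀) - prop (σ t₀) (u t₀)‖) (𝓝 t₀)
      (𝓝 (0 + 0)) :=
    (tendsto_iff_norm_sub_tendsto_zero.1 (hu.tendsto t₀)).add
      (tendsto_iff_norm_sub_tendsto_zero.1 (((continuous_prop (u t₀)).comp hσ).tendsto t₀))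
  rw [add_zero] at h1
  refine squeeze_zero (fun _ => norm_nonneg _) (fun t => ?_) h1
  have : prop (σ t) (u t) - prop (σ t₀) (u t₀) = prop (σ t) (u t - u t₀) +
      (prop (σ t) (u t₀) - prop (σ t₀) (u t₀)) := by
    rw [map_sub]; abel
  rw [this]
  refine (norm_add_le _ _).trans ?_
  rw [norm_prop]

end Propagator

/-! ### The harmonic oscillator generates the propagator -/

section Generator

open LineDeriv

variable {d : ℕ}

/-- The harmonic oscillator on Schwartz functions. -/
def oscS (φ : 𝓢(Rd d, ℂ)) : 𝓢(Rd d, ℂ) :=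
  -(Δ φ) + SchwartzMap.smulLeftCLM ℂ (fun x : Rd d => ((‖x‖ ^ 2 : ℝ) : ℂ)) φ

theorem hasTemperateGrowth_norm_sq_ofReal :
    (fun x : Rd d => ((‖x‖ ^ 2 : ℝ) : ℂ)).HasTemperateGrowth :=
  Function.Complex.hasTemperateGrowth_ofReal.comp (Function.hasTemperateGrowth_norm_sq (Rd d))

theorem harmonicOscillator_apply (v : 𝓢'(Rd d, ℂ)) (φ : 𝓢(Rd d, ℂ)) :
    harmonicOscillator v φ = v (oscS φ) := by
  rw [harmonicOscillator, oscS, map_add, map_neg]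
  have h1 : (-(Δ v) + TemperedDistribution.smulLeftCLM ℂ (fun x : Rd d => ((‖x‖ ^ 2 : ℝ) : ℂ)) v) φ
      = -((Δ v) φ) + (TemperedDistribution.smulLeftCLM ℂ
        (fun x : Rd d => ((‖x‖ ^ 2 : ℝ) : ℂ)) v) φ := rfl
  rw [h1, TemperedDistribution.laplacian_apply_apply, TemperedDistribution.smulLeftCLM_apply_apply]

theorem oscS_apply (φ : 𝓢(Rd d, ℂ)) (s : Rd d) :
    oscS φ s = -(Δ φ s) + ((‖s‖ ^ 2 : ℝ) : ℂ) * φ s := by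
  rw [oscS, add_apply, neg_apply,
    SchwartzMap.smulLeftCLM_apply_apply hasTemperateGrowth_norm_sq_ofReal, smul_eq_mul]

theorem integral_oscS_mul (φ ψ : 𝓢(Rd d, ℂ)) :
    ∫ s, oscS φ s * ψ s = ∫ s, φ s * oscS ψ s := by
  have h1 : ∀ s, oscS φ s * ψ s = -(Δ φ s * ψ s) +
      SchwartzMap.smulLeftCLM ℂ (fun x : Rd d => ((‖x‖ ^ 2 : ℝ) : ℂ)) φ s * ψ s := by
    intro s
    rw [oscS, add_apply, neg_apply]
    ring
  have h2 : ∀ s, φ s * oscS ψ s = -(φ s * Δ ψ s) +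
      SchwartzMap.smulLeftCLM ℂ (fun x : Rd d => ((‖x‖ ^ 2 : ℝ) : ℂ)) φ s * ψ s := by
    intro s
    rw [oscS_apply, SchwartzMap.smulLeftCLM_apply_apply hasTemperateGrowth_norm_sq_ofReal,
      smul_eq_mul]
    ring
  simp only [h1, h2]
  rw [integral_add (integrable_schwartz_mul _ _).fun_neg (integrable_schwartz_mul _ _),
    integral_add (integrable_schwartz_mul _ _).fun_neg (integrable_schwartz_mul _ _),
    integral_neg, integral_neg, SchwartzMap.integral_mul_laplacian_right_eq_left]

theorem hasDerivAt_schwartz_line (f : 𝓢(Rd d, ℂ)) (s v : Rd d) :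
    HasDerivAt (fun r : ℝ => f (s + r • v)) (∂_{v} f s) 0 := by
  rw [SchwartzMap.lineDerivOp_apply]
  exact f.differentiableAt.lineDifferentiableAt.hasLineDerivAt

theorem lineDeriv_lineDeriv_coh (z : PS d) (v s : Rd d) :
    ∂_{v} (∂_{v} (coh z)) s = ((Complex.I * ((inner ℝ z.2 v : ℝ) : ℂ) -
      ((inner ℝ (s - z.1) v : ℝ) : ℂ)) ^ 2 - ((‖v‖ ^ 2 : ℝ) : ℂ)) * coh z s := by
  have h1 := hasDerivAt_schwartz_line (∂_{v} (coh z)) s v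
  have h2 := hasDerivAt_schwartz_line (coh z) s v
  have h3 : HasDerivAt (fun r : ℝ => Complex.I * ((inner ℝ z.2 v : ℝ) : ℂ) -
      ((inner ℝ (s + r • v - z.1) v : ℝ) : ℂ)) (-((‖v‖ ^ 2 : ℝ) : ℂ)) 0 := by
    have h : HasDerivAt (fun r : ℝ => inner ℝ (s + r • v - z.1) v) (‖v‖ ^ 2) 0 := by
      have : HasDerivAt (fun r : ℝ => r * ‖v‖ ^ 2 + inner ℝ (s - z.1) v) (1 * ‖v‖ ^ 2) 0 :=
        ((hasDerivAt_id (0 : ℝ)).mul_const _).add_const _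
      rw [one_mul] at this
      refine this.congr_of_eventuallyEq (Eventually.of_forall fun r => ?_)
      simp only [inner_sub_left, inner_add_left, inner_smul_left, conj_trivial,
        real_inner_self_eq_norm_sq]
      ring
    exact h.ofReal_comp.const_sub _
  have h4 := h3.mul h2
  have h5 : (fun r : ℝ => ∂_{v} (coh z) (s + r • v)) =
      (fun r : ℝ => Complex.I * ((inner ℝ z.2 v : ℝ) : ℂ) -
        ((inner ℝ (s + r • v - z.1) v : ℝ) : ℂ)) * (fun r : ℝ => coh z (s + r • v)) := by
    ext r
    rw [lineDeriv_coh, Pi.mul_apply]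
  rw [h5] at h1
  rw [h1.unique h4, lineDeriv_coh]
  simp only [zero_smul, add_zero]
  ring

theorem oscS_coh (z : PS d) (s : Rd d) :
    oscS (coh z) s = (d + 2 * (((inner ℝ z.1 s : ℝ) : ℂ) + Complex.I * ((inner ℝ z.2 s : ℝ) : ℂ)) -
      (((‖z.1‖ ^ 2 - ‖z.2‖ ^ 2 : ℝ) : ℂ) + 2 * Complex.I * ((inner ℝ z.1 z.2 : ℝ) : ℂ))) *
      coh z s := by
  set e := EuclideanSpace.basisFun (Fin d) ℝ
  rw [oscS_apply, SchwartzMap.laplacian_eq_sum e, sum_apply]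
  simp only [lineDeriv_lineDeriv_coh, OrthonormalBasis.norm_eq_one]
  have h1 : ∀ a b : Rd d, ∑ j, ((inner ℝ a (e j) : ℝ) : ℂ) * ((inner ℝ b (e j) : ℝ) : ℂ) =
      ((inner ℝ a b : ℝ) : ℂ) := by
    intro a b
    rw [← e.sum_inner_mul_inner a b]
    push_cast
    refine Finset.sum_congr rfl fun j _ => ?_
    rw [real_inner_comm b]
  have h2 : ∑ j, ((Complex.I * ((inner ℝ z.2 (e j) : ℝ) : ℂ) -
      ((inner ℝ (s - z.1) (e j) : ℝ) : ℂ)) ^ 2 - (((1 : ℝ) ^ 2 : ℝ) : ℂ)) =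
      -((inner ℝ z.2 z.2 : ℝ) : ℂ) - 2 * Complex.I * ((inner ℝ z.2 (s - z.1) : ℝ) : ℂ) +
        ((inner ℝ (s - z.1) (s - z.1) : ℝ) : ℂ) - d := by
    rw [← h1, ← h1, ← h1, Finset.mul_sum, ← Finset.sum_neg_distrib, ← Finset.sum_sub_distrib,
      ← Finset.sum_add_distrib, Finset.sum_sub_distrib]
    congr 1
    · refine Finset.sum_congr rfl fun j _ => ?_
      linear_combination ((inner ℝ z.2 (e j) : ℝ) : ℂ) ^ 2 * Complex.I_sq
    · simp
  rw [← Finset.sum_mul, h2]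
  simp only [inner_sub_left, inner_sub_right, real_inner_self_eq_norm_sq]
  rw [real_inner_comm s z.1, real_inner_comm z.1 z.2]
  push_cast
  ring

/-- The evolution of a coherent state: an explicit solution of the Schrödinger equation. -/
def cohFlow (z : PS d) (t : ℝ) : 𝓢(Rd d, ℂ) :=
  Complex.exp (-(Complex.I * d * t)) • coh (rot (-(2 * t)) z)

theorem oscS_smul (c : ℂ) (φ : 𝓢(Rd d, ℂ)) (s : Rd d) : oscS (c • φ) s = c * oscS φ s := by
  rw [oscS_apply, oscS_apply, ← SchwartzMap.laplacianCLM_eq (𝕜 := ℂ) (c • φ), map_smul,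
    SchwartzMap.laplacianCLM_eq, smul_apply, smul_apply]
  simp only [smul_eq_mul]
  ring

theorem hasDerivAt_rot_fst (z : PS d) (t : ℝ) :
    HasDerivAt (fun t : ℝ => (rot (-(2 * t)) z).1) ((2 : ℝ) • (rot (-(2 * t)) z).2) t := by
  have hl : HasDerivAt (fun t : ℝ => -(2 * t)) (-2) t := by
    simpa using ((hasDerivAt_id t).const_mul 2).fun_neg
  refine ((hl.cos.smul_const z.1).fun_sub (hl.sin.smul_const z.2)).congr_deriv ?_
  simp only [rot]
  module

theorem hasDerivAt_rot_snd (z : PS d) (t : ℝ) :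
    HasDerivAt (fun t : ℝ => (rot (-(2 * t)) z).2) (-(2 : ℝ) • (rot (-(2 * t)) z).1) t := by
  have hl : HasDerivAt (fun t : ℝ => -(2 * t)) (-2) t := by
    simpa using ((hasDerivAt_id t).const_mul 2).fun_neg
  refine ((hl.sin.smul_const z.1).fun_add (hl.cos.smul_const z.2)).congr_deriv ?_
  simp only [rot]
  module

/-- A coherent state stays coherent while its centre follows the classical trajectory of `|x|² +
|y|²`, a rotation with angular speed 2. The phase `e^{-idt}` carries the ground state energy `d`. -/
theorem hasDerivAt_cohFlow (z : PS d) (t : ℝ) (s : Rd d) :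
    HasDerivAt (fun t : ℝ => cohFlow z t s) (-Complex.I * oscS (cohFlow z t) s) t := by
  set x : ℝ → Rd d := fun t => (rot (-(2 * t)) z).1 with hx
  set y : ℝ → Rd d := fun t => (rot (-(2 * t)) z).2 with hy
  have hx' : HasDerivAt x ((2 : ℝ) • y t) t := hasDerivAt_rot_fst z t
  have hy' : HasDerivAt y (-(2 : ℝ) • x t) t := hasDerivAt_rot_snd z t
  have h1 : HasDerivAt (fun t => inner ℝ (y t) s - inner ℝ (x t) (y t) / 2)
      (inner ℝ (-(2 : ℝ) • x t) s -
        (inner ℝ (x t) (-(2 : ℝ) • x t) + inner ℝ ((2 : ℝ) • y t) (y t)) / 2) t := by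
    have ha := hy'.inner ℝ (hasDerivAt_const t s)
    have hb := (hx'.inner ℝ hy').div_const 2
    refine (ha.fun_sub hb).congr_deriv ?_
    simp
  have h2 : HasDerivAt (fun t => ‖s - x t‖ ^ 2 / 2) (inner ℝ (s - x t) (-((2 : ℝ) • y t))) t := by
    refine ((hx'.const_sub s).norm_sq.div_const 2).congr_deriv ?_
    ring
  have h3 : HasDerivAt (fun t : ℝ => -(Complex.I * d * t)) (-(Complex.I * d)) t := by
    refine ((Complex.ofRealCLM.hasDerivAt (x := t)).const_mul (Complex.I * d)).fun_neg.congr_deriv ?_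
    simp
  have h4 := (h3.add ((h1.ofReal_comp.const_mul Complex.I).sub h2.ofReal_comp)).cexp
  have h5 : (fun t : ℝ => cohFlow z t s) = fun t : ℝ => Complex.exp
      (((fun t : ℝ => -(Complex.I * d * t)) + ((fun t : ℝ => Complex.I *
        ((inner ℝ (y t) s - inner ℝ (x t) (y t) / 2 : ℝ) : ℂ)) -
        fun t : ℝ => ((‖s - x t‖ ^ 2 / 2 : ℝ) : ℂ))) t) := by
    ext t
    rw [cohFlow, smul_apply, coh_apply, smul_eq_mul, ← Complex.exp_add]
    rfl
  rw [h5]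
  convert h4 using 1
  have h6 : Complex.exp (((fun t : ℝ => -(Complex.I * d * t)) + ((fun t : ℝ => Complex.I *
        ((inner ℝ (y t) s - inner ℝ (x t) (y t) / 2 : ℝ) : ℂ)) -
        fun t : ℝ => ((‖s - x t‖ ^ 2 / 2 : ℝ) : ℂ))) t) =
      Complex.exp (-(Complex.I * d * t)) * coh (rot (-(2 * t)) z) s := by
    rw [coh_apply, ← Complex.exp_add]
    rfl
  rw [h6, cohFlow, oscS_smul, oscS_coh]
  simp only [inner_smul_left, inner_smul_right, inner_neg_right, inner_sub_left, conj_trivial,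
    real_inner_self_eq_norm_sq, hx, hy]
  rw [real_inner_comm (rot (-(2 * t)) z).2 s]
  push_cast
  linear_combination (Complex.exp (-(Complex.I * d * t)) * coh (rot (-(2 * t)) z) s) *
    (2 * ((inner ℝ (rot (-(2 * t)) z).1 (rot (-(2 * t)) z).2 : ℝ) : ℂ)
      - 2 * ((inner ℝ (rot (-(2 * t)) z).2 s : ℝ) : ℂ)) * Complex.I_sq

theorem ba_prop_schwartz (φ : 𝓢(Rd d, ℂ)) (t : ℝ) (z : PS d) :
    ba (prop t (φ.toLp 2)) z = ∫ s, φ s * cohFlow (zbar z) t s := by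
  rw [ba_prop, ba_toLp, ba_eq, zbar_rot, ← integral_const_mul]
  congr 1
  ext s
  rw [cohFlow, smul_apply, smul_eq_mul]
  ring

theorem norm_rot_le (θ : ℝ) (z : PS d) :
    ‖(rot θ z).1‖ ≤ ‖z.1‖ + ‖z.2‖ ∧ ‖(rot θ z).2‖ ≤ ‖z.1‖ + ‖z.2‖ := by
  have h := norm_sq_rot θ z
  have h1 := norm_nonneg z.1
  have h2 := norm_nonneg z.2
  constructor
  · refine abs_le_of_sq_le_sq' ?_ (by positivity) |>.2
    nlinarith [sq_nonneg ‖(rot θ z).2‖]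
  · refine abs_le_of_sq_le_sq' ?_ (by positivity) |>.2
    nlinarith [sq_nonneg ‖(rot θ z).1‖]

theorem norm_oscS_cohFlow_le (z : PS d) (t : ℝ) (s : Rd d) :
    ‖oscS (cohFlow z t) s‖ ≤ d + 4 * (‖z.1‖ + ‖z.2‖) * ‖s‖ + 4 * (‖z.1‖ + ‖z.2‖) ^ 2 := by
  rw [cohFlow, oscS_smul, norm_mul, norm_exp_neg_I_mul, one_mul, oscS_coh, norm_mul]
  obtain ⟨h1, h2⟩ := norm_rot_le (-(2 * t)) z
  set R := ‖z.1‖ + ‖z.2‖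
  set x := (rot (-(2 * t)) z).1
  set y := (rot (-(2 * t)) z).2
  have hR : 0 ≤ R := by positivity
  refine (mul_le_of_le_one_right (norm_nonneg _) (norm_coh_le _ _)).trans ?_
  have h3 : |inner ℝ x s| ≤ R * ‖s‖ := (abs_real_inner_le_norm x s).trans (by gcongr)
  have h4 : |inner ℝ y s| ≤ R * ‖s‖ := (abs_real_inner_le_norm y s).trans (by gcongr)
  have h5 : |inner ℝ x y| ≤ R * R := (abs_real_inner_le_norm x y).trans (by gcongr)
  have h6 : |‖x‖ ^ 2 - ‖y‖ ^ 2| ≤ R ^ 2 := by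
    have ha : ‖x‖ ^ 2 ≤ R ^ 2 := by gcongr
    have hb : ‖y‖ ^ 2 ≤ R ^ 2 := by gcongr
    exact abs_le.2 ⟨by nlinarith [sq_nonneg ‖x‖], by nlinarith [sq_nonneg ‖y‖]⟩
  have e1 : ‖(2 : ℂ) * (((inner ℝ x s : ℝ) : ℂ) + Complex.I * ((inner ℝ y s : ℝ) : ℂ))‖ ≤
      2 * (R * ‖s‖ + R * ‖s‖) := by
    rw [norm_mul, Complex.norm_ofNat]
    refine mul_le_mul_of_nonneg_left ((norm_add_le _ _).trans (add_le_add ?_ ?_)) (by norm_num)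
    · rwa [Complex.norm_real, Real.norm_eq_abs]
    · rwa [norm_mul, Complex.norm_I, one_mul, Complex.norm_real, Real.norm_eq_abs]
  have e2 : ‖(((‖x‖ ^ 2 - ‖y‖ ^ 2 : ℝ) : ℂ) + 2 * Complex.I * ((inner ℝ x y : ℝ) : ℂ))‖ ≤
      R ^ 2 + 2 * (R * R) := by
    refine (norm_add_le _ _).trans (add_le_add ?_ ?_)
    · rwa [Complex.norm_real, Real.norm_eq_abs]
    · rw [norm_mul, norm_mul, Complex.norm_I, mul_one, Complex.norm_ofNat, Complex.norm_real,
        Real.norm_eq_abs]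
      gcongr
  refine (norm_sub_le _ _).trans ?_
  have e3 := norm_add_le (d : ℂ)
    ((2 : ℂ) * (((inner ℝ x s : ℝ) : ℂ) + Complex.I * ((inner ℝ y s : ℝ) : ℂ)))
  rw [Complex.norm_natCast] at e3
  nlinarith

/-- The evolution is carried by the coherent state, where it is explicit, and symmetry of `oscS`
returns the oscillator to `φ`. Domination holds since `oscS (cohFlow z t)` grows at most linearly in
`s`, uniformly in `t`. -/
theorem hasDerivAt_ba_prop (φ : 𝓢(Rd d, ℂ)) (t : ℝ) (z : PS d) :
    HasDerivAt (fun t => ba (prop t (φ.toLp 2)) z)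
      (ba (-Complex.I • prop t ((oscS φ).toLp 2) : L2 d) z) t := by
  rw [ba_smul, ba_prop_schwartz, integral_oscS_mul, ← integral_const_mul]
  simp only [ba_prop_schwartz]
  set z' := zbar z
  have h := hasDerivAt_integral_of_dominated_loc_of_deriv_le (μ := (volume : Measure (Rd d)))
    (F := fun t s => φ s * cohFlow z' t s)
    (F' := fun t s => φ s * (-Complex.I * oscS (cohFlow z' t) s)) (x₀ := t)
    (bound := fun s => (d + 4 * (‖z'.1‖ + ‖z'.2‖) ^ 2) * ‖φ s‖ +
      (4 * (‖z'.1‖ + ‖z'.2‖)) * (‖s‖ ^ 1 * ‖φ s‖)) univ_mem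
    (Eventually.of_forall fun t => (integrable_schwartz_mul _ _).aestronglyMeasurable)
    (integrable_schwartz_mul _ _) ?_ ?_ ?_ ?_
  · refine h.2.congr_deriv ?_
    congr 1
    ext s
    ring
  · have := (integrable_schwartz_mul φ (oscS (cohFlow z' t))).const_mul (-Complex.I)
    refine (this.congr (ae_of_all _ fun s => ?_)).aestronglyMeasurable
    simp only
    ring
  · refine ae_of_all _ fun s t _ => ?_
    rw [norm_mul, norm_mul, norm_neg, Complex.norm_I, one_mul]
    have := mul_le_mul_of_nonneg_left (norm_oscS_cohFlow_le z' t s) (norm_nonneg (φ s))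
    refine this.trans (le_of_eq ?_)
    ring
  · exact (φ.integrable.norm.const_mul _).add ((φ.integrable_pow_mul volume 1).const_mul _)
  · exact ae_of_all _ fun s t _ => (hasDerivAt_cohFlow z' t s).const_mul (φ s)

/-- A curve in `L²` whose coherent-state transform is differentiable at every point of phase space,
with derivative the transform of a continuous curve, is the primitive of that curve. -/
theorem eq_add_integral_of_ba {w e : ℝ → L2 d} (he : Continuous e) {S : Set ℝ} (hS : Convex ℝ S)
    (h0 : (0 : ℝ) ∈ S)
    (h : ∀ z, ∀ t ∈ S, HasDerivWithinAt (fun t => ba (w t) z) (ba (e t) z) S t)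
    {t : ℝ} (ht : t ∈ S) : w t = w 0 + ∫ s in (0 : ℝ)..t, e s := by
  refine ba_injective fun z => ?_
  let W : ℝ → L2 d := fun t => w 0 + ∫ s in (0 : ℝ)..t, e s
  have hW : ∀ t, HasDerivAt W (e t) t := fun t =>
    (intervalIntegral.integral_hasDerivAt_right (he.intervalIntegrable _ _)
      he.aestronglyMeasurable.stronglyMeasurableAtFilter he.continuousAt).const_add _
  have hbW : ∀ t, HasDerivAt (fun t => ba (W t) z) (ba (e t) z) t := by
    intro t
    simp only [ba_eq_inner]
    exact (innerSL ℂ (cohL z)).hasFDerivAt.restrictScalars ℝ |>.comp_hasDerivAt t (hW t)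
  -- The difference of the two transforms has zero derivative on a convex set and vanishes at 0;
  -- injectivity of the transform concludes.
  have hd : ∀ t ∈ S, HasDerivWithinAt (fun t => ba (w t) z - ba (W t) z) 0 S t := by
    intro t ht
    have := (h z t ht).sub (hbW t).hasDerivWithinAt
    rwa [sub_self] at this
  have hn := hS.norm_image_sub_le_of_norm_hasDerivWithin_le (C := 0) hd (fun _ _ => by simp) h0 ht
  rw [zero_mul, norm_le_zero_iff] at hn
  have hW0 : W 0 = w 0 := by simp [W]
  rw [hW0, sub_self, sub_zero, sub_eq_zero] at hn
  exact hn

theorem hasDerivAt_add_integral {e : ℝ → L2 d} (he : Continuous e) (w₀ : L2 d) (t : ℝ) :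
    HasDerivAt (fun t => w₀ + ∫ s in (0 : ℝ)..t, e s) (e t) t :=
  (intervalIntegral.integral_hasDerivAt_right (he.intervalIntegrable _ _)
      he.aestronglyMeasurable.stronglyMeasurableAtFilter he.continuousAt).const_add _

/-- Pointwise differentiability of the transforms upgrades to differentiability in norm, because the
candidate derivative is a continuous `L²` curve and can be integrated. -/
theorem hasDerivAt_prop_of_ba {f g : L2 d}
    (h : ∀ t z, HasDerivAt (fun t => ba (prop t f) z) (ba (-Complex.I • prop t g : L2 d) z) t)
    (t : ℝ) : HasDerivAt (fun t => prop t f) (-Complex.I • prop t g) t := by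
  have hc : Continuous fun t => -Complex.I • prop t g :=
    (continuous_prop g).fun_const_smul (-Complex.I)
  have h1 : (fun t => prop t f) = fun t => prop 0 f + ∫ s in (0 : ℝ)..t, -Complex.I • prop s g := by
    funext t
    exact eq_add_integral_of_ba (w := fun t => prop t f) hc convex_univ (Set.mem_univ _)
      (fun z t _ => (h t z).hasDerivWithinAt) (Set.mem_univ t)
  rw [h1]
  exact hasDerivAt_add_integral hc _ t

/-- The harmonic oscillator generates the propagator on Schwartz functions. -/
theorem hasDerivAt_prop (φ : 𝓢(Rd d, ℂ)) (t : ℝ) :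
    HasDerivAt (fun t => prop t (φ.toLp 2 : L2 d))
      (-Complex.I • prop t ((oscS φ).toLp 2 : L2 d)) t :=
  hasDerivAt_prop_of_ba (fun t z => hasDerivAt_ba_prop φ t z) t

end Generator

/-! ### Convolution estimates -/

section Young

variable {G : Type*} [MeasurableSpace G] {μ : Measure G}

/-- Jensen's inequality for a weighted integral. -/
theorem lintegral_mul_rpow_le {a F : G → ℝ≥0∞} (ha : AEMeasurable a μ) (hF : AEMeasurable F μ)
    {p : ℝ} (hp : 1 ≤ p) :
    (∫⁻ w, a w * F w ∂μ) ^ p ≤ (∫⁻ w, a w ∂μ) ^ (p - 1) * ∫⁻ w, a w * F w ^ p ∂μ := by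
  have hp0 : 0 < p := by linarith
  have hq : 0 ≤ 1 - p⁻¹ := by
    have := inv_le_one_of_one_le₀ hp
    linarith
  -- Hölder's inequality for the splitting `a F = a^{1 - 1/p} (a F^p)^{1/p}`.
  have h := ENNReal.lintegral_mul_norm_pow_le ha (ha.mul (hF.pow_const p)) hq
    (inv_nonneg.2 hp0.le) (by ring)
  have h1 : ∀ w, a w ^ (1 - p⁻¹) * (a * fun x => F x ^ p) w ^ p⁻¹ = a w * F w := by
    intro w
    rw [Pi.mul_apply, ENNReal.mul_rpow_of_nonneg _ _ (inv_nonneg.2 hp0.le), ← mul_assoc,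
      ← ENNReal.rpow_add_of_nonneg _ _ hq (inv_nonneg.2 hp0.le), ← ENNReal.rpow_mul,
      mul_inv_cancel₀ hp0.ne', ENNReal.rpow_one]
    simp
  simp only [h1] at h
  calc (∫⁻ w, a w * F w ∂μ) ^ p
      ≤ ((∫⁻ w, a w ∂μ) ^ (1 - p⁻¹) * (∫⁻ w, (a * fun x => F x ^ p) w ∂μ) ^ p⁻¹) ^ p :=
        ENNReal.rpow_le_rpow h hp0.le
    _ = _ := by
        rw [ENNReal.mul_rpow_of_nonneg _ _ hp0.le, ← ENNReal.rpow_mul, ← ENNReal.rpow_mul,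
          inv_mul_cancel₀ hp0.ne', ENNReal.rpow_one, sub_mul, inv_mul_cancel₀ hp0.ne', one_mul]
        rfl

variable [AddCommGroup G] [MeasurableAdd₂ G] [MeasurableNeg G] [μ.IsAddLeftInvariant]
  [μ.IsNegInvariant]

/-- Jensen's inequality with weight `Θ (z - ·)`, then Tonelli and translation invariance. -/
theorem lintegral_convolution_rpow_le [SFinite μ] {Θ F : G → ℝ≥0∞} (hΘ : Measurable Θ) (hF : Measurable F)
    {p : ℝ} (hp : 1 ≤ p) :
    ∫⁻ z, (∫⁻ w, Θ (z - w) * F w ∂μ) ^ p ∂μ ≤ (∫⁻ w, Θ w ∂μ) ^ p * ∫⁻ w, F w ^ p ∂μ := by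
  have hsub : Measurable fun a : G × G => Θ (a.1 - a.2) :=
    hΘ.comp (measurable_fst.sub measurable_snd)
  have h1 : ∀ z, ∫⁻ w, Θ (z - w) ∂μ = ∫⁻ w, Θ w ∂μ := fun z =>
    lintegral_sub_left_eq_self Θ z
  calc ∫⁻ z, (∫⁻ w, Θ (z - w) * F w ∂μ) ^ p ∂μ
      ≤ ∫⁻ z, (∫⁻ w, Θ w ∂μ) ^ (p - 1) * ∫⁻ w, Θ (z - w) * F w ^ p ∂μ ∂μ := by
        refine lintegral_mono fun z => ?_
        rw [← h1 z]
        exact lintegral_mul_rpow_le (hsub.comp measurable_prodMk_left).aemeasurable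
          hF.aemeasurable hp
    _ = (∫⁻ w, Θ w ∂μ) ^ (p - 1) * ∫⁻ z, ∫⁻ w, Θ (z - w) * F w ^ p ∂μ ∂μ := by
        rw [lintegral_const_mul]
        exact Measurable.lintegral_prod_right'
          (f := fun a : G × G => Θ (a.1 - a.2) * F a.2 ^ p)
          (hsub.mul ((hF.comp measurable_snd).pow_const p))
    _ = (∫⁻ w, Θ w ∂μ) ^ (p - 1) * ∫⁻ w, (∫⁻ z, Θ z ∂μ) * F w ^ p ∂μ := by
        congr 1
        rw [lintegral_lintegral_swap (hsub.mul
          ((hF.comp measurable_snd).pow_const p)).aemeasurable]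
        refine lintegral_congr fun w => ?_
        have hw : Measurable fun x => Θ (x - w) := hΘ.comp (measurable_id.sub measurable_const)
        rw [lintegral_mul_const _ hw]
        congr 1
        exact lintegral_sub_right_eq_self Θ w
    _ = _ := by
        rw [lintegral_const_mul _ (hF.pow_const p), ← mul_assoc]
        congr 1
        nth_rewrite 2 [← ENNReal.rpow_one (∫⁻ w, Θ w ∂μ)]
        rw [← ENNReal.rpow_add_of_nonneg _ _ (by linarith) zero_le_one, sub_add_cancel]

variable {A F : G → ℂ} {Θ : G → ℝ≥0∞}

/-- Young's inequality for a function dominated by a convolution. -/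
theorem eLpNorm_le_of_le_convolution [SFinite μ] (hΘ : Measurable Θ) (hF : Measurable F)
    (h : ∀ z, ‖A z‖ₑ ≤ ∫⁻ w, Θ (z - w) * ‖F w‖ₑ ∂μ) {p : ℝ≥0∞} (hp : 1 ≤ p) (hp' : p ≠ ∞) :
    eLpNorm A p μ ≤ (∫⁻ w, Θ w ∂μ) * eLpNorm F p μ := by
  have hp0 : p ≠ 0 := (one_pos.trans_le hp).ne'
  have hr : 1 ≤ p.toReal := by
    rw [← ENNReal.toReal_one]
    exact ENNReal.toReal_mono hp' hp
  have hr0 : 0 < p.toReal := by linarith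
  rw [eLpNorm_eq_lintegral_rpow_enorm_toReal hp0 hp', eLpNorm_eq_lintegral_rpow_enorm_toReal hp0 hp']
  have h1 : ∫⁻ z, ‖A z‖ₑ ^ p.toReal ∂μ ≤
      (∫⁻ w, Θ w ∂μ) ^ p.toReal * ∫⁻ w, ‖F w‖ₑ ^ p.toReal ∂μ :=
    (lintegral_mono fun z => ENNReal.rpow_le_rpow (h z) hr0.le).trans
      (lintegral_convolution_rpow_le hΘ hF.enorm hr)
  refine (ENNReal.rpow_le_rpow h1 (by positivity)).trans (le_of_eq ?_)
  rw [ENNReal.mul_rpow_of_nonneg _ _ (by positivity), ← ENNReal.rpow_mul, one_div,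
    mul_inv_cancel₀ hr0.ne', ENNReal.rpow_one]

theorem enorm_le_of_le_convolution (hΘ : Measurable Θ) (hF : Measurable F) {M : ℝ≥0∞}
    (hM : ∀ w, Θ w ≤ M) (h : ∀ z, ‖A z‖ₑ ≤ ∫⁻ w, Θ (z - w) * ‖F w‖ₑ ∂μ) {p : ℝ≥0∞} (hp : 1 ≤ p)
    (hp' : p ≠ ∞) (z : G) :
    ‖A z‖ₑ ≤ ((∫⁻ w, Θ w ∂μ) ^ (p.toReal - 1) * M) ^ (p.toReal⁻¹) * eLpNorm F p μ := by
  have hp0 : p ≠ 0 := (one_pos.trans_le hp).ne'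
  have hr : 1 ≤ p.toReal := by
    rw [← ENNReal.toReal_one]
    exact ENNReal.toReal_mono hp' hp
  have hr0 : 0 < p.toReal := by linarith
  have hsub : Measurable fun w => Θ (z - w) := hΘ.comp (measurable_const.sub measurable_id)
  have h1 : ‖A z‖ₑ ^ p.toReal ≤
      (∫⁻ w, Θ w ∂μ) ^ (p.toReal - 1) * M * ∫⁻ w, ‖F w‖ₑ ^ p.toReal ∂μ := by
    refine (ENNReal.rpow_le_rpow (h z) hr0.le).trans ((lintegral_mul_rpow_le hsub.aemeasurable
      hF.enorm.aemeasurable hr).trans ?_)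
    rw [lintegral_sub_left_eq_self Θ z, mul_assoc, ← lintegral_const_mul _ (hF.enorm.pow_const _)]
    gcongr
    exact hM _
  have h2 := ENNReal.rpow_le_rpow h1 (inv_nonneg.2 hr0.le)
  rw [← ENNReal.rpow_mul, mul_inv_cancel₀ hr0.ne', ENNReal.rpow_one,
    ENNReal.mul_rpow_of_nonneg _ _ (inv_nonneg.2 hr0.le)] at h2
  rwa [eLpNorm_eq_lintegral_rpow_enorm_toReal hp0 hp', one_div]

/-- `A` is bounded both in `L^p` and pointwise by `B`, so `|A|² ≤ B^{2-p} |A|^p` settles the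
exponent 2. The condition `p ≤ 2` of the theorem enters here and yields the embedding of `M^{p,p}`
into `L²`. -/
theorem eLpNorm_two_le_of_le_convolution [SFinite μ] (hΘ : Measurable Θ) (hF : Measurable F)
    {M : ℝ≥0∞}
    (hM : ∀ w, Θ w ≤ M) (h : ∀ z, ‖A z‖ₑ ≤ ∫⁻ w, Θ (z - w) * ‖F w‖ₑ ∂μ) {p : ℝ≥0∞} (hp : 1 ≤ p)
    (hp2 : p ≤ 2) :
    eLpNorm A 2 μ ≤ max (∫⁻ w, Θ w ∂μ)
      (((∫⁻ w, Θ w ∂μ) ^ (p.toReal - 1) * M) ^ (p.toReal⁻¹)) * eLpNorm F p μ := by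
  have hp' : p ≠ ∞ := (hp2.trans_lt (by simp)).ne
  have hp0 : p ≠ 0 := (one_pos.trans_le hp).ne'
  have hr : 1 ≤ p.toReal := by
    rw [← ENNReal.toReal_one]
    exact ENNReal.toReal_mono hp' hp
  have hr2 : p.toReal ≤ 2 := by
    have := ENNReal.toReal_mono (by simp) hp2
    simpa using this
  have hr0 : 0 < p.toReal := by linarith
  set C := max (∫⁻ w, Θ w ∂μ) (((∫⁻ w, Θ w ∂μ) ^ (p.toReal - 1) * M) ^ (p.toReal⁻¹)) with hC
  set B := C * eLpNorm F p μ with hB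
  have h1 : ∀ z, ‖A z‖ₑ ≤ B := fun z =>
    (enorm_le_of_le_convolution hΘ hF hM h hp hp' z).trans (mul_le_mul' (le_max_right _ _) le_rfl)
  have h2 : eLpNorm A p μ ≤ B :=
    (eLpNorm_le_of_le_convolution hΘ hF h hp hp').trans (mul_le_mul' (le_max_left _ _) le_rfl)
  rw [eLpNorm_eq_lintegral_rpow_enorm_toReal hp0 hp'] at h2
  have h3 : ∫⁻ z, ‖A z‖ₑ ^ p.toReal ∂μ ≤ B ^ p.toReal := by
    have := ENNReal.rpow_le_rpow h2 hr0.le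
    rwa [← ENNReal.rpow_mul, one_div, inv_mul_cancel₀ hr0.ne', ENNReal.rpow_one] at this
  rw [eLpNorm_eq_lintegral_rpow_enorm_toReal (by simp) (by simp)]
  simp only [ENNReal.toReal_ofNat]
  have h4 : ∫⁻ z, ‖A z‖ₑ ^ (2 : ℝ) ∂μ ≤ B ^ (2 : ℝ) := by
    have hpt : ∀ z, ‖A z‖ₑ ^ (2 : ℝ) ≤ B ^ (2 - p.toReal) * ‖A z‖ₑ ^ p.toReal := by
      intro z
      have : (2 : ℝ) = (2 - p.toReal) + p.toReal := by ring
      rw [this, ENNReal.rpow_add_of_nonneg _ _ (by linarith) hr0.le, ← this]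
      gcongr
      exact h1 z
    by_cases hBtop : B = ∞
    · simp [hBtop]
    refine (lintegral_mono hpt).trans ?_
    rw [lintegral_const_mul' _ _ (ENNReal.rpow_ne_top_of_nonneg (by linarith) hBtop)]
    refine (mul_le_mul_right h3 _).trans (le_of_eq ?_)
    rw [← ENNReal.rpow_add_of_nonneg _ _ (by linarith) hr0.le]
    congr 1
    ring
  have h5 := ENNReal.rpow_le_rpow h4 (by positivity : (0 : ℝ) ≤ 1 / 2)
  rwa [← ENNReal.rpow_mul, show (2 : ℝ) * (1 / 2) = 1 by norm_num, ENNReal.rpow_one] at h5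

end Young

/-! ### Independence of the window -/

section Window

variable {d : ℕ}

instance : (volume : Measure (PS d)).IsNegInvariant :=
  Measure.IsAddHaarMeasure.isNegInvariant_of_regular volume

theorem norm_ba_weyl (z : PS d) (φ : 𝓢(Rd d, ℂ)) (w : PS d) :
    ‖ba (weyl z φ) w‖ = ‖ba φ (w - z)‖ := by
  have h := weyl_weyl z (w - z) (gau : 𝓢(Rd d, ℂ))
  rw [add_sub_cancel] at h
  set c : ℝ := (inner ℝ z.2 (w - z).1 - inner ℝ z.1 (w - z).2) / 2
  have h1 : ∀ s, weyl z φ s * conj (coh w s) = Complex.exp (Complex.I * (c : ℂ)) *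
      (φ (s - z.1) * conj (coh (w - z) (s - z.1))) := by
    intro s
    have h2 : coh w s = conj (Complex.exp (Complex.I * (c : ℂ))) * weyl z (coh (w - z)) s := by
      rw [coh, coh, h, smul_apply, smul_eq_mul, ← mul_assoc, ← Complex.normSq_eq_conj_mul_self,
        Complex.normSq_eq_norm_sq, norm_exp_I_mul_ofReal]
      simp
    rw [h2, weyl_apply, weyl_apply, map_mul, map_mul, Complex.conj_conj]
    set e := Complex.exp (Complex.I * ((inner ℝ z.2 s - (inner ℝ z.1 z.2) / 2 : ℝ) : ℂ))
    have he : e * conj e = 1 := by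
      rw [Complex.mul_conj, Complex.normSq_eq_norm_sq, norm_exp_I_mul_ofReal]
      simp
    calc _ = (e * conj e) * (Complex.exp (Complex.I * (c : ℂ)) *
        (φ (s - z.1) * conj (coh (w - z) (s - z.1)))) := by ring
      _ = _ := by rw [he, one_mul]
  rw [ba, ba]
  simp_rw [h1]
  rw [integral_const_mul, norm_mul, norm_exp_I_mul_ofReal, one_mul,
    integral_sub_right_eq_self (fun s => φ s * conj (coh (w - z) s)) z.1]

theorem ba_zero_eq_gauPairing (φ : 𝓢(Rd d, ℂ)) : ba φ 0 = gauPairing φ := by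
  rw [ba, gauPairing]
  congr 1
  ext s
  rw [conj_coh, mul_comm, coh, weyl_apply]
  simp [zbar]

/-- A window may be orthogonal to the Gaussian, which would make the inversion constant vanish. Its
shifts cannot all be, because in modulus these pairings run through all values of the injective
transform of `g`. -/
theorem exists_gauPairing_weyl_ne_zero {g : 𝓢(Rd d, ℂ)} (hg : g ≠ 0) :
    ∃ z : PS d, gauPairing (weyl z g) ≠ 0 := by
  by_contra! h
  have h1 : (g.toLp 2 : L2 d) = 0 := by
    refine ba_eq_zero_imp fun z => ?_
    have h2 := norm_ba_weyl (-z) g 0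
    rw [ba_zero_eq_gauPairing, h, norm_zero, sub_neg_eq_add, zero_add] at h2
    rw [ba_toLp]
    exact norm_eq_zero.1 h2.symm
  refine hg (SchwartzMap.injective_toLp 2 volume ?_)
  exact h1.trans (map_zero (SchwartzMap.toLpCLM ℂ ℂ 2 (volume : Measure (Rd d)))).symm

theorem lintegral_enorm_ba_lt_top (φ : 𝓢(Rd d, ℂ)) : ∫⁻ w, ‖ba φ w‖ₑ < ∞ := by
  have h := integrable_ba_mul_of_bounded φ (F := fun _ => 1) (C := 1)
    aestronglyMeasurable_const (by simp)
  simp only [mul_one] at h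
  exact h.2

/-- A change of window is controlled by convolution with a bounded integrable kernel. -/
theorem exists_window_kernel (φ : 𝓢(Rd d, ℂ)) {g : 𝓢(Rd d, ℂ)} (hg : g ≠ 0) :
    ∃ Θ : PS d → ℝ≥0∞, Measurable Θ ∧ ∫⁻ w, Θ w ≠ ∞ ∧ (∃ M : ℝ≥0∞, M ≠ ∞ ∧ ∀ w, Θ w ≤ M) ∧
      ∀ (T : 𝓢'(Rd d, ℂ)) (z : PS d), ‖T (weyl z φ)‖ₑ ≤ ∫⁻ w, Θ (z - w) * ‖T (weyl w g)‖ₑ := by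
  obtain ⟨z₁, hz₁⟩ := exists_gauPairing_weyl_ne_zero hg
  set c : ℂ := (2 * Real.pi) ^ d * gauPairing (weyl z₁ g)
  have hc : c ≠ 0 := by
    refine mul_ne_zero (pow_ne_zero _ ?_) hz₁
    exact_mod_cast Real.two_pi_pos.ne'
  have hmeas : Measurable fun w : PS d => ‖ba φ w‖ₑ := (continuous_ba_schwartz φ).enorm.measurable
  have hsub : Measurable fun u : PS d => -u - z₁ := by fun_prop
  have hctop : ‖c⁻¹‖ₑ ≠ ∞ := enorm_ne_top
  obtain ⟨A, hA, hdec⟩ := exists_ba_decay φ 0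
  refine ⟨fun u => ‖c⁻¹‖ₑ * ‖ba φ (-u - z₁)‖ₑ, (hmeas.comp hsub).const_mul _, ?_,
    ⟨‖c⁻¹‖ₑ * ENNReal.ofReal A, ENNReal.mul_ne_top hctop ENNReal.ofReal_ne_top, fun w => ?_⟩,
    fun T z => ?_⟩
  · have hm : Measurable fun u : PS d => ‖ba φ (-u - z₁)‖ₑ := hmeas.comp hsub
    rw [lintegral_const_mul _ hm]
    refine ENNReal.mul_ne_top hctop (ne_of_eq_of_ne ?_ (lintegral_enorm_ba_lt_top φ).ne)
    rw [lintegral_neg_eq_self (fun u => ‖ba φ (u - z₁)‖ₑ),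
      lintegral_sub_right_eq_self (fun u => ‖ba φ u‖ₑ) z₁]
  · refine mul_le_mul' le_rfl ?_
    rw [← ofReal_norm]
    refine ENNReal.ofReal_le_ofReal ?_
    simpa using hdec (-w - z₁)
  -- `T` is synthesised with the shifted window; covariance of `ba` and `weyl_weyl` turn the
  -- integral into a convolution up to phases, and translating by `z₁` removes the shift from the
  -- argument of `T`.
  · have h := distribution_inversion T (weyl z φ) (weyl z₁ g)
    have h1 : T (weyl z φ) = c⁻¹ * ∫ w, ba (weyl z φ) w * T (weyl w (weyl z₁ g)) := by
      rw [h, inv_mul_cancel_left₀ hc]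
    rw [h1, enorm_mul]
    calc ‖c⁻¹‖ₑ * ‖∫ w, ba (weyl z φ) w * T (weyl w (weyl z₁ g))‖ₑ
        ≤ ‖c⁻¹‖ₑ * ∫⁻ w, ‖ba (weyl z φ) w * T (weyl w (weyl z₁ g))‖ₑ := by
          gcongr
          exact enorm_integral_le_lintegral_enorm _
      _ = ‖c⁻¹‖ₑ * ∫⁻ w, ‖ba φ (w - z)‖ₑ * ‖T (weyl (w + z₁) g)‖ₑ := by
          congr 1
          refine lintegral_congr fun w => ?_
          rw [enorm_mul, weyl_weyl, map_smul, enorm_smul]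
          congr 1
          · rw [← ofReal_norm, norm_ba_weyl, ofReal_norm]
          · rw [← ofReal_norm (Complex.exp _), norm_exp_I_mul_ofReal, ENNReal.ofReal_one, one_mul]
      _ = ‖c⁻¹‖ₑ * ∫⁻ w, ‖ba φ (w - z₁ - z)‖ₑ * ‖T (weyl w g)‖ₑ := by
          congr 1
          rw [← lintegral_sub_right_eq_self
            (fun w => ‖ba φ (w - z)‖ₑ * ‖T (weyl (w + z₁) g)‖ₑ) z₁]
          simp only [sub_add_cancel]
      _ = _ := by
          rw [← lintegral_const_mul' _ _ hctop]
          refine lintegral_congr fun w => ?_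
          rw [mul_assoc, show -(z - w) - z₁ = w - z₁ - z by abel]

theorem measurable_apply_weyl (T : 𝓢'(Rd d, ℂ)) (g : 𝓢(Rd d, ℂ)) :
    Measurable fun z : PS d => T (weyl z g) :=
  ((map_continuous T).comp (continuous_weyl g)).measurable

theorem measurePreserving_zbar : MeasurePreserving (zbar : PS d → PS d) volume volume :=
  (MeasurePreserving.id volume).prod (Measure.measurePreserving_neg volume)

theorem zbar_zbar (z : PS d) : zbar (zbar z) = z := by simp [zbar]

/-- Phase-space conjugation as a homeomorphism. -/
def zbarHomeomorph : PS d ≃ₜ PS d where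
  toFun := zbar
  invFun := zbar
  left_inv := zbar_zbar
  right_inv := zbar_zbar
  continuous_toFun := continuous_zbar
  continuous_invFun := continuous_zbar

theorem eLpNorm_comp_zbar {F : PS d → ℂ} (hF : Measurable F) (p : ℝ≥0∞) :
    eLpNorm (fun z => F (zbar z)) p volume = eLpNorm F p volume :=
  eLpNorm_comp_measurePreserving hF.aestronglyMeasurable measurePreserving_zbar

/-- The normalizing constant of the short-time Fourier transform. -/
def stftConst (d : ℕ) : ℝ := (2 * Real.pi) ^ (-(d : ℝ) / 2)

theorem stftConst_pos : 0 < stftConst d := by unfold stftConst; positivity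

theorem enorm_stft (g : 𝓢(Rd d, ℂ)) (T : 𝓢'(Rd d, ℂ)) (x y : Rd d) :
    ‖stft g T x y‖ₑ = ‖stftConst d‖ₑ * ‖T (weyl (x, -y) (conjS g))‖ₑ := by
  have h : modulation y (translation x g) = tf (x, y) g := rfl
  rw [stft, h, conjS_tf, weyl, map_smul, enorm_mul, enorm_smul]
  rw [← ofReal_norm (Complex.exp _), norm_exp_I_mul_ofReal, ENNReal.ofReal_one, one_mul,
    ← ofReal_norm ((_ : ℝ) : ℂ), Complex.norm_real, ofReal_norm]
  rfl

/-- Since the inner and outer exponents agree, Tonelli merges the mixed norm into one `L^p` norm on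
phase space. The conjugated window and the sign of `y` come from conjugate linearity in the second
slot. -/
theorem modNorm_eq (g : 𝓢(Rd d, ℂ)) (T : 𝓢'(Rd d, ℂ)) {p : ℝ≥0∞} (hp : 1 ≤ p) (hp' : p ≠ ∞) :
    modNorm g p p T = ‖stftConst d‖ₑ * eLpNorm (fun z => T (weyl z (conjS g))) p volume := by
  have hp0 : p ≠ 0 := (one_pos.trans_le hp).ne'
  have hr0 : 0 < p.toReal := ENNReal.toReal_pos hp0 hp'
  have hm : Measurable fun z : PS d => ‖T (weyl (z.1, -z.2) (conjS g))‖ₑ :=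
    ((measurable_apply_weyl T (conjS g)).comp measurePreserving_zbar.measurable).enorm
  rw [← eLpNorm_comp_zbar (measurable_apply_weyl T (conjS g))]
  simp only [modNorm, eLpNorm_eq_lintegral_rpow_enorm_toReal hp0 hp', enorm_stft, enorm_eq_self,
    zbar]
  simp only [← ENNReal.rpow_mul, one_div, inv_mul_cancel₀ hr0.ne', ENNReal.rpow_one]
  simp only [ENNReal.mul_rpow_of_nonneg _ _ hr0.le]
  have h1 : ∫⁻ z : PS d, ‖T (weyl (z.1, -z.2) (conjS g))‖ₑ ^ p.toReal =
      ∫⁻ y, ∫⁻ x, ‖T (weyl (x, -y) (conjS g))‖ₑ ^ p.toReal :=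
    lintegral_prod_symm' _ (hm.pow_const _)
  rw [h1]
  have hc : ‖stftConst d‖ₑ ^ p.toReal ≠ ∞ := ENNReal.rpow_ne_top_of_nonneg hr0.le enorm_ne_top
  simp_rw [lintegral_const_mul' _ _ hc]
  rw [ENNReal.mul_rpow_of_nonneg _ _ (inv_nonneg.2 hr0.le), ← ENNReal.rpow_mul,
    mul_inv_cancel₀ hr0.ne', ENNReal.rpow_one]

theorem conjS_ne_zero {g : 𝓢(Rd d, ℂ)} (hg : g ≠ 0) : conjS g ≠ 0 := by
  intro h
  apply hg
  rw [← conjS_conjS g, h]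
  ext s
  simp [conjS_apply]

theorem gau_ne_zero : (gau : 𝓢(Rd d, ℂ)) ≠ 0 := by
  intro h
  have h1 := congrArg (fun f : 𝓢(Rd d, ℂ) => f 0) h
  simp [gau_apply] at h1

theorem exists_eLpNorm_coh_le_modNorm {g : 𝓢(Rd d, ℂ)} (hg : g ≠ 0) {p : ℝ≥0∞} (hp : 1 ≤ p)
    (hp2 : p ≤ 2) :
    ∃ C : ℝ≥0∞, C ≠ ∞ ∧ ∀ T : 𝓢'(Rd d, ℂ),
      eLpNorm (fun z => T (coh z)) p volume ≤ C * modNorm g p p T ∧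
      eLpNorm (fun z => T (coh z)) 2 volume ≤ C * modNorm g p p T := by
  have hp' : p ≠ ∞ := (hp2.trans_lt (by simp)).ne
  have hr : 1 ≤ p.toReal := by
    rw [← ENNReal.toReal_one]
    exact ENNReal.toReal_mono hp' hp
  obtain ⟨Θ, hΘ, hΘi, ⟨M, hM, hΘM⟩, h⟩ := exists_window_kernel gau (conjS_ne_zero hg)
  set B := max (∫⁻ w, Θ w) (((∫⁻ w, Θ w) ^ (p.toReal - 1) * M) ^ (p.toReal⁻¹))
  have hB : B ≠ ∞ := by
    refine (max_lt hΘi.lt_top (ENNReal.rpow_lt_top_of_nonneg (by positivity) ?_)).ne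
    exact ENNReal.mul_ne_top (ENNReal.rpow_ne_top_of_nonneg (by linarith) hΘi) hM
  have hc0 : ‖stftConst d‖ₑ ≠ 0 := by simpa using stftConst_pos.ne'
  refine ⟨B * ‖stftConst d‖ₑ⁻¹, ENNReal.mul_ne_top hB (ENNReal.inv_ne_top.2 hc0), fun T => ?_⟩
  rw [modNorm_eq g T hp hp', ← mul_assoc, mul_assoc B,
    ENNReal.inv_mul_cancel hc0 enorm_ne_top, mul_one]
  exact ⟨(eLpNorm_le_of_le_convolution hΘ (measurable_apply_weyl T _) (h T) hp hp').trans
    (mul_le_mul' (le_max_left _ _) le_rfl),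
    eLpNorm_two_le_of_le_convolution hΘ (measurable_apply_weyl T _) hΘM (h T) hp hp2⟩

theorem exists_modNorm_le_eLpNorm_coh (g : 𝓢(Rd d, ℂ)) {p : ℝ≥0∞} (hp : 1 ≤ p) (hp' : p ≠ ∞) :
    ∃ C : ℝ≥0∞, C ≠ ∞ ∧ ∀ T : 𝓢'(Rd d, ℂ),
      modNorm g p p T ≤ C * eLpNorm (fun z => T (coh z)) p volume := by
  obtain ⟨Θ, hΘ, hΘi, -, h⟩ := exists_window_kernel (conjS g) gau_ne_zero
  refine ⟨‖stftConst d‖ₑ * ∫⁻ w, Θ w, ENNReal.mul_ne_top enorm_ne_top hΘi, fun T => ?_⟩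
  rw [modNorm_eq g T hp hp', mul_assoc]
  gcongr
  exact eLpNorm_le_of_le_convolution hΘ (measurable_apply_weyl T _) (h T) hp hp'

end Window

/-! ### Square-integrable distributions -/

section Regularity

variable {d : ℕ}

/-- The tempered distribution of an `L²` function. -/
def dist2 : L2 d →L[ℂ] 𝓢'(Rd d, ℂ) := Lp.toTemperedDistributionCLM ℂ volume 2

theorem dist2_apply (f : L2 d) (φ : 𝓢(Rd d, ℂ)) : dist2 f φ = ∫ s, φ s * f s := by
  rw [dist2, Lp.toTemperedDistributionCLM_apply, Lp.toTemperedDistribution_apply]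
  simp only [smul_eq_mul]

theorem dist2_apply_eq_inner (f : L2 d) (φ : 𝓢(Rd d, ℂ)) :
    dist2 f φ = inner ℂ ((conjS φ).toLp 2 : L2 d) f := by
  rw [dist2_apply, inner_toLp_eq]
  simp only [conjS_apply, Complex.conj_conj, mul_comm]

theorem dist2_coh (f : L2 d) (z : PS d) : dist2 f (coh z) = ba f (zbar z) := by
  rw [dist2_apply, ba_eq, zbar_zbar]
  simp only [mul_comm]

theorem eLpNorm_dist2_coh (f : L2 d) (p : ℝ≥0∞) :
    eLpNorm (fun z => dist2 f (coh z)) p volume = eLpNorm (ba f) p volume := by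
  simp only [dist2_coh]
  exact eLpNorm_comp_zbar (continuous_ba f).measurable p

theorem isFunction_of_memLp {f : Rd d → ℂ} {p : ℝ≥0∞} (hp : 1 ≤ p) (hf : MemLp f p volume)
    {T : 𝓢'(Rd d, ℂ)} (hT : ∀ φ : 𝓢(Rd d, ℂ), T φ = ∫ x, φ x * f x) : IsFunction T f := by
  refine ⟨hf.locallyIntegrable hp, fun φ => ⟨?_, hT φ⟩⟩
  have : ENNReal.HolderConjugate p (ENNReal.conjExponent p) := .conjExponent hp
  have : ENNReal.HolderTriple (ENNReal.conjExponent p) p 1 :=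
    (inferInstance : ENNReal.HolderConjugate (ENNReal.conjExponent p) p)
  exact memLp_one_iff_integrable.1 (MemLp.mul' (p := ENNReal.conjExponent p) (q := p) hf
    (φ.memLp _ volume))

theorem isFunction_dist2 (f : L2 d) : IsFunction (dist2 f) f :=
  isFunction_of_memLp one_le_two (Lp.memLp f) (dist2_apply f)

theorem IsFunction.congr {T : 𝓢'(Rd d, ℂ)} {f h : Rd d → ℂ} (hf : IsFunction T f)
    (hfh : f =ᵐ[volume] h) : IsFunction T h := by
  refine ⟨hf.1.congr hfh, fun φ => ?_⟩
  have h1 : (fun x => φ x * f x) =ᵐ[volume] fun x => φ x * h x := by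
    filter_upwards [hfh] with x hx
    rw [hx]
  exact ⟨(hf.2 φ).1.congr h1, (hf.2 φ).2.trans (integral_congr_ae h1)⟩

theorem IsFunction.ae_eq {T : 𝓢'(Rd d, ℂ)} {f h : Rd d → ℂ} (hf : IsFunction T f)
    (hh : IsFunction T h) : f =ᵐ[volume] h := by
  refine ae_eq_of_integral_contDiff_smul_eq hf.1 hh.1 fun η hη hηc => ?_
  have h1 : HasCompactSupport fun x => (η x : ℂ) := hηc.comp_left Complex.ofReal_zero
  simp only [Complex.real_smul]
  exact (hf.2 (h1.toSchwartzMap (Complex.ofRealCLM.contDiff.comp hη))).2.symm.trans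
    (hh.2 (h1.toSchwartzMap (Complex.ofRealCLM.contDiff.comp hη))).2

/-- A tempered distribution with square-integrable coherent-state transform is an `L²` function. -/
theorem exists_eq_dist2 {T : 𝓢'(Rd d, ℂ)} (hT : eLpNorm (fun z => T (coh z)) 2 volume < ∞) :
    ∃ f : L2 d, T = dist2 f := by
  have hm : MemLp (fun z => T (coh (zbar z))) 2 volume := by
    refine ⟨((measurable_apply_weyl T gau).comp
      measurePreserving_zbar.measurable).aestronglyMeasurable, ?_⟩
    exact (eLpNorm_comp_zbar (measurable_apply_weyl T gau) 2).trans_lt hT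
  set F : LZ d 2 := hm.toLp
  -- The square-integrable transform need not be known to lie in the range of `baL`; the adjoint
  -- produces a function, and the inversion formula for `T` shows that it represents `T`.
  refine ⟨(moyal d : ℂ)⁻¹ • ContinuousLinearMap.adjoint baL F, ?_⟩
  ext φ
  have hmo : (moyal d : ℂ) ≠ 0 := by exact_mod_cast moyal_pos.ne'
  rw [map_smul, smul_apply, smul_eq_mul, dist2_apply_eq_inner,
    ContinuousLinearMap.adjoint_inner_right, L2.inner_def, eq_inv_mul_iff_mul_eq₀ hmo, moyal_eq,
    ← distribution_inversion T φ gau]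
  have hz : ∫ w, ba φ w * T (weyl w gau) = ∫ w, ba φ (zbar w) * T (weyl (zbar w) gau) :=
    (measurePreserving_zbar.integral_comp (zbarHomeomorph.measurableEmbedding)
      (fun w => ba φ w * T (weyl w gau))).symm
  rw [hz]
  refine integral_congr_ae ?_
  filter_upwards [coeFn_baL ((conjS φ).toLp 2 : L2 d), hm.coeFn_toLp] with w h1 h2
  rw [h1, h2, RCLike.inner_apply, ba_toLp, mul_comm, coh]
  congr 1
  rw [ba, ba, ← integral_conj]
  congr 1
  ext s
  simp only [map_mul, conjS_apply, Complex.conj_conj, conj_coh, zbar_zbar]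

theorem eLpNorm_ba (f : L2 d) : eLpNorm (ba f) 2 volume = ENNReal.ofReal (√(moyal d) * ‖f‖) := by
  rw [← norm_baL, ← eLpNorm_congr_ae (coeFn_baL f), Lp.norm_def,
    ENNReal.ofReal_toReal (Lp.eLpNorm_ne_top _)]

end Regularity

/-! ### Potentials in the Sjöstrand class -/

section Sjostrand

variable {d : ℕ}

/-- A closed set of full measure is everything, so for continuous functions the essential supremum
bounds every value. -/
theorem enorm_le_eLpNorm_top {F : Rd d → ℂ} (hF : Continuous F) (x : Rd d) :
    ‖F x‖ₑ ≤ eLpNorm F ∞ volume := by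
  rw [eLpNorm_exponent_top]
  have h1 : IsClosed {y | ‖F y‖ₑ ≤ eLpNormEssSup F volume} :=
    isClosed_le hF.enorm continuous_const
  have h2 : Dense {y | ‖F y‖ₑ ≤ eLpNormEssSup F volume} :=
    Measure.dense_of_ae (enorm_ae_le_eLpNormEssSup F volume)
  have h3 : x ∈ closure {y | ‖F y‖ₑ ≤ eLpNormEssSup F volume} := h2 x
  rwa [h1.closure_eq] at h3

/-- The short-time Fourier transform of an element of the Sjöstrand class, with an arbitrary
window, is dominated by an integrable function of the frequency. -/
theorem exists_sjostrand_majorant {g : 𝓢(Rd d, ℂ)} (hg : g ≠ 0) {K : 𝓢'(Rd d, ℂ)}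
    (hK : K ∈ modSpace g ∞ 1) (φ : 𝓢(Rd d, ℂ)) :
    ∃ κ : Rd d → ℝ≥0∞, Measurable κ ∧ ∫⁻ η, κ η ≠ ∞ ∧
      ∀ x η, ‖K (weyl (x, η) φ)‖ₑ ≤ κ η := by
  have hcont : Continuous fun z : PS d => K (weyl z (conjS g)) :=
    (map_continuous K).comp (continuous_weyl _)
  set S : Rd d → ℝ≥0∞ := fun η => ⨆ x, ‖K (weyl (x, η) (conjS g))‖ₑ with hS
  have hSm : Measurable S :=
    -- An uncountable supremum of continuous functions is still lower semicontinuous, hence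
    -- measurable.
    (lowerSemicontinuous_iSup fun x => (hcont.comp (by fun_prop :
      Continuous fun η : Rd d => (x, η))).enorm.lowerSemicontinuous).measurable
  have hc0 : ‖stftConst d‖ₑ ≠ 0 := by simpa using stftConst_pos.ne'
  have hSi : ∫⁻ η, S η ≠ ∞ := by
    have h1 : ‖stftConst d‖ₑ * ∫⁻ η, S η ≤ modNorm g ∞ 1 K := by
      rw [← lintegral_neg_eq_self S, ← lintegral_const_mul' _ _ enorm_ne_top, modNorm,
        eLpNorm_one_eq_lintegral_enorm]
      refine lintegral_mono fun y => ?_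
      simp only [enorm_eq_self, hS, ENNReal.mul_iSup]
      refine iSup_le fun x => ?_
      rw [← enorm_stft]
      refine enorm_le_eLpNorm_top (F := fun x => stft g K x y) ?_ x
      have h2 : Continuous fun x : Rd d => conjS (modulation y (translation x g)) := by
        have : (fun x : Rd d => conjS (modulation y (translation x g))) =
            fun x => tf (zbar (x, y)) (conjS g) := by
          ext1 x
          exact conjS_tf (x, y) g
        rw [this]
        exact (continuous_tf _).comp (continuous_zbar.comp (by fun_prop))
      exact continuous_const.mul ((map_continuous K).comp h2)
    intro h
    rw [h, ENNReal.mul_top hc0] at h1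
    exact (hK : modNorm g ∞ 1 K < ∞).ne (top_le_iff.1 h1)
  obtain ⟨Θ, hΘ, hΘi, -, hP⟩ := exists_window_kernel φ (conjS_ne_zero hg)
  -- Once the position is bounded by the supremum `S`, only the frequency marginal of the kernel
  -- matters, and the majorant is a convolution on `ℝ^d`.
  set Θ₁ : Rd d → ℝ≥0∞ := fun v => ∫⁻ u, Θ (u, v)
  have hΘ₁ : Measurable Θ₁ := hΘ.lintegral_prod_left'
  have hΘ₁i : ∫⁻ v, Θ₁ v = ∫⁻ w, Θ w := (lintegral_prod_symm' Θ hΘ).symm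
  refine ⟨fun η => ∫⁻ v, Θ₁ (η - v) * S v, ?_, ?_, fun x η => ?_⟩
  · exact Measurable.lintegral_prod_right' (f := fun a : Rd d × Rd d => Θ₁ (a.1 - a.2) * S a.2)
      ((hΘ₁.comp (measurable_fst.sub measurable_snd)).mul (hSm.comp measurable_snd))
  · have h := lintegral_convolution_rpow_le (μ := (volume : Measure (Rd d))) hΘ₁ hSm le_rfl
    simp only [ENNReal.rpow_one] at h
    exact (h.trans_lt (ENNReal.mul_lt_top (hΘ₁i ▸ hΘi.lt_top) hSi.lt_top)).ne
  · refine (hP K (x, η)).trans ?_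
    have hm : Measurable fun w : PS d => Θ ((x, η) - w) * ‖K (weyl w (conjS g))‖ₑ :=
      (hΘ.comp (measurable_const.sub measurable_id)).mul hcont.enorm.measurable
    have h1 : ∫⁻ w : PS d, Θ ((x, η) - w) * ‖K (weyl w (conjS g))‖ₑ =
        ∫⁻ v, ∫⁻ u, Θ ((x, η) - (u, v)) * ‖K (weyl (u, v) (conjS g))‖ₑ :=
      lintegral_prod_symm' _ hm
    rw [h1]
    refine lintegral_mono fun v => ?_
    have hm2 : Measurable fun u : Rd d => Θ (x - u, η - v) :=
      hΘ.comp ((measurable_const.sub measurable_id).prodMk measurable_const)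
    calc ∫⁻ u, Θ ((x, η) - (u, v)) * ‖K (weyl (u, v) (conjS g))‖ₑ
        ≤ ∫⁻ u, Θ (x - u, η - v) * S v :=
          lintegral_mono fun u => mul_le_mul' le_rfl
            (le_iSup (fun x => ‖K (weyl (x, v) (conjS g))‖ₑ) u)
      _ = Θ₁ (η - v) * S v := by
          rw [lintegral_mul_const _ hm2,
            lintegral_sub_left_eq_self (fun u => Θ (u, η - v)) x]

theorem continuous_coh_uncurry : Continuous fun a : PS d × Rd d => coh a.1 a.2 := by
  simp only [coh_apply]
  fun_prop

/-- An element of the Sjöstrand class is a bounded function. -/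
theorem exists_bounded_function {K : 𝓢'(Rd d, ℂ)} {κ : Rd d → ℝ≥0∞} (hκ : Measurable κ)
    (hκi : ∫⁻ η, κ η ≠ ∞) (hκK : ∀ x η, ‖K (weyl (x, η) gau)‖ₑ ≤ κ η) :
    ∃ (k : Rd d → ℂ) (B : ℝ), Measurable k ∧ (∀ s, ‖k s‖ ≤ B) ∧ ∀ φ : 𝓢(Rd d, ℂ), K φ = ∫ s, φ s * k s := by
  have hKc : Continuous fun w : PS d => K (coh w) := (map_continuous K).comp (continuous_weyl _)
  set D : ℝ≥0∞ := (∫⁻ s : Rd d, ‖gau s‖ₑ) * ∫⁻ η, κ η with hD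
  have hgm : Measurable fun s : Rd d => ‖gau s‖ₑ := gau.continuous.enorm.measurable
  have hDt : D ≠ ∞ := ENNReal.mul_ne_top gau.integrable.2.ne hκi
  have hbound : ∀ s : Rd d, ∫⁻ w : PS d, ‖conj (coh w s) * K (coh w)‖ₑ ≤ D := by
    intro s
    have hm : Measurable fun u : Rd d => ‖gau (s - u)‖ₑ :=
      hgm.comp (measurable_const.sub measurable_id)
    calc ∫⁻ w : PS d, ‖conj (coh w s) * K (coh w)‖ₑ
        ≤ ∫⁻ w : PS d, ‖gau (s - w.1)‖ₑ * κ w.2 := by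
          refine lintegral_mono fun w => ?_
          rw [enorm_mul]
          refine mul_le_mul' (le_of_eq ?_) (hκK w.1 w.2)
          rw [← ofReal_norm, ← ofReal_norm, RCLike.norm_conj, coh, norm_weyl_apply]
      _ = (∫⁻ u, ‖gau (s - u)‖ₑ) * ∫⁻ η, κ η :=
          lintegral_prod_mul hm.aemeasurable hκ.aemeasurable
      _ = D := by rw [hD, lintegral_sub_left_eq_self (fun u : Rd d => ‖gau u‖ₑ) s]
  have hmo : (moyal d : ℂ) ≠ 0 := by exact_mod_cast moyal_pos.ne'
  have hcc : Continuous fun a : Rd d × PS d => conj (coh a.2 a.1) * K (coh a.2) :=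
    ((Complex.continuous_conj.comp (continuous_coh_uncurry.comp continuous_swap))).mul
      (hKc.comp continuous_snd)
  -- The inversion formula read pointwise. It converges absolutely and uniformly in `s`: the
  -- Gaussian is integrable in the position, `κ` in the frequency.
  refine ⟨fun s => (moyal d : ℂ)⁻¹ * ∫ w : PS d, conj (coh w s) * K (coh w),
    ‖(moyal d : ℂ)⁻¹‖ * D.toReal, ?_, fun s => ?_, fun φ => ?_⟩
  · exact (hcc.stronglyMeasurable.integral_prod_right (ν := volume)).measurable.const_mul _
  · rw [norm_mul]
    gcongr
    refine (norm_integral_le_lintegral_norm _).trans ?_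
    refine ENNReal.toReal_mono hDt ?_
    simp only [ofReal_norm]
    exact hbound s
  · have hint : Integrable (Function.uncurry fun (w : PS d) (s : Rd d) =>
        φ s * (conj (coh w s) * K (coh w))) (volume.prod volume) := by
      have hc1 : Continuous fun a : PS d × Rd d => conj (coh a.1 a.2) * K (coh a.1) :=
        (Complex.continuous_conj.comp continuous_coh_uncurry).mul (hKc.comp continuous_fst)
      have hc2 : Continuous fun a : PS d × Rd d => φ a.2 * (conj (coh a.1 a.2) * K (coh a.1)) :=
        (φ.continuous.comp continuous_snd).mul hc1
      refine ⟨hc2.aestronglyMeasurable, ?_⟩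
      have hsw := lintegral_prod_symm' (μ := (volume : Measure (PS d)))
        (ν := (volume : Measure (Rd d))) _ hc2.enorm.measurable
      refine (le_of_eq hsw).trans_lt ?_
      calc _ ≤ ∫⁻ s, ‖φ s‖ₑ * D := by
            refine lintegral_mono fun s => ?_
            simp only [enorm_mul (φ s)]
            rw [lintegral_const_mul' _ _ enorm_ne_top]
            exact mul_le_mul' le_rfl (hbound s)
        _ < ∞ := by
            rw [lintegral_mul_const _ φ.continuous.enorm.measurable]
            exact ENNReal.mul_lt_top φ.integrable.2 hDt.lt_top
    have h := distribution_inversion K φ gau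
    rw [← moyal_eq] at h
    have h2 : ∫ w : PS d, ba φ w * K (weyl w gau) =
        ∫ w : PS d, ∫ s, φ s * (conj (coh w s) * K (coh w)) := by
      congr 1
      ext w
      rw [ba, ← integral_mul_const]
      simp only [mul_assoc, coh]
    rw [h2, integral_integral_swap hint] at h
    rw [← mul_right_inj' hmo, ← h, ← integral_const_mul]
    congr 1
    ext s
    rw [integral_const_mul]
    field_simp

theorem IsReal.ae_real {K : 𝓢'(Rd d, ℂ)} (hK : IsReal K) {k : Rd d → ℂ} (hk : IsFunction K k) :
    k =ᵐ[volume] fun s => ((k s).re : ℂ) := by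
  have hconj : LocallyIntegrable (fun s => conj (k s)) volume := by
    intro x
    obtain ⟨U, hU, h⟩ := hk.1 x
    exact ⟨U, hU, (LinearIsometryEquiv.integrable_comp_iff Complex.conjLIE).2 h⟩
  have h : k =ᵐ[volume] fun s => conj (k s) := by
    refine ae_eq_of_integral_contDiff_smul_eq hk.1 hconj fun η hη hηc => ?_
    have h1 : HasCompactSupport fun x => (η x : ℂ) := hηc.comp_left Complex.ofReal_zero
    set φ : 𝓢(Rd d, ℂ) := h1.toSchwartzMap (Complex.ofRealCLM.contDiff.comp hη)
    have hφ : ∀ s, φ s = (η s : ℂ) := fun s => rfl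
    have h2 : (K φ).im = 0 := hK φ fun s => by rw [hφ, Complex.ofReal_im]
    have h3 : conj (K φ) = K φ := Complex.conj_eq_iff_im.2 h2
    rw [(hk.2 φ).2, ← integral_conj] at h3
    simp only [map_mul, hφ, Complex.conj_ofReal] at h3
    simp only [Complex.real_smul]
    exact h3.symm
  filter_upwards [h] with s hs
  exact (Complex.conj_eq_iff_re.1 hs.symm).symm

/-- A bounded real function whose short-time Fourier transform with a Gaussian window is dominated
by an integrable function of the frequency. -/
structure Potential (d : ℕ) where
  /-- The function. -/
  k : Rd d → ℝ
  measurable_k : Measurable k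
  /-- A bound for `k`. -/
  bound : ℝ
  norm_k_le : ∀ s, ‖k s‖ ≤ bound
  /-- The frequency majorant. -/
  κ : Rd d → ℝ≥0∞
  measurable_κ : Measurable κ
  lintegral_κ : ∫⁻ η, κ η ≠ ∞
  -- The window is `gauSq` because a coherent state times a conjugate coherent state is a shifted
  -- `gauSq` (`coh_mul_conj_coh`).
  enorm_le_κ : ∀ x η, ‖∫ s, weyl (x, η) gauSq s * (k s : ℂ)‖ₑ ≤ κ η

theorem exists_potential {g : 𝓢(Rd d, ℂ)} (hg : g ≠ 0) {K : 𝓢'(Rd d, ℂ)}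
    (hK : K ∈ modSpace g ∞ 1) (hKr : IsReal K) :
    ∃ P : Potential d, IsFunction K (fun s => (P.k s : ℂ)) := by
  obtain ⟨κ, h1, h2, h3⟩ := exists_sjostrand_majorant hg hK gau
  obtain ⟨k, B, hk, hB, hKk⟩ := exists_bounded_function h1 h2 h3
  obtain ⟨κ', h1', h2', h3'⟩ := exists_sjostrand_majorant hg hK gauSq
  have hfun : IsFunction K k := isFunction_of_memLp le_top
    (memLp_top_of_bound hk.aestronglyMeasurable B (ae_of_all _ hB)) hKk
  have hre := hfun.congr (hKr.ae_real hfun)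
  exact ⟨⟨fun s => (k s).re, Complex.measurable_re.comp hk, B,
    fun s => (Complex.abs_re_le_norm _).trans (hB s), κ', h1', h2', fun x η => by
      rw [← (hre.2 _).2]
      exact h3' x η⟩, hre⟩

end Sjostrand

/-! ### The Hartree multiplier -/

section Hartree

variable {d : ℕ}

theorem integrable_conj_mul (f h : L2 d) : Integrable (fun y => conj (f y) * h y) := by
  refine (L2.integrable_inner (𝕜 := ℂ) f h).congr (ae_of_all _ fun y => ?_)
  simp only [RCLike.inner_apply, mul_comm]

theorem lintegral_enorm_conj_mul_le (f h : L2 d) :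
    ∫⁻ y, ‖conj (f y) * h y‖ₑ ≤ ENNReal.ofReal (‖f‖ * ‖h‖) := by
  have h1 := eLpNorm_smul_le_mul_eLpNorm (p := 2) (q := 2) (r := 1)
    (Lp.aestronglyMeasurable h) (Lp.aestronglyMeasurable f)
  rw [eLpNorm_one_eq_lintegral_enorm] at h1
  rw [ENNReal.ofReal_mul (norm_nonneg _), Lp.norm_def, Lp.norm_def,
    ENNReal.ofReal_toReal (Lp.eLpNorm_ne_top _), ENNReal.ofReal_toReal (Lp.eLpNorm_ne_top _)]
  refine le_of_eq_of_le (lintegral_congr fun y => ?_) h1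
  rw [Pi.smul_apply', smul_eq_mul, enorm_mul, enorm_mul]
  congr 1
  rw [← ofReal_norm, ← ofReal_norm, RCLike.norm_conj]

namespace Potential

variable (P : Potential d)

/-- The convolution `k * (conj f · h)`. -/
def W (f h : Rd d → ℂ) (x : Rd d) : ℂ := ∫ y, (P.k (x - y) : ℂ) * (conj (f y) * h y)

theorem bound_nonneg : 0 ≤ P.bound := (norm_nonneg _).trans (P.norm_k_le 0)

theorem measurable_k_sub : Measurable fun a : Rd d × Rd d => (P.k (a.1 - a.2) : ℂ) :=
  Complex.measurable_ofReal.comp (P.measurable_k.comp (measurable_fst.sub measurable_snd))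

theorem norm_ofReal_k_le (s : Rd d) : ‖(P.k s : ℂ)‖ ≤ P.bound := by
  rw [Complex.norm_real]
  exact P.norm_k_le s

theorem integrable_k_mul {a : Rd d → ℂ} (ha : Integrable a) (x : Rd d) :
    Integrable fun y => (P.k (x - y) : ℂ) * a y :=
  ha.bdd_mul (c := P.bound) ((P.measurable_k_sub.comp measurable_prodMk_left).aestronglyMeasurable)
    (ae_of_all _ fun _ => P.norm_ofReal_k_le _)

theorem norm_W_le (f h : L2 d) (x : Rd d) : ‖P.W f h x‖ ≤ P.bound * (‖f‖ * ‖h‖) := by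
  have h1 : ∫ y, ‖conj (f y) * h y‖ ≤ ‖f‖ * ‖h‖ := by
    rw [integral_norm_eq_lintegral_enorm (integrable_conj_mul f h).1]
    exact ENNReal.toReal_le_of_le_ofReal (by positivity) (lintegral_enorm_conj_mul_le f h)
  calc ‖P.W f h x‖ ≤ ∫ y, P.bound * ‖conj (f y) * h y‖ := by
        refine norm_integral_le_of_norm_le ((integrable_conj_mul f h).norm.const_mul _)
          (ae_of_all _ fun y => ?_)
        rw [norm_mul]
        gcongr
        exact P.norm_ofReal_k_le _
    _ ≤ _ := by
        rw [integral_const_mul]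
        exact mul_le_mul_of_nonneg_left h1 P.bound_nonneg

theorem stronglyMeasurable_W (f h : L2 d) : StronglyMeasurable (P.W f h) := by
  have h1 : StronglyMeasurable fun a : Rd d × Rd d =>
      (P.k (a.1 - a.2) : ℂ) * (conj (f a.2) * h a.2) :=
    P.measurable_k_sub.stronglyMeasurable.mul
      ((Complex.continuous_conj.comp_stronglyMeasurable
        ((Lp.stronglyMeasurable f).comp_measurable measurable_snd)).mul
        ((Lp.stronglyMeasurable h).comp_measurable measurable_snd))
  exact h1.integral_prod_right (ν := volume)

theorem W_sub_left (f f' h : L2 d) (x : Rd d) :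
    P.W (f - f' : L2 d) h x = P.W f h x - P.W f' h x := by
  rw [W, W, W, ← integral_sub (P.integrable_k_mul (integrable_conj_mul f h) x)
    (P.integrable_k_mul (integrable_conj_mul f' h) x)]
  refine integral_congr_ae ?_
  filter_upwards [Lp.coeFn_sub f f'] with y h1
  rw [h1, Pi.sub_apply, map_sub]
  ring

theorem W_sub_right (f h h' : L2 d) (x : Rd d) :
    P.W f (h - h' : L2 d) x = P.W f h x - P.W f h' x := by
  rw [W, W, W, ← integral_sub (P.integrable_k_mul (integrable_conj_mul f h) x)
    (P.integrable_k_mul (integrable_conj_mul f h') x)]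
  refine integral_congr_ae ?_
  filter_upwards [Lp.coeFn_sub h h'] with y h1
  rw [h1, Pi.sub_apply]
  ring

theorem conj_W (f h : Rd d → ℂ) (x : Rd d) : conj (P.W f h x) = P.W h f x := by
  rw [W, W, ← integral_conj]
  congr 1
  ext y
  simp only [map_mul, Complex.conj_ofReal, Complex.conj_conj]
  ring

theorem norm_W_mul_le (f h u : L2 d) (x : Rd d) :
    ‖P.W f h x * u x‖ ≤ P.bound * (‖f‖ * ‖h‖) * ‖u x‖ := by
  rw [norm_mul]
  gcongr
  exact P.norm_W_le f h x

theorem memLp_W_mul (f h u : L2 d) : MemLp (fun x => P.W f h x * u x) 2 volume :=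
  (Lp.memLp u).of_le_mul ((P.stronglyMeasurable_W f h).aestronglyMeasurable.mul
    (Lp.aestronglyMeasurable u)) (ae_of_all _ (P.norm_W_mul_le f h u))

/-- Multiplication by `k * (conj f · h)` on `L²`. -/
def mult (f h : L2 d) : L2 d →L[ℂ] L2 d :=
  LinearMap.mkContinuous
    { toFun := fun u => (P.memLp_W_mul f h u).toLp
      map_add' := fun u v => by
        rw [← MemLp.toLp_add]
        refine MemLp.toLp_congr _ _ ?_
        filter_upwards [Lp.coeFn_add u v] with x hx
        rw [hx, Pi.add_apply, Pi.add_apply, mul_add]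
      map_smul' := fun c u => by
        rw [RingHom.id_apply, ← MemLp.toLp_const_smul]
        refine MemLp.toLp_congr _ _ ?_
        filter_upwards [Lp.coeFn_smul c u] with x hx
        rw [hx, Pi.smul_apply, Pi.smul_apply, smul_eq_mul, smul_eq_mul]
        ring }
    (P.bound * (‖f‖ * ‖h‖)) (fun u => by
      simp only [LinearMap.coe_mk, AddHom.coe_mk]
      refine Lp.norm_le_mul_norm_of_ae_le_mul ?_
      filter_upwards [(P.memLp_W_mul f h u).coeFn_toLp] with x hx
      rw [hx]
      exact P.norm_W_mul_le f h u x)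

theorem coeFn_mult (f h u : L2 d) : P.mult f h u =ᵐ[volume] fun x => P.W f h x * u x :=
  (P.memLp_W_mul f h u).coeFn_toLp

theorem norm_mult_le (f h u : L2 d) : ‖P.mult f h u‖ ≤ P.bound * (‖f‖ * ‖h‖) * ‖u‖ :=
  ((P.mult f h).le_opNorm u).trans (mul_le_mul_of_nonneg_right
    (LinearMap.mkContinuous_norm_le _ (mul_nonneg P.bound_nonneg (by positivity)) _)
    (norm_nonneg u))

theorem mult_sub_left (f f' h u : L2 d) :
    P.mult (f - f') h u = P.mult f h u - P.mult f' h u := by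
  refine Lp.ext ?_
  filter_upwards [P.coeFn_mult (f - f') h u, P.coeFn_mult f h u, P.coeFn_mult f' h u,
    Lp.coeFn_sub (P.mult f h u) (P.mult f' h u)] with x h1 h2 h3 h4
  rw [h1, h4, Pi.sub_apply, h2, h3, W_sub_left, sub_mul]

theorem mult_sub_right (f h h' u : L2 d) :
    P.mult f (h - h') u = P.mult f h u - P.mult f h' u := by
  refine Lp.ext ?_
  filter_upwards [P.coeFn_mult f (h - h') u, P.coeFn_mult f h u, P.coeFn_mult f h' u,
    Lp.coeFn_sub (P.mult f h u) (P.mult f h' u)] with x h1 h2 h3 h4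
  rw [h1, h4, Pi.sub_apply, h2, h3, W_sub_right, sub_mul]

theorem inner_mult (f h u v : L2 d) :
    inner ℂ (P.mult f h u) v = inner ℂ u (P.mult h f v) := by
  rw [L2.inner_def, L2.inner_def]
  refine integral_congr_ae ?_
  filter_upwards [P.coeFn_mult f h u, P.coeFn_mult h f v] with x h1 h2
  rw [h1, h2, RCLike.inner_apply, RCLike.inner_apply, map_mul, conj_W]
  ring

/-- Translating `k` by `y` only moves the position variable and adds a phase, and `κ` is independent
of position. -/
theorem enorm_integral_k_tf_le (z : PS d) (y : Rd d) :
    ‖∫ x, (P.k (x - y) : ℂ) * tf z gauSq x‖ₑ ≤ P.κ z.2 := by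
  rw [← integral_add_right_eq_self (fun x => (P.k (x - y) : ℂ) * tf z gauSq x) y]
  set c : ℝ := inner ℝ z.2 y + inner ℝ (z.1 - y) z.2 / 2 with hc
  have h1 : ∀ s, (P.k (s + y - y) : ℂ) * tf z gauSq (s + y) =
      Complex.exp (Complex.I * (c : ℂ)) * (weyl (z.1 - y, z.2) gauSq s * (P.k s : ℂ)) := by
    intro s
    rw [add_sub_cancel_right, tf_apply, weyl_apply, ← mul_assoc (Complex.exp _),
      ← mul_assoc (Complex.exp _), ← Complex.exp_add, mul_comm (P.k s : ℂ)]
    congr 2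
    · rw [hc, inner_add_right]
      congr 1
      push_cast
      ring
    · rw [sub_sub_eq_add_sub]
  simp_rw [h1]
  rw [integral_const_mul, enorm_mul, ← ofReal_norm (Complex.exp _), norm_exp_I_mul_ofReal,
    ENNReal.ofReal_one, one_mul]
  exact P.enorm_le_κ _ _

/-- By Fubini the coefficient is an average, with density `conj f · h`, of time-frequency
coefficients of translates of `k`. These are bounded uniformly in the translation, so only the `L¹`
norm of `conj f · h` enters. -/
theorem enorm_integral_W_coh_le (f h : L2 d) (z w : PS d) :
    ‖∫ x, P.W f h x * (coh w x * conj (coh z x))‖ₑ ≤ ENNReal.ofReal (‖f‖ * ‖h‖) *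
      (ENNReal.ofReal (Real.exp (-(‖z.1 - w.1‖ ^ 2 / 4))) * P.κ (w.2 - z.2)) := by
  set ψ : Rd d → ℂ := fun x => coh w x * conj (coh z x) with hψ
  have hψi : Integrable ψ := by
    refine (integrable_schwartz_mul (coh w) (coh (zbar z))).congr (ae_of_all _ fun x => ?_)
    simp only [hψ, conj_coh]
  set a : Rd d → ℂ := fun y => conj (f y) * h y
  have ha : Integrable a := integrable_conj_mul f h
  have hint : Integrable (Function.uncurry fun x y => (P.k (x - y) : ℂ) * (ψ x * a y))
      (volume.prod volume) :=
    (hψi.mul_prod ha).bdd_mul (c := P.bound) P.measurable_k_sub.aestronglyMeasurable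
      (ae_of_all _ fun _ => P.norm_ofReal_k_le _)
  have h1 : ∫ x, P.W f h x * ψ x = ∫ y, (∫ x, (P.k (x - y) : ℂ) * ψ x) * a y := by
    calc ∫ x, P.W f h x * ψ x = ∫ x, ∫ y, (P.k (x - y) : ℂ) * (ψ x * a y) := by
          congr 1
          ext x
          rw [W, ← integral_mul_const]
          congr 1
          ext y
          ring
      _ = ∫ y, ∫ x, (P.k (x - y) : ℂ) * (ψ x * a y) := integral_integral_swap hint
      _ = _ := by
          congr 1
          ext y
          rw [← integral_mul_const]
          simp only [mul_assoc]
  have h2 : ∀ y, ‖∫ x, (P.k (x - y) : ℂ) * ψ x‖ₑ ≤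
      ENNReal.ofReal (Real.exp (-(‖z.1 - w.1‖ ^ 2 / 4))) * P.κ (w.2 - z.2) := by
    intro y
    simp only [hψ, coh_mul_conj_coh, mul_left_comm (P.k _ : ℂ)]
    rw [integral_const_mul, enorm_mul]
    refine mul_le_mul' (le_of_eq ?_) (P.enorm_integral_k_tf_le _ y)
    rw [← ofReal_norm, sub_eq_add_neg, Complex.exp_add, norm_mul, norm_exp_I_mul_ofReal, one_mul,
      ← Complex.ofReal_neg, ← Complex.ofReal_exp, Complex.norm_real, Real.norm_eq_abs,
      Real.abs_exp]
  rw [h1]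
  calc ‖∫ y, (∫ x, (P.k (x - y) : ℂ) * ψ x) * a y‖ₑ
      ≤ ∫⁻ y, ‖(∫ x, (P.k (x - y) : ℂ) * ψ x) * a y‖ₑ := enorm_integral_le_lintegral_enorm _
    _ ≤ ∫⁻ y, (ENNReal.ofReal (Real.exp (-(‖z.1 - w.1‖ ^ 2 / 4))) * P.κ (w.2 - z.2)) * ‖a y‖ₑ := by
        refine lintegral_mono fun y => ?_
        rw [enorm_mul]
        exact mul_le_mul' (h2 y) le_rfl
    _ = (ENNReal.ofReal (Real.exp (-(‖z.1 - w.1‖ ^ 2 / 4))) * P.κ (w.2 - z.2)) * ∫⁻ y, ‖a y‖ₑ :=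
        lintegral_const_mul'' _ ha.1.enorm
    _ ≤ _ := by
        rw [mul_comm]
        exact mul_le_mul' (lintegral_enorm_conj_mul_le f h) le_rfl

/-- The phase-space kernel that dominates the Hartree multiplier. -/
def kernel (v : PS d) : ℝ≥0∞ :=
  ENNReal.ofReal (moyal d)⁻¹ * (ENNReal.ofReal (Real.exp (-(‖v.1‖ ^ 2 / 4))) * P.κ (-v.2))

theorem measurable_kernel : Measurable P.kernel := by
  refine Measurable.const_mul (Measurable.mul ?_ ?_) _
  · exact ENNReal.measurable_ofReal.comp (by fun_prop)
  · exact P.measurable_κ.comp measurable_snd.neg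

theorem lintegral_kernel_ne_top : ∫⁻ v, P.kernel v ≠ ∞ := by
  have h1 : Measurable fun x : Rd d => ENNReal.ofReal (Real.exp (-(‖x‖ ^ 2 / 4))) :=
    ENNReal.measurable_ofReal.comp (by fun_prop)
  have h2 : Measurable fun y : Rd d => P.κ (-y) := P.measurable_κ.comp measurable_neg
  simp only [kernel]
  rw [lintegral_const_mul' _ _ ENNReal.ofReal_ne_top]
  refine ENNReal.mul_ne_top ENNReal.ofReal_ne_top ?_
  have h3 : ∫⁻ v : PS d, ENNReal.ofReal (Real.exp (-(‖v.1‖ ^ 2 / 4))) * P.κ (-v.2) =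
      (∫⁻ x : Rd d, ENNReal.ofReal (Real.exp (-(‖x‖ ^ 2 / 4)))) * ∫⁻ y, P.κ (-y) :=
    lintegral_prod_mul h1.aemeasurable h2.aemeasurable
  rw [h3, lintegral_neg_eq_self P.κ]
  refine ENNReal.mul_ne_top ?_ P.lintegral_κ
  have h4 : Integrable fun x : Rd d => Real.exp (-(‖x‖ ^ 2 / 4)) := by
    have h := (GaussianFourier.integrable_cexp_neg_mul_sq_norm_add (V := Rd d) (b := 1 / 4)
      (by norm_num) 0 0).norm
    refine h.congr (ae_of_all _ fun x => ?_)
    simp only [Complex.norm_exp]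
    congr 1
    simp [← Complex.ofReal_pow]
    ring
  have h5 := h4.2
  rw [hasFiniteIntegral_iff_ofReal (ae_of_all _ fun x => (Real.exp_pos _).le)] at h5
  exact h5.ne

/-- The multiplier is moved onto `coh z` by `inner_mult`, and Moyal's identity expands the inner
product with `u` over phase space. What appears is the matrix of the multiplier between coherent
states. -/
theorem enorm_ba_mult_le (f h u : L2 d) (z : PS d) :
    ‖ba (P.mult f h u) z‖ₑ ≤
      ∫⁻ w, (ENNReal.ofReal (‖f‖ * ‖h‖) * P.kernel (z - w)) * ‖ba u w‖ₑ := by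
  have hmo : (moyal d : ℂ) ≠ 0 := by exact_mod_cast moyal_pos.ne'
  have h1 : ba (P.mult f h u) z = (moyal d : ℂ)⁻¹ *
      ∫ w, ba u w * conj (ba (P.mult h f (cohL z)) w) := by
    rw [integral_ba_mul_conj_ba_L2, inv_mul_cancel_left₀ hmo, ba_eq_inner, ← inner_mult]
  have h2 : ∀ w, conj (ba (P.mult h f (cohL z)) w) =
      ∫ x, P.W f h x * (coh w x * conj (coh z x)) := by
    intro w
    rw [ba, ← integral_conj]
    refine integral_congr_ae ?_
    filter_upwards [P.coeFn_mult h f (cohL z), (coh z).coeFn_toLp 2 volume] with x h3 h4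
    rw [h3, cohL, h4, map_mul, map_mul, conj_W, Complex.conj_conj]
    ring
  rw [h1, enorm_mul]
  calc ‖(moyal d : ℂ)⁻¹‖ₑ * ‖∫ w, ba u w * conj (ba (P.mult h f (cohL z)) w)‖ₑ
      ≤ ‖(moyal d : ℂ)⁻¹‖ₑ * ∫⁻ w, ‖ba u w * conj (ba (P.mult h f (cohL z)) w)‖ₑ :=
        mul_le_mul' le_rfl (enorm_integral_le_lintegral_enorm _)
    _ = ∫⁻ w, ‖(moyal d : ℂ)⁻¹‖ₑ * ‖ba u w * conj (ba (P.mult h f (cohL z)) w)‖ₑ :=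
        (lintegral_const_mul' _ _ enorm_ne_top).symm
    _ ≤ _ := by
        refine lintegral_mono fun w => ?_
        rw [enorm_mul, h2, mul_comm ‖ba u w‖ₑ, ← mul_assoc]
        refine mul_le_mul' ?_ le_rfl
        have h5 : ‖(moyal d : ℂ)⁻¹‖ₑ = ENNReal.ofReal (moyal d)⁻¹ := by
          rw [← ofReal_norm, norm_inv, Complex.norm_real, Real.norm_of_nonneg moyal_pos.le]
        rw [h5, kernel, mul_left_comm]
        refine mul_le_mul' le_rfl ?_
        have h6 := P.enorm_integral_W_coh_le f h z w
        simpa only [Prod.fst_sub, Prod.snd_sub, neg_sub] using h6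

/-- The operator bound of the Hartree multiplier on modulation spaces. -/
def modBound : ℝ := (∫⁻ v, P.kernel v).toReal

/-- The decisive estimate: only `L²` norms of `f` and `h` enter, so conservation of mass makes the
bound uniform in time. -/
theorem eLpNorm_ba_mult_le (f h u : L2 d) {p : ℝ≥0∞} (hp : 1 ≤ p) (hp' : p ≠ ∞) :
    eLpNorm (ba (P.mult f h u)) p volume ≤
      ENNReal.ofReal (P.modBound * (‖f‖ * ‖h‖)) * eLpNorm (ba u) p volume := by
  have h1 := eLpNorm_le_of_le_convolution (μ := volume) (P.measurable_kernel.const_mul _)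
    (continuous_ba u).measurable (P.enorm_ba_mult_le f h u) hp hp'
  refine h1.trans (le_of_eq ?_)
  rw [lintegral_const_mul _ P.measurable_kernel, mul_comm P.modBound,
    ENNReal.ofReal_mul (p := ‖f‖ * ‖h‖) (by positivity), modBound, ENNReal.ofReal_toReal P.lintegral_kernel_ne_top]

end Potential

end Hartree

/-! ### Globally Lipschitz differential equations -/

section ODE

variable {E : Type*} [NormedAddCommGroup E]

theorem continuous_lipschitz_comp {f : ℝ → E → E} {L : NNReal} (hL : ∀ t, LipschitzWith L (f t))
    (hc : ∀ x, Continuous fun t => f t x) {x : ℝ → E} (hx : Continuous x) :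
    Continuous fun t => f t (x t) :=
  (continuous_prod_of_continuous_lipschitzWith' (fun a : ℝ × E => f a.1 a.2) L hL hc).comp
    (continuous_id.prodMk hx)

/-- The radial factor that retracts a normed space onto a ball. -/
def radial (R : ℝ) (u : E) : ℝ := R / max R ‖u‖

theorem radial_nonneg {R : ℝ} (hR : 0 < R) (u : E) : 0 ≤ radial R u :=
  div_nonneg hR.le (hR.le.trans (le_max_left _ _))

theorem radial_eq_one {R : ℝ} (hR : 0 < R) {u : E} (hu : ‖u‖ ≤ R) : radial R u = 1 := by
  rw [radial, max_eq_left hu, div_self hR.ne']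

variable [NormedSpace ℝ E]

theorem integral_exp_mul {a : ℝ} (ha : a ≠ 0) (t : ℝ) :
    ∫ s in (0 : ℝ)..t, Real.exp (a * s) = (Real.exp (a * t) - 1) / a := by
  have h1 : ∀ s ∈ Set.uIcc 0 t, HasDerivAt (fun s : ℝ => Real.exp (a * s) / a) (Real.exp (a * s)) s := by
    intro s _
    have h : HasDerivAt (fun s : ℝ => Real.exp (a * s) / a) (Real.exp (a * s) * (a * 1) / a) s :=
      (((hasDerivAt_id s).const_mul a).exp).div_const a
    exact h.congr_deriv (by field_simp)
  rw [intervalIntegral.integral_eq_sub_of_hasDerivAt h1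
    ((Continuous.intervalIntegrable (by fun_prop)) _ _)]
  simp [sub_div]

theorem norm_integral_exp_le {a c t : ℝ} (ha : 0 < a) (hc : 0 ≤ c) (ht : 0 ≤ t) {e : ℝ → E}
    (he : ∀ s, 0 ≤ s → ‖e s‖ ≤ c * Real.exp (a * s)) :
    ‖∫ s in (0 : ℝ)..t, e s‖ ≤ c / a * Real.exp (a * t) := by
  calc ‖∫ s in (0 : ℝ)..t, e s‖ ≤ ∫ s in (0 : ℝ)..t, c * Real.exp (a * s) :=
        intervalIntegral.norm_integral_le_of_norm_le ht
          (ae_of_all _ fun s hs => he s hs.1.le)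
          ((Continuous.intervalIntegrable (by fun_prop)) _ _)
    _ = c / a * (Real.exp (a * t) - 1) := by
        rw [intervalIntegral.integral_const_mul, integral_exp_mul ha.ne']
        ring
    _ ≤ _ := by
        gcongr
        linarith

theorem hasDerivWithinAt_of_integral_eq [CompleteSpace E] {x e : ℝ → E} (he : Continuous e) {x₀ : E}
    (h : ∀ t, 0 ≤ t → x t = x₀ + ∫ s in (0 : ℝ)..t, e s) {t : ℝ} (ht : 0 ≤ t) :
    HasDerivWithinAt x (e t) (Set.Ici 0) t := by
  have h1 : HasDerivAt (fun t => x₀ + ∫ s in (0 : ℝ)..t, e s) (e t) t :=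
    (intervalIntegral.integral_hasDerivAt_right (he.intervalIntegrable _ _)
      he.aestronglyMeasurable.stronglyMeasurableAtFilter he.continuousAt).const_add _
  exact h1.hasDerivWithinAt.congr (fun s hs => h s hs) (h t ht)

theorem exists_global_solution [CompleteSpace E] {f : ℝ → E → E} {L : NNReal} (hL : ∀ t, LipschitzWith L (f t))
    (hc : ∀ x, Continuous fun t => f t x) (h0 : ∀ t, f t 0 = 0) (x₀ : E) :
    ∃ x : ℝ → E, Continuous x ∧ x 0 = x₀ ∧
      ∀ t, 0 ≤ t → HasDerivWithinAt x (f t (x t)) (Set.Ici 0) t := by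
  -- The weight `e^{-at}` turns the Picard map into a contraction on the whole half-line with
  -- constant `L / a < 1`.
  set a : ℝ := L + 1 with ha
  have ha0 : 0 < a := by positivity
  have hlift : ∀ y : BoundedContinuousFunction ℝ E,
      Continuous fun s : ℝ => Real.exp (a * s) • y s := fun y =>
    (by fun_prop : Continuous fun s : ℝ => Real.exp (a * s)).smul y.continuous
  have hcomp : ∀ y : BoundedContinuousFunction ℝ E,
      Continuous fun s : ℝ => f s (Real.exp (a * s) • y s) := fun y =>
    continuous_lipschitz_comp hL hc (hlift y)
  -- The Picard map for `y t = e^{-at} x t`; negative times are frozen at 0 to work with bounded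
  -- functions on the line.
  set φ : BoundedContinuousFunction ℝ E → ℝ → E := fun y t => Real.exp (-(a * max t 0)) •
    (x₀ + ∫ s in (0 : ℝ)..max t 0, f s (Real.exp (a * s) • y s)) with hφ
  have hφc : ∀ y, Continuous (φ y) := by
    intro y
    have h1 : Continuous fun t : ℝ => max t 0 := by fun_prop
    have h2 : Continuous fun t : ℝ => ∫ s in (0 : ℝ)..t, f s (Real.exp (a * s) • y s) :=
      intervalIntegral.continuous_primitive (fun _ _ => (hcomp y).intervalIntegrable _ _) 0
    exact (by fun_prop : Continuous fun t : ℝ => Real.exp (-(a * max t 0))).smul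
      (continuous_const.add (h2.comp h1))
  have hdiff : ∀ y y' t, ‖φ y t - φ y' t‖ ≤ L / a * ‖y - y'‖ := by
    intro y y' t
    have hm : 0 ≤ max t 0 := le_max_right _ _
    simp only [hφ, ← smul_sub, add_sub_add_left_eq_sub]
    rw [← intervalIntegral.integral_sub ((hcomp y).intervalIntegrable _ _)
      ((hcomp y').intervalIntegrable _ _), norm_smul, Real.norm_eq_abs, Real.abs_exp]
    have h1 := norm_integral_exp_le (E := E) ha0 (c := L * ‖y - y'‖) (by positivity) hm
      (e := fun s => f s (Real.exp (a * s) • y s) - f s (Real.exp (a * s) • y' s)) (by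
        intro s _
        refine ((hL s).norm_sub_le _ _).trans ?_
        rw [← smul_sub, norm_smul, Real.norm_eq_abs, Real.abs_exp, mul_assoc,
          mul_comm (Real.exp _)]
        gcongr
        exact (y - y').norm_coe_le_norm s)
    calc _ ≤ Real.exp (-(a * max t 0)) * (L * ‖y - y'‖ / a * Real.exp (a * max t 0)) := by gcongr
      _ = L / a * ‖y - y'‖ * (Real.exp (-(a * max t 0)) * Real.exp (a * max t 0)) := by ring
      _ = _ := by rw [← Real.exp_add, neg_add_cancel, Real.exp_zero, mul_one]
  have hbound : ∀ y t, ‖φ y t‖ ≤ ‖x₀‖ + L / a * ‖y‖ := by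
    intro y t
    have h1 := hdiff y 0 t
    have h2 : ‖φ 0 t‖ ≤ ‖x₀‖ := by
      simp only [hφ, BoundedContinuousFunction.coe_zero, Pi.zero_apply, smul_zero, h0,
        intervalIntegral.integral_zero, add_zero]
      rw [norm_smul, Real.norm_eq_abs, Real.abs_exp]
      refine mul_le_of_le_one_left (norm_nonneg _) (Real.exp_le_one_iff.2 ?_)
      have : 0 ≤ a * max t 0 := mul_nonneg ha0.le (le_max_right _ _)
      linarith
    rw [sub_zero] at h1
    have h3 := norm_sub_norm_le (φ y t) (φ 0 t)
    linarith
  set Φ : BoundedContinuousFunction ℝ E → BoundedContinuousFunction ℝ E := fun y =>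
    BoundedContinuousFunction.ofNormedAddCommGroup (φ y) (hφc y) _ (hbound y)
  have hK : (L / (L + 1) : NNReal) < 1 := by
    rw [div_lt_one (by positivity)]
    exact lt_add_one L
  have hΦ : ContractingWith (L / (L + 1)) Φ := by
    refine ⟨hK, LipschitzWith.of_dist_le_mul fun y y' => ?_⟩
    rw [BoundedContinuousFunction.dist_le (by positivity)]
    intro t
    rw [dist_eq_norm, dist_eq_norm]
    exact hdiff y y' t
  obtain ⟨y, hy⟩ : ∃ y, Φ y = y := ⟨_, hΦ.fixedPoint_isFixedPt⟩
  have hyt : ∀ t, 0 ≤ t → Real.exp (a * t) • y t =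
      x₀ + ∫ s in (0 : ℝ)..t, f s (Real.exp (a * s) • y s) := by
    intro t ht
    have h1 : y t = φ y t := by
      conv_lhs => rw [← hy]
      rfl
    conv_lhs => rw [h1]
    simp only [hφ, max_eq_left ht]
    rw [smul_smul, ← Real.exp_add, add_neg_cancel, Real.exp_zero, one_smul]
  refine ⟨fun t => Real.exp (a * t) • y t, hlift y, by simpa using hyt 0 le_rfl, fun t ht => ?_⟩
  exact hasDerivWithinAt_of_integral_eq (hcomp y) hyt ht

/-- Local Lipschitz bounds suffice because both curves stay in one ball on a compact time interval.
-/
theorem solution_unique {f : ℝ → E → E} {x y : ℝ → E} (hxc : Continuous x) (hyc : Continuous y)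
    (hLip : ∀ R, ∃ L : NNReal, ∀ t, LipschitzOnWith L (f t) (Metric.closedBall 0 R))
    (hx : ∀ t, 0 ≤ t → HasDerivWithinAt x (f t (x t)) (Set.Ici 0) t)
    (hy : ∀ t, 0 ≤ t → HasDerivWithinAt y (f t (y t)) (Set.Ici 0) t) (h0 : x 0 = y 0)
    {t : ℝ} (ht : 0 ≤ t) : x t = y t := by
  obtain ⟨R₁, hR₁⟩ := (isCompact_Icc (a := (0 : ℝ)) (b := t)).exists_bound_of_continuousOn
    hxc.continuousOn
  obtain ⟨R₂, hR₂⟩ := (isCompact_Icc (a := (0 : ℝ)) (b := t)).exists_bound_of_continuousOn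
    hyc.continuousOn
  obtain ⟨L, hL⟩ := hLip (max R₁ R₂)
  refine ODE_solution_unique_of_mem_Icc_right (v := f) (K := L)
    (s := fun _ => Metric.closedBall 0 (max R₁ R₂)) (fun s _ => hL s) hxc.continuousOn
    (fun s hs => (hx s hs.1).mono (Set.Ici_subset_Ici.2 hs.1)) (fun s hs => ?_) hyc.continuousOn
    (fun s hs => (hy s hs.1).mono (Set.Ici_subset_Ici.2 hs.1)) (fun s hs => ?_) h0
    (Set.right_mem_Icc.2 ht)
  · rw [mem_closedBall_zero_iff]
    exact (hR₁ s ⟨hs.1, hs.2.le⟩).trans (le_max_left _ _)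
  · rw [mem_closedBall_zero_iff]
    exact (hR₂ s ⟨hs.1, hs.2.le⟩).trans (le_max_right _ _)

theorem norm_radial_smul_le {R : ℝ} (hR : 0 < R) (u : E) : ‖radial R u • u‖ ≤ R := by
  have hm : 0 < max R ‖u‖ := hR.trans_le (le_max_left _ _)
  rw [norm_smul, Real.norm_of_nonneg (radial_nonneg hR u), radial, div_mul_eq_mul_div,
    div_le_iff₀ hm]
  exact mul_le_mul_of_nonneg_left (le_max_right _ _) hR.le

/-- One `‖u - v‖` comes from moving the vector with the factor fixed, the other from moving the
factor. -/
theorem norm_radial_smul_sub_le {R : ℝ} (hR : 0 < R) (u v : E) :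
    ‖radial R u • u - radial R v • v‖ ≤ 2 * ‖u - v‖ := by
  have hu : 0 < max R ‖u‖ := hR.trans_le (le_max_left _ _)
  have hv : 0 < max R ‖v‖ := hR.trans_le (le_max_left _ _)
  have h1 : radial R u ≤ 1 := (div_le_one hu).2 (le_max_left _ _)
  have h2 : |max R ‖v‖ - max R ‖u‖| ≤ ‖u - v‖ := by
    rw [abs_sub_comm]
    exact (abs_max_sub_max_le_max _ _ _ _).trans (by simpa using abs_norm_sub_norm_le u v)
  have h3 : radial R u - radial R v =
      (R / max R ‖u‖) * ((max R ‖v‖ - max R ‖u‖) / max R ‖v‖) := by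
    unfold radial
    field_simp
  have h4 : |radial R u - radial R v| * ‖v‖ ≤ ‖u - v‖ := by
    rw [h3, abs_mul, abs_div _ (max R ‖v‖), abs_of_pos hv,
      abs_of_nonneg (show 0 ≤ R / max R ‖u‖ from radial_nonneg hR u)]
    calc R / max R ‖u‖ * (|max R ‖v‖ - max R ‖u‖| / max R ‖v‖) * ‖v‖
        ≤ 1 * (‖u - v‖ / max R ‖v‖) * max R ‖v‖ := by
          gcongr
          · exact h1
          · exact le_max_right _ _
      _ = ‖u - v‖ := by field_simp
  have h5 : radial R u • u - radial R v • v =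
      radial R u • (u - v) + (radial R u - radial R v) • v := by
    rw [smul_sub, sub_smul]
    abel
  rw [h5]
  refine (norm_add_le _ _).trans ?_
  rw [norm_smul, norm_smul, Real.norm_of_nonneg (radial_nonneg hR u), Real.norm_eq_abs]
  have := mul_le_of_le_one_left (norm_nonneg (u - v)) h1
  linarith

end ODE

/-! ### Telescoping and continuity for bounded trilinear expressions -/

section Trilinear

variable {V Y Z : Type*} [NormedAddCommGroup V] [NormedAddCommGroup Y] [NormedAddCommGroup Z]
  {M : V → V → Y → Z} {C : ℝ}

theorem norm_trilinear_sub_le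
    (hl : ∀ f f' h y, M (f - f') h y = M f h y - M f' h y)
    (hr : ∀ f h h' y, M f (h - h') y = M f h y - M f h' y)
    (hy : ∀ f h y y', M f h (y - y') = M f h y - M f h y')
    (hb : ∀ f h y, ‖M f h y‖ ≤ C * (‖f‖ * ‖h‖) * ‖y‖) (f f' h h' : V) (y y' : Y) :
    ‖M f h y - M f' h' y'‖ ≤ C * (‖f‖ * ‖h‖) * ‖y - y'‖ + C * (‖f - f'‖ * ‖h‖) * ‖y'‖ +
      C * (‖f'‖ * ‖h - h'‖) * ‖y'‖ := by
  have h1 : M f h y - M f' h' y' = M f h (y - y') + M (f - f') h y' + M f' (h - h') y' := by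
    rw [hl, hr, hy]
    abel
  rw [h1]
  exact (norm_add₃_le).trans (add_le_add (add_le_add (hb _ _ _) (hb _ _ _)) (hb _ _ _))

theorem continuous_trilinear
    (hl : ∀ f f' h y, M (f - f') h y = M f h y - M f' h y)
    (hr : ∀ f h h' y, M f (h - h') y = M f h y - M f h' y)
    (hy : ∀ f h y y', M f h (y - y') = M f h y - M f h y')
    (hb : ∀ f h y, ‖M f h y‖ ≤ C * (‖f‖ * ‖h‖) * ‖y‖) :
    Continuous fun a : V × V × Y => M a.1 a.2.1 a.2.2 := by
  refine continuous_iff_continuousAt.2 fun b => ?_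
  rw [ContinuousAt, tendsto_iff_norm_sub_tendsto_zero]
  have h1 : Continuous fun a : V × V × Y => C * (‖a.1‖ * ‖a.2.1‖) * ‖a.2.2 - b.2.2‖ +
      C * (‖a.1 - b.1‖ * ‖a.2.1‖) * ‖b.2.2‖ + C * (‖b.1‖ * ‖a.2.1 - b.2.1‖) * ‖b.2.2‖ := by
    fun_prop
  have h2 := h1.tendsto b
  simp only [sub_self, norm_zero, mul_zero, zero_mul, add_zero] at h2
  exact squeeze_zero (fun _ => norm_nonneg _)
    (fun a => norm_trilinear_sub_le hl hr hy hb _ _ _ _ _ _) h2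

end Trilinear

/-! ### The Hartree flow on `L²` -/

section Flow

variable {d : ℕ}

namespace Potential

variable (P : Potential d)

/-- The Hartree nonlinearity `(k * |u|²) u`. -/
def hartree (u : L2 d) : L2 d := P.mult u u u

theorem continuous_mult : Continuous fun a : L2 d × L2 d × L2 d => P.mult a.1 a.2.1 a.2.2 :=
  continuous_trilinear P.mult_sub_left P.mult_sub_right (fun f h => map_sub (P.mult f h))
    P.norm_mult_le

theorem continuous_hartree : Continuous P.hartree := by
  have h : Continuous fun u : L2 d => (u, u, u) := by fun_prop
  have h' : P.hartree = (fun a : L2 d × L2 d × L2 d => P.mult a.1 a.2.1 a.2.2) ∘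
      fun u => (u, u, u) := by
    ext1 u
    rw [hartree, Function.comp_apply]
  rw [h']
  exact P.continuous_mult.comp h

theorem norm_hartree_sub_le {R : ℝ} {u v : L2 d} (hu : ‖u‖ ≤ R) (hv : ‖v‖ ≤ R) :
    ‖P.hartree u - P.hartree v‖ ≤ 3 * P.bound * R ^ 2 * ‖u - v‖ := by
  have hR : 0 ≤ R := (norm_nonneg u).trans hu
  have hB := P.bound_nonneg
  have h := norm_trilinear_sub_le (M := fun f h u => P.mult f h u) P.mult_sub_left
    P.mult_sub_right (fun f h => map_sub (P.mult f h)) P.norm_mult_le u v u v u v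
  refine h.trans ?_
  calc P.bound * (‖u‖ * ‖u‖) * ‖u - v‖ + P.bound * (‖u - v‖ * ‖u‖) * ‖v‖ +
        P.bound * (‖v‖ * ‖u - v‖) * ‖v‖
      ≤ P.bound * (R * R) * ‖u - v‖ + P.bound * (‖u - v‖ * R) * R +
        P.bound * (R * ‖u - v‖) * R := by gcongr
    _ = _ := by ring

theorem hartree_zero : P.hartree 0 = 0 := map_zero _

/-- The vector field of the Hartree equation in the interaction picture. -/
def field (t : ℝ) (w : L2 d) : L2 d := -Complex.I • prop (-t) (P.hartree (prop t w))

theorem continuous_field {w : ℝ → L2 d} (hw : Continuous w) :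
    Continuous fun t => P.field t (w t) :=
  (continuous_prop_apply (P.continuous_hartree.comp (continuous_prop_apply hw continuous_id))
    continuous_neg).fun_const_smul _

theorem norm_neg_I_smul_prop (t : ℝ) (u : L2 d) : ‖-Complex.I • prop t u‖ = ‖u‖ := by
  rw [norm_smul, norm_neg, Complex.norm_I, one_mul, norm_prop]

theorem neg_I_smul_prop_sub (t : ℝ) (u v : L2 d) :
    -Complex.I • prop t u - -Complex.I • prop t v = -Complex.I • prop t (u - v) := by
  rw [map_sub, smul_sub]

theorem exists_lipschitzOnWith_field (R : ℝ) :
    ∃ L : NNReal, ∀ t, LipschitzOnWith L (P.field t) (Metric.closedBall 0 R) := by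
  refine ⟨Real.toNNReal (3 * P.bound * R ^ 2), fun t => LipschitzOnWith.of_dist_le_mul
    fun u hu v hv => ?_⟩
  rw [mem_closedBall_zero_iff] at hu hv
  rw [dist_eq_norm, dist_eq_norm, field, field, neg_I_smul_prop_sub, norm_neg_I_smul_prop,
    Real.coe_toNNReal _ (mul_nonneg (mul_nonneg (by norm_num) P.bound_nonneg) (sq_nonneg R)),
    ← norm_prop t (u - v), map_sub]
  exact P.norm_hartree_sub_le (by rwa [norm_prop]) (by rwa [norm_prop])

theorem conj_inner_mult_self (f v : L2 d) :
    conj (inner ℂ v (P.mult f f v)) = inner ℂ v (P.mult f f v) := by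
  rw [inner_conj_symm, inner_mult]

/-- The truncated vector field. -/
def truncField (R t : ℝ) (w : L2 d) : L2 d :=
  -Complex.I • prop (-t) (P.hartree (radial R (prop t w) • prop t w))

/-- As `k` is real, multiplication by `k * |f|²` is symmetric, so the inner product of `w` with the
field is `-i` times a real number. The real radial factor keeps this structure, so the truncated
flow conserves mass too. -/
theorem inner_truncField_add (R t : ℝ) (w : L2 d) :
    inner ℂ w (P.truncField R t w) + inner ℂ (P.truncField R t w) w = 0 := by
  have h1 : inner ℂ w (P.truncField R t w) = -Complex.I * ((radial R (prop t w) : ℝ) *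
      inner ℂ (prop t w) (P.mult (radial R (prop t w) • prop t w)
        (radial R (prop t w) • prop t w) (prop t w))) := by
    rw [truncField, inner_smul_right, inner_prop_right, neg_neg]
    conv_lhs => rw [hartree, ContinuousLinearMap.map_smul_of_tower, RCLike.real_smul_eq_coe_smul (K := ℂ),
      inner_smul_right]
    rfl
  rw [← inner_conj_symm (P.truncField R t w) w, h1, map_mul, map_mul, conj_inner_mult_self,
    map_neg, Complex.conj_I, Complex.conj_ofReal]
  ring

/-- The truncated field is globally Lipschitz, so its flow is global. Conservation of mass keeps the
solution in the ball where the truncation is inactive, and it therefore solves the original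
equation. -/
theorem exists_flow (w₀ : L2 d) :
    ∃ w : ℝ → L2 d, Continuous w ∧ w 0 = w₀ ∧ (∀ t, ‖w t‖ = ‖w₀‖) ∧
      ∀ t, 0 ≤ t → HasDerivWithinAt w (P.field t (w t)) (Set.Ici 0) t := by
  -- The summand 1 keeps the radius positive when `w₀ = 0`.
  set R : ℝ := ‖w₀‖ + 1
  have hR : 0 < R := by positivity
  set L : NNReal := Real.toNNReal (3 * P.bound * R ^ 2 * 2) with hLdef
  have hcL : (L : ℝ) = 3 * P.bound * R ^ 2 * 2 :=
    Real.coe_toNNReal _ (mul_nonneg (mul_nonneg (mul_nonneg (by norm_num) P.bound_nonneg)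
      (sq_nonneg R)) zero_le_two)
  have hL : ∀ t, LipschitzWith L (P.truncField R t) := by
    intro t
    refine LipschitzWith.of_dist_le_mul fun u v => ?_
    rw [dist_eq_norm, dist_eq_norm, truncField, truncField, neg_I_smul_prop_sub,
      norm_neg_I_smul_prop, hcL]
    refine (P.norm_hartree_sub_le (norm_radial_smul_le hR _) (norm_radial_smul_le hR _)).trans ?_
    rw [mul_assoc _ 2, ← norm_prop t (u - v), map_sub]
    exact mul_le_mul_of_nonneg_left (norm_radial_smul_sub_le hR _ _)
      (mul_nonneg (mul_nonneg (by norm_num) P.bound_nonneg) (sq_nonneg R))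
  have hrad : Continuous fun u : L2 d => radial R u • u := by
    have h : Continuous fun u : L2 d => radial R u :=
      continuous_const.div (continuous_const.max continuous_norm)
        fun u => (hR.trans_le (le_max_left _ _)).ne'
    exact h.smul continuous_id
  have hc : ∀ u, Continuous fun t => P.truncField R t u := fun u =>
    (continuous_prop_apply (P.continuous_hartree.comp (hrad.comp (continuous_prop u)))
      continuous_neg).fun_const_smul _
  obtain ⟨x, hx, hx0, hxd⟩ := exists_global_solution hL hc
    (fun t => by simp [truncField, hartree_zero]) w₀
  have hmass : ∀ t, 0 ≤ t → ‖x t‖ = ‖w₀‖ := by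
    intro t ht
    have h1 : inner ℂ (x t) (x t) = inner ℂ (x 0) (x 0) :=
      constant_of_has_deriv_right_zero (f := fun t => inner ℂ (x t) (x t))
        (hx.inner hx).continuousOn (fun s hs => by
          have h := (hxd s hs.1).inner ℂ (hxd s hs.1)
          rw [inner_truncField_add] at h
          exact h.mono (Set.Ici_subset_Ici.2 hs.1)) t (Set.right_mem_Icc.2 ht)
    rw [inner_self_eq_norm_sq_to_K, inner_self_eq_norm_sq_to_K, hx0] at h1
    have h2 : ‖x t‖ ^ 2 = ‖w₀‖ ^ 2 := by exact_mod_cast h1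
    exact (pow_left_inj₀ (norm_nonneg _) (norm_nonneg _) two_ne_zero).1 h2
  have hfield : ∀ t, 0 ≤ t → P.truncField R t (x t) = P.field t (x t) := by
    intro t ht
    rw [truncField, field, radial_eq_one hR, one_smul]
    rw [norm_prop, hmass t ht]
    linarith
  -- Freezing negative times makes continuity and the norm identity hold on the whole line.
  refine ⟨fun t => x (max t 0), hx.comp (by fun_prop), by simpa using hx0,
    fun t => hmass _ (le_max_right _ _), fun t ht => ?_⟩
  have h1 := hxd t ht
  rw [hfield t ht] at h1
  simp only [max_eq_left ht]
  refine h1.congr (fun s hs => ?_) ?_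
  · rw [max_eq_left (Set.mem_Ici.1 hs)]
  · rw [max_eq_left ht]

end Potential

end Flow

/-! ### Persistence of modulation regularity -/

section Persistence

variable {d : ℕ} (p : ℝ≥0∞)

/-- The pairs `(F, f)` of an `L²` function `f` and its coherent-state transform `F`, assumed to be
in `L^p`. -/
def graphSpace : Submodule ℂ (LZ d p × L2 d) where
  carrier := {x | x.1 =ᵐ[volume] ba x.2}
  add_mem' {x y} hx hy := by
    change ((x + y).1 : PS d → ℂ) =ᵐ[volume] _
    filter_upwards [hx, hy, Lp.coeFn_add x.1 y.1] with z h1 h2 h3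
    rw [Prod.fst_add, h3, Pi.add_apply, h1, h2, Prod.snd_add, ba_add]
  zero_mem' := by
    change ((0 : LZ d p × L2 d).1 : PS d → ℂ) =ᵐ[volume] _
    filter_upwards [Lp.coeFn_zero ℂ p (volume : Measure (PS d))] with z h1
    rw [Prod.fst_zero, h1, Pi.zero_apply, Prod.snd_zero, ba_eq_inner, inner_zero_right]
  smul_mem' c x hx := by
    change ((c • x).1 : PS d → ℂ) =ᵐ[volume] _
    filter_upwards [hx, Lp.coeFn_smul c x.1] with z h1 h2
    rw [Prod.smul_fst, h2, Pi.smul_apply, h1, Prod.smul_snd, ba_smul, smul_eq_mul]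

/-- `L^p` convergence gives almost everywhere convergence of a subsequence of the first components,
while `L²` convergence gives convergence of the transforms at every point. The two limits agree. -/
theorem isClosed_graphSpace [Fact (1 ≤ p)] : 
    IsClosed ((graphSpace p : Submodule ℂ (LZ d p × L2 d)) : Set (LZ d p × L2 d)) := by
  refine IsSeqClosed.isClosed fun x a hx ha => ?_
  have h1 : Tendsto (fun n => (x n).1) atTop (𝓝 a.1) := ha.fst_nhds
  have h2 : Tendsto (fun n => (x n).2) atTop (𝓝 a.2) := ha.snd_nhds
  obtain ⟨ns, hns, h3⟩ := (tendstoInMeasure_of_tendsto_Lp h1).exists_seq_tendsto_ae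
  change (a.1 : PS d → ℂ) =ᵐ[volume] ba a.2
  filter_upwards [h3, ae_all_iff.2 hx] with z h4 h5
  refine tendsto_nhds_unique h4 ?_
  simp only [h5, ba_eq_inner]
  exact tendsto_const_nhds.inner (h2.comp hns.tendsto_atTop)

instance [Fact (1 ≤ p)] : CompleteSpace (graphSpace (d := d) p) :=
  (isClosed_graphSpace p).completeSpace_coe

variable {p}

/-- The element of the graph space with given second component. -/
def graphMk (f : L2 d) (hf : MemLp (ba f) p volume) : graphSpace (d := d) p :=
  ⟨(hf.toLp, f), hf.coeFn_toLp⟩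

theorem graph_ext {x y : graphSpace (d := d) p} (h : x.1.2 = y.1.2) : x = y := by
  refine Subtype.ext (Prod.ext (Lp.ext ?_) h)
  have h1 : (x.1.1 : PS d → ℂ) =ᵐ[volume] ba x.1.2 := x.2
  have h2 : (y.1.1 : PS d → ℂ) =ᵐ[volume] ba y.1.2 := y.2
  rw [← h] at h2
  exact h1.trans h2.symm

theorem eLpNorm_ba_graph (x : graphSpace (d := d) p) :
    eLpNorm (ba x.1.2) p volume = ENNReal.ofReal ‖x.1.1‖ := by
  have h1 : (x.1.1 : PS d → ℂ) =ᵐ[volume] ba x.1.2 := x.2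
  rw [← eLpNorm_congr_ae h1, Lp.norm_def, ENNReal.ofReal_toReal (Lp.eLpNorm_ne_top _)]

theorem memLp_ba_graph (x : graphSpace (d := d) p) : MemLp (ba x.1.2) p volume :=
  ⟨(continuous_ba _).aestronglyMeasurable, by
    rw [eLpNorm_ba_graph]
    exact ENNReal.ofReal_lt_top⟩

theorem memLp_ba_prop (t : ℝ) {f : L2 d} (hf : MemLp (ba f) p volume) :
    MemLp (ba (prop t f)) p volume := by
  have h : ba (prop t f) = fun z => Complex.exp (-(Complex.I * d * t)) * ba f (rot (2 * t) z) :=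
    funext (ba_prop t f)
  rw [h]
  exact (hf.comp_measurePreserving (measurePreserving_rot (2 * t))).const_mul _

variable [Fact (1 ≤ p)]

theorem norm_fst_le_graph (x : graphSpace (d := d) p) : ‖x.1.1‖ ≤ ‖x‖ := norm_fst_le x.1

theorem norm_snd_le_graph (x : graphSpace (d := d) p) : ‖x.1.2‖ ≤ ‖x‖ := norm_snd_le x.1

theorem norm_graphMk_le {f : L2 d} {hf : MemLp (ba f) p volume} {C : ℝ} (hC : 0 ≤ C)
    (h1 : eLpNorm (ba f) p volume ≤ ENNReal.ofReal C) (h2 : ‖f‖ ≤ C) : ‖graphMk f hf‖ ≤ C := by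
  refine max_le ?_ h2
  change ‖hf.toLp‖ ≤ C
  rw [Lp.norm_toLp]
  exact ENNReal.toReal_le_of_le_ofReal hC h1

theorem toLp_ba_prop (t : ℝ) (x : graphSpace (d := d) p) :
    (memLp_ba_prop t (memLp_ba_graph x)).toLp = rotL p t x.1.1 := by
  refine Lp.ext ?_
  have h1 : (x.1.1 : PS d → ℂ) =ᵐ[volume] ba x.1.2 := x.2
  filter_upwards [(memLp_ba_prop t (memLp_ba_graph x)).coeFn_toLp, coeFn_rotL p t x.1.1,
    (measurePreserving_rot (2 * t)).quasiMeasurePreserving.ae h1] with z h2 h3 h4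
  rw [h2, h3, h4, ba_prop]

/-- The propagator on the graph space. -/
def graphProp (t : ℝ) : graphSpace (d := d) p →L[ℂ] graphSpace (d := d) p :=
  LinearMap.mkContinuous
    { toFun := fun x => graphMk (prop t x.1.2) (memLp_ba_prop t (memLp_ba_graph x))
      map_add' := fun x y => graph_ext (map_add (prop t) x.1.2 y.1.2)
      map_smul' := fun c x => graph_ext (map_smul (prop t) c x.1.2) } 1 fun x => by
    rw [one_mul]
    refine max_le ?_ ((norm_prop t x.1.2).le.trans (norm_snd_le_graph x))
    change ‖(memLp_ba_prop t (memLp_ba_graph x)).toLp‖ ≤ ‖x‖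
    rw [toLp_ba_prop, norm_rotL]
    exact norm_fst_le_graph x

theorem graphProp_snd (t : ℝ) (x : graphSpace (d := d) p) :
    (graphProp t x).1.2 = prop t x.1.2 := rfl

theorem graphProp_fst (t : ℝ) (x : graphSpace (d := d) p) :
    (graphProp t x).1.1 = rotL p t x.1.1 := toLp_ba_prop t x

theorem norm_graphProp_le (t : ℝ) (x : graphSpace (d := d) p) : ‖graphProp t x‖ ≤ ‖x‖ := by
  refine max_le ?_ ?_
  · change ‖(graphProp t x).1.1‖ ≤ ‖x‖
    rw [graphProp_fst, norm_rotL]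
    exact norm_fst_le_graph x
  · change ‖(graphProp t x).1.2‖ ≤ ‖x‖
    rw [graphProp_snd, norm_prop]
    exact norm_snd_le_graph x

theorem continuous_graphProp_apply (hp : p ≠ ∞) {x : ℝ → graphSpace (d := d) p}
    (hx : Continuous x) {σ : ℝ → ℝ} (hσ : Continuous σ) :
    Continuous fun t => graphProp (σ t) (x t) := by
  have h : Continuous fun a : ℝ × graphSpace (d := d) p => graphProp a.1 a.2 := by
    refine continuous_prod_of_continuous_lipschitzWith' _ 1 (fun t => ?_) fun x => ?_
    · refine LipschitzWith.of_dist_le_mul fun x y => ?_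
      rw [NNReal.coe_one, one_mul, dist_eq_norm, dist_eq_norm, ← map_sub]
      exact norm_graphProp_le t _
    · refine Continuous.subtype_mk (f := fun t => (graphProp t x).1) ?_ _
      refine Continuous.prodMk (f := fun t => (graphProp t x).1.1)
        (g := fun t => (graphProp t x).1.2) ?_ ?_
      · simp only [graphProp_fst]
        exact continuous_rotL p hp x.1.1
      · simp only [graphProp_snd]
        exact continuous_prop x.1.2
  have h' : Continuous fun t => (σ t, x t) := hσ.prodMk hx
  exact Continuous.comp' (g := fun a : ℝ × graphSpace (d := d) p => graphProp a.1 a.2)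
    (f := fun t => (σ t, x t)) h h'

namespace Potential

variable (P : Potential d)

theorem modBound_nonneg : 0 ≤ P.modBound := ENNReal.toReal_nonneg

theorem memLp_ba_mult (hp : p ≠ ∞) (f h : L2 d) {u : L2 d} (hu : MemLp (ba u) p volume) :
    MemLp (ba (P.mult f h u)) p volume :=
  ⟨(continuous_ba _).aestronglyMeasurable,
    (P.eLpNorm_ba_mult_le f h u Fact.out hp).trans_lt
      (ENNReal.mul_lt_top ENNReal.ofReal_lt_top hu.2)⟩

/-- The bound of the Hartree multiplier on the graph space. -/
def graphBound : ℝ := max P.modBound P.bound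

theorem graphBound_nonneg : 0 ≤ P.graphBound := P.bound_nonneg.trans (le_max_right _ _)

theorem norm_graphMk_mult_le (hp : p ≠ ∞) (f h : L2 d) (x : graphSpace (d := d) p) :
    ‖graphMk (P.mult f h x.1.2) (P.memLp_ba_mult hp f h (memLp_ba_graph x))‖ ≤
      P.graphBound * (‖f‖ * ‖h‖) * ‖x‖ := by
  have h0 := P.graphBound_nonneg
  refine norm_graphMk_le (by positivity) ?_ ?_
  · refine (P.eLpNorm_ba_mult_le f h x.1.2 Fact.out hp).trans ?_
    have h1 := P.modBound_nonneg
    rw [eLpNorm_ba_graph, ← ENNReal.ofReal_mul (by positivity)]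
    refine ENNReal.ofReal_le_ofReal ?_
    exact mul_le_mul (mul_le_mul_of_nonneg_right (le_max_left _ _) (by positivity))
      (norm_fst_le_graph x) (norm_nonneg _) (by positivity)
  · refine (P.norm_mult_le f h x.1.2).trans ?_
    exact mul_le_mul (mul_le_mul_of_nonneg_right (le_max_right _ _) (by positivity))
      (norm_snd_le_graph x) (norm_nonneg _) (by positivity)

/-- The Hartree multiplier on the graph space. -/
def graphMult (hp : p ≠ ∞) (f h : L2 d) : graphSpace (d := d) p →L[ℂ] graphSpace (d := d) p :=
  LinearMap.mkContinuous
    { toFun := fun x => graphMk (P.mult f h x.1.2) (P.memLp_ba_mult hp f h (memLp_ba_graph x))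
      map_add' := fun x y => graph_ext (map_add (P.mult f h) x.1.2 y.1.2)
      map_smul' := fun c x => graph_ext (map_smul (P.mult f h) c x.1.2) }
    (P.graphBound * (‖f‖ * ‖h‖)) (P.norm_graphMk_mult_le hp f h)

theorem norm_graphMult_le (hp : p ≠ ∞) (f h : L2 d) (x : graphSpace (d := d) p) :
    ‖P.graphMult hp f h x‖ ≤ P.graphBound * (‖f‖ * ‖h‖) * ‖x‖ :=
  P.norm_graphMk_mult_le hp f h x

theorem continuous_graphMult (hp : p ≠ ∞) :
    Continuous fun a : L2 d × L2 d × graphSpace (d := d) p =>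
      P.graphMult hp a.1 a.2.1 a.2.2 :=
  continuous_trilinear (M := fun f h x => P.graphMult hp f h x)
    (fun f f' h x => graph_ext (P.mult_sub_left f f' h x.1.2))
    (fun f h h' x => graph_ext (P.mult_sub_right f h h' x.1.2))
    (fun f h => map_sub (P.graphMult hp f h)) (P.norm_graphMult_le hp)

/-- With the known `L²` solution frozen in the potential, the equation is linear, and its
coefficients are bounded by the conserved mass. Its solution in the graph space is thus global, so
the modulation norm cannot blow up. -/
theorem exists_graph_lift (hp : p ≠ ∞) {w : ℝ → L2 d} {w₀ : L2 d} (hw : Continuous w)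
    (hw0 : w 0 = w₀) (hm : ∀ t, ‖w t‖ = ‖w₀‖)
    (hwd : ∀ t, 0 ≤ t → HasDerivWithinAt w (P.field t (w t)) (Set.Ici 0) t)
    (h0 : MemLp (ba w₀) p volume) :
    ∃ x : ℝ → graphSpace (d := d) p, Continuous x ∧ ∀ t, 0 ≤ t → (x t).1.2 = w t := by
  set u : ℝ → L2 d := fun t => prop t (w t) with hu
  have huc : Continuous u := continuous_prop_apply hw continuous_id
  have hun : ∀ t, ‖u t‖ = ‖w₀‖ := fun t => by rw [hu, norm_prop, hm]
  set F : ℝ → graphSpace (d := d) p → graphSpace (d := d) p := fun t x =>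
    -Complex.I • graphProp (-t) (P.graphMult hp (u t) (u t) (graphProp t x)) with hF
  set f : ℝ → L2 d → L2 d := fun t y => -Complex.I • prop (-t) (P.mult (u t) (u t) (prop t y))
    with hf
  have hFsub : ∀ t x y, F t x - F t y = F t (x - y) := fun t x y => by
    simp only [hF, map_sub, smul_sub]
  have hFc : ∀ x, Continuous fun t => F t x := by
    intro x
    have h1 : Continuous fun t => P.graphMult hp (u t) (u t) (graphProp t x) :=
      Continuous.comp' (g := fun a : L2 d × L2 d × graphSpace (d := d) p =>
        P.graphMult hp a.1 a.2.1 a.2.2) (f := fun t => (u t, u t, graphProp t x))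
        (P.continuous_graphMult hp)
        (huc.prodMk (huc.prodMk (continuous_graphProp_apply hp continuous_const continuous_id)))
    exact (continuous_graphProp_apply hp h1 continuous_neg).fun_const_smul _
  have hFL : ∀ t, LipschitzWith (Real.toNNReal (P.graphBound * (‖w₀‖ * ‖w₀‖))) (F t) := by
    intro t
    refine LipschitzWith.of_dist_le_mul fun x y => ?_
    have hC : 0 ≤ P.graphBound * (‖w₀‖ * ‖w₀‖) := mul_nonneg P.graphBound_nonneg (by positivity)
    rw [dist_eq_norm, dist_eq_norm, hFsub, Real.coe_toNNReal _ hC, hF, norm_smul, norm_neg,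
      Complex.norm_I, one_mul]
    refine (norm_graphProp_le _ _).trans ((P.norm_graphMult_le hp _ _ _).trans ?_)
    rw [hun]
    exact mul_le_mul_of_nonneg_left (norm_graphProp_le _ _) hC
  obtain ⟨x, hx, hx0, hxd⟩ := exists_global_solution hFL hFc
    (fun t => by simp only [hF, map_zero, smul_zero]) (graphMk w₀ h0)
  refine ⟨x, hx, fun t ht => ?_⟩
  set S : graphSpace (d := d) p →L[ℂ] L2 d :=
    (ContinuousLinearMap.snd ℂ (LZ d p) (L2 d)).comp (graphSpace p).subtypeL
  -- `P.field t (w t)` unfolds to `f t (w t)`, so `w` and the `L²` component solve the same linear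
  -- equation.
  refine solution_unique (f := f) (x := fun t => S (x t)) (S.continuous.comp hx) hw
    (fun R => ⟨Real.toNNReal (P.bound * (‖w₀‖ * ‖w₀‖)), fun t =>
      LipschitzOnWith.of_dist_le_mul fun y _ y' _ => ?_⟩) (fun t ht => ?_) hwd ?_ ht
  · have hC : 0 ≤ P.bound * (‖w₀‖ * ‖w₀‖) := mul_nonneg P.bound_nonneg (by positivity)
    rw [dist_eq_norm, dist_eq_norm, Real.coe_toNNReal _ hC, hf, neg_I_smul_prop_sub,
      norm_neg_I_smul_prop, ← map_sub, ← map_sub]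
    refine (P.norm_mult_le _ _ _).trans ?_
    rw [hun, norm_prop]
  · exact (S.hasFDerivAt.restrictScalars ℝ).comp_hasDerivWithinAt t (hxd t ht)
  · change (x 0).1.2 = w 0
    rw [hx0, hw0]
    rfl

end Potential

end Persistence

/-! ### The Cauchy problem -/

section Cauchy

open LineDeriv

variable {d : ℕ}

theorem lineDeriv_conjS (φ : 𝓢(Rd d, ℂ)) (v : Rd d) : ∂_{v} (conjS φ) = conjS (∂_{v} φ) := by
  ext s
  have h1 := hasDerivAt_schwartz_line (conjS φ) s v
  have h2 : HasDerivAt (fun r : ℝ => conjS φ (s + r • v)) (conj (∂_{v} φ s)) 0 :=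
    (Complex.conjCLE.toContinuousLinearMap.hasFDerivAt).comp_hasDerivAt (0 : ℝ)
      (hasDerivAt_schwartz_line φ s v)
  rw [h1.unique h2, conjS_apply]

theorem conjS_oscS (φ : 𝓢(Rd d, ℂ)) : conjS (oscS φ) = oscS (conjS φ) := by
  ext s
  have e := EuclideanSpace.basisFun (Fin d) ℝ
  rw [conjS_apply, oscS_apply, oscS_apply, SchwartzMap.laplacian_eq_sum e,
    SchwartzMap.laplacian_eq_sum e]
  simp only [sum_apply, lineDeriv_conjS, conjS_apply, map_add, map_neg, map_mul, map_sum,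
    Complex.conj_ofReal]

theorem dist2_injective : Function.Injective (dist2 : L2 d → 𝓢'(Rd d, ℂ)) := fun f h hfh =>
  ba_injective fun z => by
    rw [← zbar_zbar z, ← dist2_coh, ← dist2_coh, hfh]

theorem harmonicOscillator_dist2_apply (f : L2 d) (φ : 𝓢(Rd d, ℂ)) :
    harmonicOscillator (dist2 f) φ = inner ℂ ((oscS (conjS φ)).toLp 2 : L2 d) f := by
  rw [harmonicOscillator_apply, dist2_apply_eq_inner, conjS_oscS]

/-- The generator commutes with its group: differentiate `s ↦ prop (s + t) f` at 0 in two ways. -/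
theorem prop_generator_eq {f g h k : L2 d} {t : ℝ}
    (hf : HasDerivAt (fun s => prop s f) (-Complex.I • prop t g) t)
    (hh : HasDerivAt (fun s => prop s h) (-Complex.I • prop 0 k) 0) (hfh : prop t f = h) :
    prop t g = k := by
  have h1 : (fun s => prop s h) = fun s => prop (s + t) f := by
    ext1 s
    rw [← hfh, ← prop_add]
  have h2 : HasDerivAt (fun s => prop (s + t) f) (-Complex.I • prop t g) 0 :=
    HasDerivAt.comp_add_const (f := fun s => prop s f) 0 t (by rwa [zero_add])
  rw [h1] at hh
  have h3 := hh.unique h2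
  rw [prop_zero] at h3
  exact (smul_right_injective _ (neg_ne_zero.2 Complex.I_ne_zero) h3).symm

namespace Potential

variable (P : Potential d)

theorem conj_mul_self (f : Rd d → ℂ) (y : Rd d) :
    conj (f y) * f y = ((‖f y‖ ^ 2 : ℝ) : ℂ) := by
  rw [← Complex.normSq_eq_conj_mul_self, Complex.normSq_eq_norm_sq]

theorem convolution_eq_W (f : Rd d → ℂ) (x : Rd d) :
    ((fun s => (P.k s : ℂ)) ⋆[ContinuousLinearMap.mul ℂ ℂ, volume]
      (fun y => ((‖f y‖ ^ 2 : ℝ) : ℂ))) x = P.W f f x := by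
  rw [convolution_eq_swap, W]
  simp only [conj_mul_self, ContinuousLinearMap.mul_apply']

theorem convolutionExistsAt (f : L2 d) (x : Rd d) :
    ConvolutionExistsAt (fun s => (P.k s : ℂ)) (fun y => ((‖f y‖ ^ 2 : ℝ) : ℂ)) x
      (ContinuousLinearMap.mul ℂ ℂ) volume := by
  have h := (P.integrable_k_mul (integrable_conj_mul f f) x).comp_sub_left x
  simpa only [ConvolutionExistsAt, conj_mul_self, ContinuousLinearMap.mul_apply',
    sub_sub_cancel] using h

variable {P} {K : 𝓢'(Rd d, ℂ)}

theorem isHartree_dist2 (hK : IsFunction K fun s => (P.k s : ℂ)) (f : L2 d) :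
    IsHartree K (dist2 f) (dist2 (P.hartree f)) := by
  refine ⟨fun s => (P.k s : ℂ), f, hK, isFunction_dist2 f,
    ae_of_all _ (P.convolutionExistsAt f), ?_⟩
  simp only [convolution_eq_W]
  exact (isFunction_dist2 _).congr (P.coeFn_mult f f f)

/-- Representing functions are unique almost everywhere and the convolution ignores null sets, so
the nonlinearity does not depend on the functions chosen in `IsHartree`. -/
theorem isHartree_dist2_unique (hK : IsFunction K fun s => (P.k s : ℂ)) {f : L2 d}
    {N : 𝓢'(Rd d, ℂ)} (h : IsHartree K (dist2 f) N) :
    N = dist2 (P.hartree f) := by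
  obtain ⟨k', f', hk', hf', -, hN⟩ := h
  have h1 : k' =ᵐ[volume] fun s => (P.k s : ℂ) := hk'.ae_eq hK
  have h2 : f' =ᵐ[volume] f := hf'.ae_eq (isFunction_dist2 f)
  have h3 : (fun y => ((‖f' y‖ ^ 2 : ℝ) : ℂ)) =ᵐ[volume] fun y => ((‖f y‖ ^ 2 : ℝ) : ℂ) := by
    filter_upwards [h2] with y hy
    rw [hy]
  rw [convolution_congr (ContinuousLinearMap.mul ℂ ℂ) h1 h3] at hN
  simp only [convolution_eq_W] at hN
  have h4 : IsFunction N (P.hartree f) := by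
    refine hN.congr ?_
    filter_upwards [P.coeFn_mult f f f, h2] with x h5 h6
    rw [hartree, h5, h6]
  ext φ
  rw [(h4.2 φ).2, dist2_apply]

/-- The propagator is moved onto the Schwartz test function, where it is differentiable; the product
rule then needs differentiability of `w` only, not of `prop t (w t)` in `L²`. -/
theorem isGlobalSolution_of_flow (hK : IsFunction K fun s => (P.k s : ℂ))
    {w : ℝ → L2 d}
    (hw : ∀ t, 0 ≤ t → HasDerivWithinAt w (P.field t (w t)) (Set.Ici 0) t) :
    IsGlobalSolution K (dist2 (w 0)) fun t => dist2 (prop t (w t)) := by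
  refine ⟨by simp only [prop_zero], fun t ht => ⟨-Complex.I • (dist2 (P.hartree (prop t (w t))) +
    harmonicOscillator (dist2 (prop t (w t)))), dist2 (P.hartree (prop t (w t))), fun φ => ?_,
    isHartree_dist2 hK _, ?_⟩⟩
  · have h1 : HasDerivAt (fun s : ℝ => prop (-s) ((conjS φ).toLp 2 : L2 d))
        (Complex.I • prop (-t) ((oscS (conjS φ)).toLp 2 : L2 d)) t := by
      have h2 := (hasDerivAt_prop (conjS φ) (-t)).scomp t (hasDerivAt_neg t)
      refine h2.congr_deriv ?_
      rw [neg_smul, neg_smul, one_smul, neg_neg]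
    have h3 := (h1.hasDerivWithinAt (s := Set.Ici 0)).inner ℂ (hw t ht)
    have h4 : (fun s => dist2 (prop s (w s)) φ) =
        fun s => inner ℂ (prop (-s) ((conjS φ).toLp 2 : L2 d)) (w s) := by
      ext1 s
      rw [dist2_apply_eq_inner, inner_prop_right]
    rw [h4]
    refine h3.congr_deriv ?_
    rw [smul_apply, add_apply, harmonicOscillator_dist2_apply, dist2_apply_eq_inner, field,
      inner_smul_right, inner_smul_left, inner_prop_prop, inner_prop_right, Complex.conj_I,
      smul_eq_mul]
    ring
  · rw [smul_smul, mul_neg, Complex.I_mul_I, neg_neg, one_smul, add_sub_cancel_right]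

/-! ### From distributional solutions to the integral equation -/

theorem hasDerivWithinAt_inner_of_eq_zero {G f : ℝ → L2 d} {S : Set ℝ} {t : ℝ} {D : L2 d}
    (hG : HasDerivWithinAt G D S t) (hG0 : G t = 0) (hf : ContinuousWithinAt f S t) :
    HasDerivWithinAt (fun s => inner ℂ (G s) (f s)) (inner ℂ D (f t)) S t := by
  rw [hasDerivWithinAt_iff_tendsto_slope] at hG ⊢
  have h1 : Tendsto f (𝓝[S \ {t}] t) (𝓝 (f t)) := hf.mono_left (nhdsWithin_mono _ Set.sdiff_subset)
  refine (hG.inner (𝕜 := ℂ) h1).congr fun s => ?_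
  rw [slope_def_module, slope_def_module, hG0, sub_zero, inner_zero_left, sub_zero,
    RCLike.real_smul_eq_coe_smul (K := ℂ), inner_smul_left, RCLike.conj_ofReal,
    RCLike.real_smul_eq_coe_smul (K := ℂ), smul_eq_mul]

/-- A solution is only continuous in `L²` and weakly differentiable, so the product rule is not
directly available. Splitting off `Ψ`, the value at time `t` of the moving test vector, leaves a
factor that vanishes there, and then continuity of `f` suffices. -/
theorem hasDerivWithinAt_inner_prop_neg {c Ψ Ω h : L2 d} {f : ℝ → L2 d} {S : Set ℝ} {t : ℝ}
    {D : ℂ} (hc : HasDerivAt (fun s => prop s c) (-Complex.I • Ω) t) (hΨ : prop t c = Ψ)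
    (hf : ContinuousWithinAt f S t) (hD : HasDerivWithinAt (fun s => inner ℂ Ψ (f s)) D S t)
    (hDe : Complex.I * D - inner ℂ Ω (f t) = inner ℂ Ψ h) :
    HasDerivWithinAt (fun s => inner ℂ c (prop (-s) (f s)))
      (inner ℂ c (-Complex.I • prop (-t) h)) S t := by
  have h1 : HasDerivWithinAt (fun s => inner ℂ (prop s c - Ψ) (f s))
      (inner ℂ (-Complex.I • Ω) (f t)) S t :=
    hasDerivWithinAt_inner_of_eq_zero (hc.sub_const _).hasDerivWithinAt
      (by rw [hΨ, sub_self]) hf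
  have h2 : (fun s => inner ℂ c (prop (-s) (f s))) = fun s =>
      inner ℂ (prop s c - Ψ) (f s) + inner ℂ Ψ (f s) := by
    ext1 s
    rw [← inner_add_left, sub_add_cancel, inner_prop_right, neg_neg]
  rw [h2]
  refine (h1.fun_add hD).congr_deriv ?_
  rw [inner_smul_right, inner_prop_right, neg_neg, hΨ, inner_smul_left, map_neg, Complex.conj_I,
    ← hDe]
  linear_combination D * Complex.I_mul_I

theorem hasDerivWithinAt_ba_of_solution (hK : IsFunction K fun s => (P.k s : ℂ))
    {u₀ : 𝓢'(Rd d, ℂ)} {f : ℝ → L2 d} (hf : Continuous f)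
    {v : ℝ → 𝓢'(Rd d, ℂ)} (hv : IsGlobalSolution K u₀ v) (hvf : ∀ t, 0 ≤ t → v t = dist2 (f t))
    (z : PS d) {t : ℝ} (ht : 0 ≤ t) :
    HasDerivWithinAt (fun s => ba (prop (-s) (f s)) z)
      (ba (P.field t (prop (-t) (f t))) z) (Set.Ici 0) t := by
  obtain ⟨W, N, hW, hN, hWN⟩ := hv.2 t ht
  rw [hvf t ht] at hN hWN
  rw [isHartree_dist2_unique hK hN] at hWN
  have hψ : prop t (cohL z) = ((cohFlow z t).toLp 2 : L2 d) := by
    rw [prop_cohL]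
    exact (map_smul (SchwartzMap.toLpCLM ℂ ℂ 2 (volume : Measure (Rd d))) _ _).symm
  have hd := hasDerivAt_prop (coh z) t
  -- The derivative of the evolved coherent state is thereby expressed through `oscS` of a Schwartz
  -- function, to which the distributional equation applies.
  rw [prop_generator_eq hd (hasDerivAt_prop (cohFlow z t) 0) hψ] at hd
  have h2 : HasDerivWithinAt (fun s => inner ℂ ((cohFlow z t).toLp 2 : L2 d) (f s))
      (W (conjS (cohFlow z t))) (Set.Ici 0) t := by
    refine (hW (conjS (cohFlow z t))).congr (fun s hs => ?_) ?_
    · rw [hvf s hs, dist2_apply_eq_inner, conjS_conjS]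
    · rw [hvf t ht, dist2_apply_eq_inner, conjS_conjS]
  have h3 : Complex.I * W (conjS (cohFlow z t)) -
      inner ℂ ((oscS (cohFlow z t)).toLp 2 : L2 d) (f t) =
      inner ℂ ((cohFlow z t).toLp 2 : L2 d) (P.hartree (f t)) := by
    have h4 : (Complex.I • W - harmonicOscillator (dist2 (f t))) (conjS (cohFlow z t)) =
        dist2 (P.hartree (f t)) (conjS (cohFlow z t)) := by rw [hWN]
    rwa [sub_apply, smul_apply, harmonicOscillator_dist2_apply, dist2_apply_eq_inner, conjS_conjS,
      smul_eq_mul] at h4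
  have h5 := hasDerivWithinAt_inner_prop_neg hd hψ hf.continuousWithinAt h2 h3
  simp only [ba_eq_inner, field, prop_prop_neg]
  exact h5

theorem solution_eq_flow (hK : IsFunction K fun s => (P.k s : ℂ))
    {w : ℝ → L2 d} (hwc : Continuous w)
    (hw : ∀ t, 0 ≤ t → HasDerivWithinAt w (P.field t (w t)) (Set.Ici 0) t)
    {f : ℝ → L2 d} (hf : Continuous f) {v : ℝ → 𝓢'(Rd d, ℂ)}
    (hv : IsGlobalSolution K (dist2 (w 0)) v) (hvf : ∀ t, 0 ≤ t → v t = dist2 (f t))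
    {t : ℝ} (ht : 0 ≤ t) : v t = dist2 (prop t (w t)) := by
  set y : ℝ → L2 d := fun s => prop (-s) (f s) with hy
  have hyc : Continuous y := continuous_prop_apply hf continuous_neg
  have hec : Continuous fun s => P.field s (y s) := P.continuous_field hyc
  have hint : ∀ s, 0 ≤ s → y s = y 0 + ∫ r in (0 : ℝ)..s, P.field r (y r) := fun s hs =>
    eq_add_integral_of_ba hec (convex_Ici 0) (Set.mem_Ici.2 le_rfl)
      (fun z r hr => hasDerivWithinAt_ba_of_solution hK hf hv hvf z hr) (Set.mem_Ici.2 hs)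
  have h0 : w 0 = y 0 := by
    simp only [hy, neg_zero, prop_zero]
    exact dist2_injective (hv.1.symm.trans (hvf 0 le_rfl))
  rw [solution_unique hwc hyc P.exists_lipschitzOnWith_field hw
    (fun s hs => hasDerivWithinAt_of_integral_eq hec hint hs) h0 ht, hy, prop_prop_neg, hvf t ht]

end Potential

/-- A curve in a modulation space with exponent at most two is a continuous curve in `L²`. -/
theorem exists_continuous_L2 {g : 𝓢(Rd d, ℂ)} (hg : g ≠ 0) {p : ℝ≥0∞} (hp : 1 ≤ p) (hp2 : p ≤ 2)
    {v : ℝ → 𝓢'(Rd d, ℂ)} (hv : ContinuousInModSpace g p p v) :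
    ∃ f : ℝ → L2 d, Continuous f ∧ ∀ t, 0 ≤ t → v t = dist2 (f t) := by
  obtain ⟨C, hC, hCT⟩ := exists_eLpNorm_coh_le_modNorm hg hp hp2
  -- Evaluating at `max t 0` gives a curve continuous on the whole line, independent of the
  -- arbitrary values at negative times.
  have hex : ∀ t : ℝ, ∃ f : L2 d, v (max t 0) = dist2 f := fun t => exists_eq_dist2
    ((hCT _).2.trans_lt (ENNReal.mul_lt_top hC.lt_top (hv.1 _ (le_max_right _ _))))
  choose f hf using hex
  refine ⟨f, ?_, fun t ht => by rw [← hf, max_eq_left ht]⟩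
  refine continuous_iff_continuousAt.2 fun t => ?_
  have hmax : Tendsto (fun s : ℝ => max s 0) (𝓝 t) (𝓝[Set.Ici 0] (max t 0)) :=
    tendsto_nhdsWithin_iff.2 ⟨(by fun_prop : Continuous fun s : ℝ => max s 0).tendsto t,
      Eventually.of_forall fun s => Set.mem_Ici.2 (le_max_right _ _)⟩
  have h1 : Tendsto (fun s => C * modNorm g p p (v (max s 0) - v (max t 0))) (𝓝 t) (𝓝 0) := by
    have h := ENNReal.Tendsto.const_mul ((hv.2 _ (le_max_right t 0)).comp hmax) (Or.inr hC)
    simpa using h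
  have h2 : Tendsto (fun s => ENNReal.ofReal (√(moyal d) * ‖f s - f t‖)) (𝓝 t) (𝓝 0) := by
    refine tendsto_of_tendsto_of_tendsto_of_le_of_le tendsto_const_nhds h1 (fun _ => zero_le)
      fun s => ?_
    dsimp only
    rw [← eLpNorm_ba, ← eLpNorm_dist2_coh, map_sub, ← hf, ← hf]
    exact (hCT _).2
  have h3 : Tendsto (fun s => √(moyal d) * ‖f s - f t‖) (𝓝 t) (𝓝 0) := by
    have h := (ENNReal.tendsto_toReal ENNReal.zero_ne_top).comp h2
    simpa [Function.comp_def, ENNReal.toReal_ofReal, Real.sqrt_nonneg, mul_nonneg] using h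
  rw [ContinuousAt, tendsto_iff_norm_sub_tendsto_zero]
  have h4 := h3.const_mul (√(moyal d))⁻¹
  simpa [inv_mul_cancel_left₀ (Real.sqrt_ne_zero'.2 (moyal_pos (d := d)))] using h4

/-- The graph norm dominates the `L^p` norm of the transform, hence the modulation norm for any
window; linearity of the graph space handles differences. -/
theorem continuousInModSpace_of_graph (g : 𝓢(Rd d, ℂ)) {p : ℝ≥0∞} [Fact (1 ≤ p)] (hp' : p ≠ ∞)
    {y : ℝ → graphSpace (d := d) p} (hy : Continuous y) {u : ℝ → L2 d}
    (hu : ∀ t, 0 ≤ t → (y t).1.2 = u t) : ContinuousInModSpace g p p fun t => dist2 (u t) := by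
  obtain ⟨C, hC, hCT⟩ := exists_modNorm_le_eLpNorm_coh g (Fact.out : 1 ≤ p) hp'
  have hb : ∀ x : graphSpace (d := d) p,
      modNorm g p p (dist2 x.1.2) ≤ C * ENNReal.ofReal ‖x.1.1‖ := fun x => by
    rw [← eLpNorm_ba_graph, ← eLpNorm_dist2_coh]
    exact hCT _
  refine ⟨fun t ht => ?_, fun t ht => ?_⟩
  · change modNorm g p p (dist2 (u t)) < ∞
    rw [← hu t ht]
    exact (hb _).trans_lt (ENNReal.mul_lt_top hC.lt_top ENNReal.ofReal_lt_top)
  · have h1 : Tendsto (fun s => C * ENNReal.ofReal ‖y s - y t‖) (𝓝[Set.Ici 0] t) (𝓝 0) := by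
      have h2 : Tendsto (fun s => ‖y s - y t‖) (𝓝[Set.Ici 0] t) (𝓝 0) :=
        (tendsto_iff_norm_sub_tendsto_zero.1 (hy.tendsto t)).mono_left nhdsWithin_le_nhds
      have h := ENNReal.Tendsto.const_mul (ENNReal.tendsto_ofReal h2) (Or.inr hC)
      simpa using h
    refine tendsto_of_tendsto_of_tendsto_of_le_of_le' tendsto_const_nhds h1
      (Eventually.of_forall fun _ => zero_le) ?_
    filter_upwards [self_mem_nhdsWithin] with s hs
    rw [← hu s hs, ← hu t ht, ← map_sub]
    refine (hb (y s - y t)).trans ?_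
    gcongr
    exact norm_fst_le_graph _

end Cauchy

end

end HarmonicNLS

/-! ### The main theorem -/

theorem theorem1p2 (d : ℕ) (hd : 1 ≤ d)
    -- the window that defines the modulation spaces
    (g : 𝓢(HarmonicNLS.Rd d, ℂ)) (hg : g ≠ 0)
    (p : ℝ≥0∞) (hp1 : 1 ≤ p) (hp2 : p ≤ 2)
    (K : 𝓢'(HarmonicNLS.Rd d, ℂ)) (hK : K ∈ HarmonicNLS.modSpace g ∞ 1)
    (hKreal : HarmonicNLS.IsReal K)
    (u₀ : 𝓢'(HarmonicNLS.Rd d, ℂ)) (hu₀ : u₀ ∈ HarmonicNLS.modSpace g p p) :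
    ∃ u : ℝ → 𝓢'(HarmonicNLS.Rd d, ℂ),
      (HarmonicNLS.ContinuousInModSpace g p p u ∧ HarmonicNLS.IsGlobalSolution K u₀ u) ∧
      ∀ v : ℝ → 𝓢'(HarmonicNLS.Rd d, ℂ),
        HarmonicNLS.ContinuousInModSpace g p p v → HarmonicNLS.IsGlobalSolution K u₀ v →
        ∀ t, 0 ≤ t → v t = u t := by
  have : Fact (1 ≤ p) := ⟨hp1⟩
  have hp' : p ≠ ∞ := (hp2.trans_lt (by simp)).ne
  obtain ⟨P, hP⟩ := HarmonicNLS.exists_potential hg hK hKreal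
  obtain ⟨C, hC, hCT⟩ := HarmonicNLS.exists_eLpNorm_coh_le_modNorm hg hp1 hp2
  have hfin : C * HarmonicNLS.modNorm g p p u₀ < ∞ := ENNReal.mul_lt_top hC.lt_top hu₀
  obtain ⟨w₀, rfl⟩ := HarmonicNLS.exists_eq_dist2 ((hCT u₀).2.trans_lt hfin)
  have hw₀ : MemLp (HarmonicNLS.ba w₀) p volume :=
    ⟨(HarmonicNLS.continuous_ba w₀).aestronglyMeasurable, by
      rw [← HarmonicNLS.eLpNorm_dist2_coh]
      exact (hCT _).1.trans_lt hfin⟩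
  obtain ⟨w, hwc, hw0, hwm, hwd⟩ := P.exists_flow w₀
  obtain ⟨x, hx, hxw⟩ := P.exists_graph_lift hp' hwc hw0 hwm hwd hw₀
  refine ⟨fun t => HarmonicNLS.dist2 (HarmonicNLS.prop t (w t)), ⟨?_, ?_⟩, fun v hv hvs t ht => ?_⟩
  · refine HarmonicNLS.continuousInModSpace_of_graph g hp'
      (HarmonicNLS.continuous_graphProp_apply hp' hx continuous_id) fun t ht => ?_
    rw [HarmonicNLS.graphProp_snd, hxw t ht, id]
  · rw [← hw0]
    exact HarmonicNLS.Potential.isGlobalSolution_of_flow hP hwd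
  -- As `p ≤ 2`, every competitor is a continuous `L²` curve, so the comparison takes place in `L²`.
  · obtain ⟨f, hf, hvf⟩ := HarmonicNLS.exists_continuous_L2 hg hp1 hp2 hv
    rw [← hw0] at hvs
    exact HarmonicNLS.Potential.solution_eq_flow hP hwc hwd hf hvs hvf ht
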